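/- All logarithms $\log$ are to base 2 and $\exp$ is the natural exponential. **Model.** Let $n,p,Q\in\mathbb Z_{>0}$, $R,c>0$, $\sigma\ge 0$. The entries of $X\in\mathbb R^{n\times p}$ are iid with a distribution $\mathcal C$ that has a density $f$ with $\|f\|_\infty\le c$ and a finite first moment $\mathbb E|V|\le M$, $V\sim\mathcal C$. The vector $\beta^*\in[-R,R]^p$ satisfies $Q\beta^*\in\mathbb Z^p$. The entries of $W\in\mathbb R^n$ are iid with a distribution of mean zero and variance at most $\sigma^2$, and $W$ is independent of $X$. We observe $X$ and $Y=X\beta^*+W$. **Algorithm ELO**, with input $Y\in\mathbb Z^n$, $X\in\mathbb Z^{n\times p}$, $\hat R,\hat W\in\mathbb Z_{>0}$. (0) Draw $Z\in\mathbb Z^p$ with iid entries uniform on $\{\hat R+1,\dots,2\hat R+\lfloor\log p\rfloor\}$, independent of everything else. (1) $Y_1=Y+XZ$. (2) $(Y_2)_i=3$ if $|(Y_1)_i|<3$, and $(Y_2)_i=(Y_1)_i$ otherwise. (3) $m=2^{n+\lceil p/2\rceil+3}\,p\,(\hat R\lceil\sqrt p\rceil+\hat W\lceil\sqrt n\rceil)$.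 (4) Run the LLL basis reduction algorithm (Lovász parameter $3/4$) on the columns of $$A_m=\begin{pmatrix} mX & -m\,\mathrm{Diag}(Y_2) & mI_n\\ I_p&0&0\\ 0&0&I_n\end{pmatrix}$$ and let $\hat z\in\mathbb Z^{2n+p}$ be the first vector of the reduced basis. (5) Let $g$ be the greatest common divisor of $\hat z_{n+1},\dots,\hat z_{n+p}$ computed by Euclid's algorithm with remainders rounded towards zero (so $g$ carries a sign: for integers $\hat z_{n+j}=q b_j$ with all $b_j>0$ it is $g=q\gcd(b_1,\dots,b_p)$). (6) If $g\ne0$ output $\frac1g(\hat z_{n+1},\dots,\hat z_{n+p})-Z$, otherwise output $0$. **Algorithm LBR**, with input $(Y,X,N,\hat Q,\hat R,\hat W)$, where $Y,X$ are real, $N,\hat Q,\hat R\in\mathbb Z_{>0}$ and $\hat W>0$ is real. Let $x_N=\mathrm{sign}(x)\lfloor 2^N|x|\rfloor/2^N$, applied entrywise to $Y$ and $X$. Run ELO with input $\bigl(2^N\hat QY_N,\;2^NX_N,\;\hat Q\hat R,\;2\hat Q(\lceil 2^N\hat W\rceil+\hat Rp)\bigr)$ and output $1/\hat Q$ times its output.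 Time is the number of bit operations, the truncated entries being read bit by bit; it includes the LLL algorithm and Euclid's algorithm. (The noise $W$, the vector $Z$ and the matrix $X$ are random; probabilities below are with respect to all of them.) **Theorem.** There are absolute constants $\kappa>0$ and $D\in\mathbb N$, and for all $c>0$ and $M$ a constant $K=K(c,M)$, such that the following holds in the model above for all values of the other parameters. Suppose that $\hat Q$ is a multiple of $Q$, that $\hat R\ge R$, that $\hat W\ge\sqrt{np}\,\sigma$ (with $\hat W>0$), and that $$N>\tfrac12(2n+p)\Bigl(2n+p+10\log\hat Q+10\log\bigl(2^N\sqrt{np}\,\sigma+\hat Rp\bigr)+20\log\bigl(3(1+c)np\bigr)\Bigr).$$ Let $\mathcal E$ be the event that LBR with input $(Y,X,N,\hat Q,\hat R,\hat W)$ terminates with output $\hat\beta^*=\beta^*$ within time $D\,\bigl(n+p+N+\log\hat R+\max(0,\log\hat W)+\log\hat Q\bigr)^D$. Then $$\mathbb P(\mathcal E)\ge 1-\frac{K}{np}\quad\text{whenever } n\le e^{\kappa p},\qquad\text{and}\qquad \mathbb P(\mathcal E)\ge 1-K\Bigl(\frac1{np}+e^{-\kappa p}\Bigr)\quad\text{for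 all } n.$$ In particular LBR recovers $\beta^*$ exactly, in time polynomial in $n,p,N,\log\hat R,\log\hat W,\log\hat Q$, with high probability as $p\to\infty$. -/

import Mathlib

open MeasureTheory

/-! ### Step counting

Integer programs are written in the monad `Timed`: a value together with the number of bit
operations spent.  Every arithmetic operation or comparison with operands `x` and `y` is charged
`bits x * bits y` (an upper bound, up to a constant factor, for schoolbook arithmetic), every
loop iteration or table entry is charged at least one. -/

/-- The result of a computation together with its cost in bit operations. -/
structure Timed (α : Type) where
  val : α
  cost : ℕ

namespace Timed

instance : Monad Timed where
  pure a := ⟨a, 0⟩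
  bind x f := ⟨(f x.val).val, x.cost + (f x.val).cost⟩

@[simp] theorem val_pure {α : Type} (a : α) : (pure a : Timed α).val = a := rfl

@[simp] theorem cost_pure {α : Type} (a : α) : (pure a : Timed α).cost = 0 := rfl

@[simp] theorem val_bind {α β : Type} (x : Timed α) (f : α → Timed β) :
    (x >>= f).val = (f x.val).val := rfl

@[simp] theorem cost_bind {α β : Type} (x : Timed α) (f : α → Timed β) :
    (x >>= f).cost = x.cost + (f x.val).cost := rfl

/-- One plus the length of the binary expansion of `|x|`. -/
def bits (x : ℤ) : ℕ := x.natAbs.size + 1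

def add (x y : ℤ) : Timed ℤ := ⟨x + y, bits x * bits y⟩

def sub (x y : ℤ) : Timed ℤ := ⟨x - y, bits x * bits y⟩

def mul (x y : ℤ) : Timed ℤ := ⟨x * y, bits x * bits y⟩

/-- Division with remainder; for `0 < y` this is `⌊x / y⌋`. -/
def quo (x y : ℤ) : Timed ℤ := ⟨x / y, bits x * bits y⟩

/-- The comparison `x ≤ y`. -/
def le (x y : ℤ) : Timed Bool := ⟨decide (x ≤ y), bits x * bits y⟩

/-- Run `f 0, f 1, …, f (k - 1)` and store the results in a table. -/
def forEach {α : Type} {k : ℕ} (f : Fin k → Timed α) : Timed (Fin k → α) :=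
  ⟨fun i => (f i).val, k + ∑ i, (f i).cost⟩

/-- Run `f 0, f 1, …, f (k - 1)` and add up the results. -/
def sum {k : ℕ} (f : Fin k → Timed ℤ) : Timed ℤ :=
  (List.finRange k).foldlM (fun s i => do
    let t ← f i
    add s t) 0

def dot {d : ℕ} (u v : Fin d → ℤ) : Timed ℤ := sum fun t => mul (u t) (v t)

/-- `2 ^ e`, by repeated doubling. -/
def pow2 : ℕ → Timed ℤ
  | 0 => pure 1
  | e + 1 => do
    let x ← pow2 e
    mul 2 x

/-- `⌈√k⌉`, computed as the number of integers `a` with `0 ≤ a < k` and `a ^ 2 < k`. -/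
def ceilSqrt (k : ℕ) : Timed ℤ :=
  sum fun a : Fin k => do
    let s ← mul a.val a.val
    let large ← le k s
    pure (if large then 0 else 1)

/-! ### Euclid's algorithm -/

/-- Euclid's algorithm on integers: replace `(a, b)` by `(b, a rem b)` until `b = 0`, where
`a rem b` is the remainder of division rounded towards zero.  The result is a greatest common
divisor of `a` and `b`; on the pair `(q a, q b)` it returns `q` times its result on `(a, b)`. -/
def euclid (a b : ℤ) : Timed ℤ :=
  if _h : b = 0 then ⟨a, 1⟩
  else
    let rest := euclid b (Int.tmod a b)
    ⟨rest.val, bits a * bits b + rest.cost⟩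
termination_by b.natAbs
decreasing_by
  rw [Int.natAbs_tmod]
  exact Nat.mod_lt _ (Int.natAbs_pos.mpr _h)

/-- Greatest common divisor of `p` integers by Euclid's algorithm. -/
def gcdAll {p : ℕ} (z : Fin p → ℤ) : Timed ℤ :=
  (List.finRange p).foldlM (fun g j => euclid g (z j)) 0

/-! ### The LLL basis reduction algorithm

The basis is `b 0, …, b (k - 1)`, a family of integer vectors.  The Gram-Schmidt data are computed
exactly in integers: if `μ i j` are the Gram-Schmidt coefficients, `b* i` the Gram-Schmidt vectors,
and `D j = ∏_{l ≤ j} ‖b* l‖²` the Gram determinant of `b 0, …, b j`, then `gso b` has the entries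
`D j` at `(j, j)` and `D j * μ i j` at `(i, j)` for `j < i`.  (Fraction-free elimination of the Gram
matrix; all divisions are exact.) -/

def gsoStep {k : ℕ} (l : Fin k) (A : Fin k → Fin k → ℤ) (piv : ℤ) :
    Timed (Fin k → Fin k → ℤ) :=
  forEach fun i => forEach fun j =>
    if l < i ∧ l < j then do
      let x ← mul (A l l) (A i j)
      let y ← mul (A i l) (A l j)
      let t ← sub x y
      quo t piv
    else pure (A i j)

def gso {k d : ℕ} (b : Fin k → Fin d → ℤ) : Timed (Fin k → Fin k → ℤ) := do
  let G ← forEach fun i => forEach fun j => dot (b i) (b j)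
  let s ← (List.finRange k).foldlM (fun (s : (Fin k → Fin k → ℤ) × ℤ) l => do
    let A ← gsoStep l s.1 s.2
    pure (A, s.1 l l)) (G, 1)
  pure s.1

/-- `b i := b i - r • b j`, where `r` is the integer nearest to `μ i j`. -/
def reduceWith {k d : ℕ} (b : Fin k → Fin d → ℤ) (i j : Fin k) : Timed (Fin k → Fin d → ℤ) := do
  let A ← gso b
  let twice ← mul 2 (A i j)
  let num ← add twice (A j j)
  let den ← mul 2 (A j j)
  let r ← quo num den
  let row ← forEach fun t => do
    let x ← mul r (b j t)
    sub (b i t) x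
  pure (Function.update b i row)

/-- Size reduction of `b i` with respect to `b (i - 1), …, b 0`, in this order. -/
def sizeReduce {k d : ℕ} (b : Fin k → Fin d → ℤ) (i : Fin k) : Timed (Fin k → Fin d → ℤ) :=
  ((List.finRange k).filter (· < i)).reverse.foldlM (fun b j => reduceWith b i j) b

/-- One iteration of the main loop at stage `i`: size-reduce `b i`, then test the Lovász condition
`‖b* i‖² ≥ (3/4 - μ i (i-1) ^ 2) * ‖b* (i-1)‖²`, here multiplied by `4 * D (i-1) * D (i-2)`.
If it holds go to stage `i + 1`, otherwise exchange `b i` and `b (i - 1)` and go to stage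
`max (i - 1) 1`.  The loop ends at stage `k`. -/
def lllStep {k d : ℕ} (b : Fin k → Fin d → ℤ) (i : ℕ) :
    Timed (((Fin k → Fin d → ℤ) × ℕ) ⊕ (Fin k → Fin d → ℤ)) :=
  if h : i < k then do
    let hi : Fin k := ⟨i, h⟩
    let lo : Fin k := ⟨i - 1, by omega⟩
    let b ← sizeReduce b hi
    let A ← gso b
    let D : ℤ := if 2 ≤ i then A ⟨i - 2, by omega⟩ ⟨i - 2, by omega⟩ else 1
    let x ← mul (A hi hi) D
    let y ← mul (A hi lo) (A hi lo)
    let s ← add x y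
    let s ← mul 4 s
    let t ← mul (A lo lo) (A lo lo)
    let t ← mul 3 t
    let ok ← le t s
    if ok then pure (Sum.inl (b, i + 1))
    else pure (Sum.inl (fun j => b (Equiv.swap hi lo j), max (i - 1) 1))
  else ⟨Sum.inr b, 1⟩

/-- The main loop.  `fuel` is not part of the algorithm: it bounds the number of iterations that are
looked at, and the value is `none` if the loop has not ended within them. -/
def lllLoop {k d : ℕ} : ℕ → (Fin k → Fin d → ℤ) → ℕ → Timed (Option (Fin k → Fin d → ℤ))
  | 0, _, _ => pure none
  | fuel + 1, b, i => do
    let s ← lllStep b i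
    match s with
    | Sum.inl (b', i') => lllLoop fuel b' i'
    | Sum.inr b' => pure (some b')

/-- The LLL algorithm; it returns the first vector of the reduced basis. -/
def lll {k d : ℕ} (fuel : ℕ) (b : Fin k → Fin d → ℤ) : Timed (Option (Fin d → ℤ)) := do
  let r ← lllLoop fuel b 1
  match r with
  | none => pure none
  | some b' => pure (some fun t => if h : 0 < k then b' ⟨0, h⟩ t else 0)

/-! ### The extended Lagarias-Odlyzko algorithm -/

/-- The columns of the integer matrix
`[ m X   -m Diag(Y)   m I ]`
`[  I        0         0  ]`
`[  0        0         I  ]`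
with `n + p + n` rows and `p + n + n` columns. -/
def eloBasis {n p : ℕ} (m : ℤ) (X : Fin n → Fin p → ℤ) (Y : Fin n → ℤ) :
    Timed (Fin (p + n + n) → Fin (n + p + n) → ℤ) := do
  let mX ← forEach fun i => forEach fun j => mul m (X i j)
  let mY ← forEach fun i => do
    let y ← mul m (Y i)
    sub 0 y
  let colX : Fin p → Fin (n + p + n) → ℤ := fun j =>
    Fin.append (Fin.append (fun i => mX i j) (Pi.single j 1)) 0
  let colY : Fin n → Fin (n + p + n) → ℤ := fun i =>
    Fin.append (Fin.append (Pi.single i (mY i)) 0) 0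
  let colI : Fin n → Fin (n + p + n) → ℤ := fun i =>
    Fin.append (Fin.append (Pi.single i m) 0) (Pi.single i 1)
  let cols := Fin.append (Fin.append colX colY) colI
  forEach fun s => forEach fun t => ⟨cols s t, 1⟩

/-- The ELO algorithm with input `(Y, X, R, W)`; `Z` is the random vector drawn in its first
step (drawing `Z j` is charged its bit length). -/
def ELO {n p : ℕ} (fuel : ℕ) (Y : Fin n → ℤ) (X : Fin n → Fin p → ℤ) (R W : ℤ) (Z : Fin p → ℤ) :
    Timed (Option (Fin p → ℤ)) := do
  let Z ← forEach fun j => ⟨Z j, bits (Z j)⟩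
  let Y₁ ← forEach fun i => do
    let s ← dot (X i) Z
    add (Y i) s
  let Y₂ ← forEach fun i => do
    let large ← le 3 |Y₁ i|
    pure (if large then Y₁ i else 3)
  let e ← pow2 (n + (p + 1) / 2 + 3)
  let rp ← ceilSqrt p
  let rn ← ceilSqrt n
  let u ← mul R rp
  let v ← mul W rn
  let s ← add u v
  let t ← mul p s
  let m ← mul e t
  let b ← eloBasis m X Y₂
  let r ← lll fuel b
  match r with
  | none => pure none
  | some z => do
    let x : Fin p → ℤ := fun j => z (Fin.castAdd n (Fin.natAdd n j))
    let g ← gcdAll x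
    if g = 0 then pure (some 0)
    else do
      let out ← forEach fun j => do
        let q ← quo (x j) g
        sub q (Z j)
      pure (some out)

end Timed

/-! ### The lattice-based regression algorithm -/

noncomputable section

/-- `x_N = sign(x) ⌊2^N |x|⌋ / 2^N`: the first `N` binary digits after the point. -/
def truncBits (N : ℕ) (x : ℝ) : ℝ := SignType.sign x * (⌊(2 : ℝ) ^ N * |x|⌋ / 2 ^ N)

/-- The integer `2^N x_N`. -/
def truncInt (N : ℕ) (x : ℝ) : ℤ := SignType.sign x * ⌊(2 : ℝ) ^ N * |x|⌋

theorem truncInt_eq (N : ℕ) (x : ℝ) : (truncInt N x : ℝ) = 2 ^ N * truncBits N x := by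
  have h : (2 : ℝ) ^ N ≠ 0 := by positivity
  unfold truncInt truncBits
  push_cast
  rw [mul_left_comm, mul_div_cancel₀ _ h]

/-- The LBR algorithm with input `(Y, X, N, Q, R, W)`.  The real entries of `Y` and `X` are read
through their first `N` digits only, which is charged by the length of what is read, and
`2 Q (2^N W + R p)` is formed from `2^N W` rounded up to an integer.  `Z` is the random vector drawn
by the subroutine ELO. -/
def LBR {n p : ℕ} (fuel : ℕ) (Y : Fin n → ℝ) (X : Fin n → Fin p → ℝ) (N Q R : ℕ) (W : ℝ)
    (Z : Fin p → ℤ) : Timed (Option (Fin p → ℚ)) := do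
  let YN ← Timed.forEach fun i => ⟨truncInt N (Y i), N + Timed.bits (truncInt N (Y i))⟩
  let XN ← Timed.forEach fun i => Timed.forEach fun j =>
    ⟨truncInt N (X i j), N + Timed.bits (truncInt N (X i j))⟩
  let WN ← ⟨⌈(2 : ℝ) ^ N * W⌉, N + Timed.bits ⌈(2 : ℝ) ^ N * W⌉⟩
  let QY ← Timed.forEach fun i => Timed.mul Q (YN i)
  let QR ← Timed.mul Q R
  let Rp ← Timed.mul R p
  let s ← Timed.add WN Rp
  let s ← Timed.mul Q s
  let WE ← Timed.mul 2 s
  let r ← Timed.ELO fuel QY XN QR WE Z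
  match r with
  | none => pure none
  | some b => do
    let out ← Timed.forEach fun j =>
      (⟨(b j : ℚ) / Q, Timed.bits (b j) * Timed.bits Q⟩ : Timed ℚ)
    pure (some out)

/-- The observations `Y = X β + W`. -/
def observations {n p : ℕ} (X : Fin n → Fin p → ℝ) (β : Fin p → ℝ) (W : Fin n → ℝ) : Fin n → ℝ :=
  fun i => ∑ j, X i j * β j + W i

/-- The LBR algorithm halts after at most `T` bit operations and its output is `β`. -/
def LBRRecovers {n p : ℕ} (Y : Fin n → ℝ) (X : Fin n → Fin p → ℝ) (N Q R : ℕ) (W : ℝ)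
    (Z : Fin p → ℤ) (β : Fin p → ℝ) (T : ℝ) : Prop :=
  ∃ (fuel : ℕ) (out : Fin p → ℚ), (LBR fuel Y X N Q R W Z).val = some out ∧
    (∀ j, (out j : ℝ) = β j) ∧ ((LBR fuel Y X N Q R W Z).cost : ℝ) ≤ T

/-- All entries are integer multiples of `1 / Q`. -/
def IsRationalWith {p : ℕ} (Q : ℕ) (β : Fin p → ℝ) : Prop :=
  ∀ j, ∃ k : ℤ, β j = k / Q

/-- The joint law of the measurement matrix `X` (iid entries with law `μX`), the noise `W` (iid
entries with law `μW`, independent of `X`), and the internal randomness `Z` of the algorithm (iid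
entries uniform on `{Q R + 1, …, 2 Q R + ⌊log₂ p⌋}`, independent of `X` and `W`). -/
def jointLaw (n p Q R : ℕ) (μX μW : Measure ℝ) :
    Measure ((Fin n → Fin p → ℝ) × (Fin n → ℝ) × (Fin p → ℤ)) :=
  (Measure.pi fun _ => Measure.pi fun _ => μX).prod
    ((Measure.pi fun _ => μW).prod
      (Measure.pi fun _ =>
        ProbabilityTheory.uniformOn (Set.Icc ((Q * R : ℕ) + 1 : ℤ) (2 * (Q * R : ℕ) + Nat.log 2 p))))

end

/-!
The algorithm recovers `β` whenever the sample is typical, and a sample is typical with high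
probability.

*The lattice.* Put `b = Q β + Z`, a vector of positive integers, where `Q` is the multiple of the
denominators given to the algorithm.  The lattice reduced by the algorithm consists of the vectors
`(m (X x - Y₂ ∘ y + v), x, v)` with integer `x`, `y`, `v`, where `X` is the truncated matrix and `∘`
is the entrywise product; the columns are independent because no entry of `Y₂` vanishes
(`pivot_eloMatrix_pos`).  It contains the vector with `x = b`, `y = 1` and `v = Y₂ - X b`, whose
top block is zero and whose remaining entries are of the size of `Z`, the noise and the rounding
errors.  The LLL algorithm returns a vector longer than the shortest one by at most the factor
`2 ^ ((2 n + p - 1) / 2)` (`lll_spec`), and `m` exceeds this multiple of the length of the planted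
vector, so the top block of the returned vector vanishes (`lll_eloMatrix_spec`).

*No spurious short vectors.* A vanishing top block with short `x` and `v` forces `y` to be bounded,
since the entries of `Y₂ ≈ X b` are not too small, and then the `i`-th measurement of `x - y_i b`
is tiny for every `i` (`exists_eq_mul_of_short`).  For fixed `x` and `y` with `x ≠ y_i b` for all
`i` this has probability at most `(2 c t) ^ n`, because an integer combination of independent
variables with density at most `c` has density at most `c` (`pi_abs_sum_mul_le`).  The lower bound
on the precision `N` is what is needed to beat the number of pairs `(x, y)` (`card_mul_prob_le`).
So `x` is a multiple of `b`, say `x = q b` with `q ≠ 0`; if the entries of `b` are coprime, then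
Euclid's algorithm returns `q` with its sign (`gcdAll_spec`), and `x / q - Z = Q β` (`ELO_spec`).
`LBRRecovers_of_typical` combines these facts.

*Typical samples.* The remaining conditions are: the noise and the matrix have about their expected
size (Chebyshev and Markov), no measurement of `b` is small, and the entries of `b` are coprime.
The last one fails with probability exponentially small in `p` (`pi_uniformOn_gcd_ne_one_le`); all
the others, and the existence of spurious vectors, have probability `O (1 / (n p))`.

*Running time.* The entries of the integral Gram-Schmidt data are minors of the Gram matrix
(`gso_spec`), so their bit lengths are polynomial.  The product of all Gram determinants decreases
by the factor `3 / 4` with every exchange of two basis vectors, which bounds the number of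
iterations (`lllLoop_spec`).  All costs are bounded by powers of one common parameter `B`; only the
existence of an exponent matters, so no care is taken to keep it small.
-/

/-! ### Cost and value of the basic operations -/

namespace Timed

theorem bits_le {x : ℤ} {s : ℕ} (h : |x| ≤ 2 ^ s) : bits x ≤ s + 2 := by
  unfold bits
  have h1 : x.natAbs ≤ 2 ^ s := by
    zify; simpa using h
  have h2 : x.natAbs.size ≤ s + 1 :=
    Nat.size_le.2 (h1.trans_lt (Nat.pow_lt_pow_right (by norm_num) (Nat.lt_succ_self s)))
  omega

theorem bits_mul_bits_le {x y : ℤ} {s : ℕ} (hx : |x| ≤ 2 ^ s) (hy : |y| ≤ 2 ^ s) :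
    bits x * bits y ≤ (s + 2) ^ 2 := by
  rw [sq]; exact Nat.mul_le_mul (bits_le hx) (bits_le hy)

theorem nat_le_two_pow (d : ℕ) : (d : ℤ) ≤ 2 ^ d := by
  exact_mod_cast (Nat.lt_two_pow_self (n := d)).le

theorem cost_forEach_le {α : Type} {k : ℕ} {f : Fin k → Timed α} {c : ℕ}
    (h : ∀ i, (f i).cost ≤ c) : (forEach f).cost ≤ k * (c + 1) := by
  have : ∑ i, (f i).cost ≤ k * c := by
    simpa using Finset.sum_le_card_nsmul Finset.univ (fun i => (f i).cost) c (fun i _ => h i)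
  change k + ∑ i, (f i).cost ≤ _
  rw [mul_add]; omega

/-- Invariant rule for a loop over a list: `P done s` is the invariant once the initial segment
`done` has been processed. -/
theorem foldlM_spec {α β : Type} (f : β → α → Timed β) (P : List α → β → Prop) (c : ℕ) :
    ∀ (L : List α) (s : β), P [] s →
      (∀ done x rest s, L = done ++ x :: rest → P done s →
        P (done ++ [x]) (f s x).val ∧ (f s x).cost ≤ c) →
      P L (L.foldlM f s).val ∧ (L.foldlM f s).cost ≤ L.length * c := by
  suffices H : ∀ (L pre : List α) (s : β), P pre s →
      (∀ done x rest s, pre ++ L = done ++ x :: rest → P done s →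
        P (done ++ [x]) (f s x).val ∧ (f s x).cost ≤ c) →
      P (pre ++ L) (L.foldlM f s).val ∧ (L.foldlM f s).cost ≤ L.length * c by
    intro L s h0 h
    simpa using H L [] s h0 (by simpa using h)
  intro L
  induction L with
  | nil => intro pre s h0 _; simpa using h0
  | cons x L ih =>
    intro pre s h0 h
    obtain ⟨h1, h2⟩ := h pre x L s rfl h0
    have := ih (pre ++ [x]) (f s x).val h1 (by
      intro done y rest t e; exact h done y rest t (by simpa using e))
    refine ⟨by simpa using this.1, ?_⟩
    simp only [List.foldlM_cons, cost_bind, List.length_cons, add_mul, one_mul]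
    omega

theorem eq_of_finRange_eq_append {k : ℕ} {done rest : List (Fin k)} {x : Fin k}
    (h : List.finRange k = done ++ x :: rest) : done.length = x.val := by
  have h1 : (List.finRange k)[done.length]? = some x := by rw [h]; simp
  rw [List.getElem?_eq_some_iff] at h1
  obtain ⟨h2, h3⟩ := h1
  rw [← h3]; simp

/-- Invariant rule for a loop over `0, …, k - 1`. -/
theorem foldlM_finRange_spec {β : Type} {k : ℕ} (f : β → Fin k → Timed β) (P : ℕ → β → Prop)
    (c : ℕ) (s : β) (h0 : P 0 s)
    (h : ∀ (l : Fin k) s, P l s → P (l + 1) (f s l).val ∧ (f s l).cost ≤ c) :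
    P k ((List.finRange k).foldlM f s).val ∧ ((List.finRange k).foldlM f s).cost ≤ k * c := by
  have := foldlM_spec f (fun done s => P done.length s) c (List.finRange k) s h0 (by
    intro done x rest s e hs
    have e' := eq_of_finRange_eq_append e
    simp only [e', List.length_append, List.length_cons, List.length_nil] at hs ⊢
    exact h x s hs)
  simpa using this

/-- Sums of integers of absolute value at most `2 ^ s`: the value, and the cost when each term
costs at most `c`. -/
theorem sum_spec {k : ℕ} (f : Fin k → Timed ℤ) {s c : ℕ} (hs : ∀ i, |(f i).val| ≤ 2 ^ s)
    (hc : ∀ i, (f i).cost ≤ c) :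
    (sum f).val = ∑ i, (f i).val ∧ (sum f).cost ≤ k * (c + (k + s + 2) ^ 2) := by
  have key := foldlM_finRange_spec (fun s i => do
      let t ← f i
      add s t)
    (fun l v => (v = ∑ i : Fin k with i.val < l, (f i).val) ∧ |v| ≤ l * 2 ^ s)
    (c + (k + s + 2) ^ 2) 0 (by simp) (by
      rintro l v ⟨hv, hb⟩
      refine ⟨⟨?_, ?_⟩, ?_⟩
      · have : (Finset.univ.filter fun i : Fin k => i.val < l + 1) =
            insert l (Finset.univ.filter fun i : Fin k => i.val < l) := by
          ext i; simp [Fin.ext_iff]; omega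
        rw [this, Finset.sum_insert (by simp), ← hv, add_comm]; rfl
      · push_cast
        change |v + (f l).val| ≤ _
        calc _ ≤ |v| + |(f l).val| := abs_add_le _ _
          _ ≤ l * 2 ^ s + 2 ^ s := add_le_add hb (hs l)
          _ = _ := by ring
      · change (f l).cost + bits v * bits (f l).val ≤ _
        refine add_le_add (hc l) (bits_mul_bits_le ?_ ((hs l).trans ?_))
        · calc |v| ≤ l * 2 ^ s := hb
            _ ≤ 2 ^ k * 2 ^ s := by
              gcongr
              exact (nat_le_two_pow l).trans (pow_le_pow_right₀ (by norm_num) l.2.le)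
            _ = _ := (pow_add _ _ _).symm
        · exact pow_le_pow_right₀ (by norm_num) (by omega))
  refine ⟨?_, key.2⟩
  rw [sum, key.1.1]; simp

theorem dot_spec {d : ℕ} {u v : Fin d → ℤ} {s t : ℕ} (hu : ∀ i, |u i| ≤ 2 ^ s)
    (hv : ∀ i, |v i| ≤ 2 ^ t) :
    (dot u v).val = ∑ i, u i * v i ∧ (dot u v).cost ≤ d * (2 * (d + (s + t) + 2) ^ 2) := by
  have := sum_spec (fun i => mul (u i) (v i)) (s := s + t) (c := (d + (s + t) + 2) ^ 2)
    (fun i => by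
      change |u i * v i| ≤ _
      rw [abs_mul, pow_add]
      exact mul_le_mul (hu i) (hv i) (abs_nonneg _) (by positivity))
    (fun i => bits_mul_bits_le
      ((hu i).trans (pow_le_pow_right₀ (by norm_num) (by omega)))
      ((hv i).trans (pow_le_pow_right₀ (by norm_num) (by omega))))
  refine ⟨this.1, this.2.trans (le_of_eq (by ring))⟩

theorem abs_sum_mul_le {d : ℕ} {u v : Fin d → ℤ} {s t : ℕ} (hu : ∀ i, |u i| ≤ 2 ^ s)
    (hv : ∀ i, |v i| ≤ 2 ^ t) : |∑ i, u i * v i| ≤ 2 ^ (d + s + t) := by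
  calc _ ≤ ∑ i, |u i * v i| := Finset.abs_sum_le_sum_abs _ _
    _ ≤ ∑ _i : Fin d, 2 ^ s * 2 ^ t := Finset.sum_le_sum fun i _ => by
      rw [abs_mul]; exact mul_le_mul (hu i) (hv i) (abs_nonneg _) (by positivity)
    _ = d * (2 ^ s * 2 ^ t) := by simp
    _ ≤ 2 ^ d * (2 ^ s * 2 ^ t) := by gcongr; exact nat_le_two_pow d
    _ = _ := by ring

theorem pow2_spec (e : ℕ) : (pow2 e).val = 2 ^ e ∧ (pow2 e).cost ≤ e * (e + 3) ^ 2 := by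
  induction e with
  | zero => simp [pow2]
  | succ e ih =>
    have hc : (pow2 (e + 1)).cost = (pow2 e).cost + bits 2 * bits (pow2 e).val := rfl
    have hv : (pow2 (e + 1)).val = 2 * (pow2 e).val := rfl
    refine ⟨by rw [hv, ih.1]; ring, ?_⟩
    have : bits 2 * bits (pow2 e).val ≤ (e + 1 + 2) ^ 2 := by
      apply bits_mul_bits_le
      · simpa using pow_le_pow_right₀ (a := (2 : ℤ)) (by norm_num) (Nat.le_add_left 1 e)
      · rw [ih.1, abs_of_nonneg (by positivity)]
        exact pow_le_pow_right₀ (by norm_num) (by omega)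
    rw [hc]
    calc _ ≤ e * (e + 3) ^ 2 + (e + 1 + 2) ^ 2 := add_le_add ih.2 this
      _ ≤ e * (e + 1 + 3) ^ 2 + (e + 1 + 3) ^ 2 := by gcongr <;> omega
      _ = _ := by ring

/-- Upper and lower bounds for the computed square root; nothing else about it is needed. -/
theorem ceilSqrt_spec (k : ℕ) : 0 ≤ (ceilSqrt k).val ∧ (ceilSqrt k).val ≤ k ∧
    (k : ℤ) ≤ (ceilSqrt k).val ^ 2 ∧ (ceilSqrt k).cost ≤ k * (3 * (2 * k + 2) ^ 2) := by
  let f : Fin k → Timed ℤ := fun a => do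
    let s ← mul a.val a.val
    let large ← le k s
    pure (if large then 0 else 1)
  have hval : ∀ a : Fin k, (f a).val = if a.val ^ 2 < k then 1 else 0 := by
    intro a
    change (if decide ((k : ℤ) ≤ (a.val : ℤ) * a.val) = true then (0 : ℤ) else 1) = _
    have : (k : ℤ) ≤ (a.val : ℤ) * a.val ↔ ¬ a.val ^ 2 < k := by
      rw [not_lt, sq]; norm_cast
    simp only [this, decide_eq_true_eq]
    split_ifs <;> simp_all
  have ha : ∀ a : Fin k, |(a.val : ℤ)| ≤ 2 ^ k := fun a => by
    rw [abs_of_nonneg (by positivity)]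
    exact (nat_le_two_pow _).trans (pow_le_pow_right₀ (by norm_num) a.2.le)
  have key := sum_spec f (s := 0) (c := 2 * (2 * k + 2) ^ 2)
    (fun i => by rw [hval]; split_ifs <;> simp)
    (fun a => by
      change bits a.val * bits a.val + (bits k * bits ((a.val : ℤ) * a.val) + 0) ≤ _
      have h1 : bits (a.val : ℤ) * bits a.val ≤ (2 * k + 2) ^ 2 :=
        (bits_mul_bits_le (ha a) (ha a)).trans (by gcongr; omega)
      have h2 : bits (k : ℤ) * bits ((a.val : ℤ) * a.val) ≤ (2 * k + 2) ^ 2 := by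
        apply bits_mul_bits_le
        · rw [abs_of_nonneg (by positivity)]
          exact (nat_le_two_pow _).trans (pow_le_pow_right₀ (by norm_num) (by omega))
        · rw [abs_mul, two_mul, pow_add]
          exact mul_le_mul (ha a) (ha a) (abs_nonneg _) (by positivity)
      omega)
  have hv : (ceilSqrt k).val = ((Finset.univ.filter fun a : Fin k => a.val ^ 2 < k).card : ℤ) := by
    change (sum f).val = _
    rw [key.1]; simp [hval]
  refine ⟨by rw [hv]; positivity, ?_, ?_, ?_⟩
  · rw [hv]
    exact_mod_cast (Finset.card_le_univ _).trans (by simp)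
  · rw [hv]
    set c := (Finset.univ.filter fun a : Fin k => a.val ^ 2 < k).card with hc
    by_contra! hlt
    have hlt' : c ^ 2 < k := by exact_mod_cast hlt
    have hck : c < k := lt_of_le_of_lt (Nat.le_self_pow (by norm_num) c) hlt'
    have : (Finset.univ.filter fun a : Fin k => a.val < c + 1) ⊆
        (Finset.univ.filter fun a : Fin k => a.val ^ 2 < k) := by
      intro a
      simp only [Finset.mem_filter, Finset.mem_univ, true_and]
      intro h
      exact (Nat.pow_le_pow_left (Nat.lt_succ_iff.1 h) 2).trans_lt hlt'
    have h2 := Finset.card_le_card this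
    rw [Fin.card_filter_val_lt] at h2
    omega
  · refine key.2.trans ?_
    gcongr
    have : (k + 0 + 2) ^ 2 ≤ (2 * k + 2) ^ 2 := by gcongr; omega
    omega

end Timed

/-! ### Symmetric elimination of a Gram matrix -/

/-- The Gram matrix of a family of integer vectors. -/
def gram {k d : ℕ} (b : Fin k → Fin d → ℤ) (i j : Fin k) : ℝ := ∑ t, (b i t : ℝ) * b j t

/-- Result of eliminating the indices `0, …, l - 1` from the matrix `G`, with all indices kept:
the eliminated rows and columns become zero.  For a Gram matrix of `b`, the entry `(i, j)` is the
inner product of the components of `b i` and `b j` orthogonal to `b 0, …, b (l - 1)`. -/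
noncomputable def schur {k : ℕ} (G : Fin k → Fin k → ℝ) : ℕ → Fin k → Fin k → ℝ
  | 0 => G
  | l + 1 => if h : l < k then fun i j =>
      schur G l i j - schur G l i ⟨l, h⟩ * schur G l ⟨l, h⟩ j / schur G l ⟨l, h⟩ ⟨l, h⟩
    else schur G l

/-- The `l`-th pivot, that is `‖b* l‖²` for a Gram matrix; `1` beyond the last index. -/
noncomputable def pivot {k : ℕ} (G : Fin k → Fin k → ℝ) (l : ℕ) : ℝ :=
  if h : l < k then schur G l ⟨l, h⟩ ⟨l, h⟩ else 1

/-- The product of the first `l` pivots, a leading principal minor of `G`. -/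
noncomputable def pivotProd {k : ℕ} (G : Fin k → Fin k → ℝ) (l : ℕ) : ℝ :=
  ∏ r ∈ Finset.range l, pivot G r

section Schur

variable {k : ℕ} {G : Fin k → Fin k → ℝ}

theorem schur_succ (l : Fin k) (i j : Fin k) :
    schur G (l + 1) i j = schur G l i j - schur G l i l * schur G l l j / schur G l l l := by
  simp [schur]

theorem pivot_fin (l : Fin k) : pivot G l = schur G l l l := by simp [pivot]

theorem pivotProd_succ (l : ℕ) : pivotProd G (l + 1) = pivotProd G l * pivot G l :=
  Finset.prod_range_succ _ _

theorem pivotProd_pos (hp : ∀ l, 0 < pivot G l) (l : ℕ) : 0 < pivotProd G l :=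
  Finset.prod_pos fun r _ => hp r

theorem gram_symm {d : ℕ} (b : Fin k → Fin d → ℤ) (i j : Fin k) : gram b i j = gram b j i := by
  simp [gram, mul_comm]

theorem schur_symm (hG : ∀ i j, G i j = G j i) (l : ℕ) (i j : Fin k) :
    schur G l i j = schur G l j i := by
  induction l generalizing i j with
  | zero => exact hG i j
  | succ l ih =>
    by_cases h : l < k
    · rw [schur_succ ⟨l, h⟩, schur_succ ⟨l, h⟩]
      simp only [ih i j, ih i ⟨l, h⟩, ih ⟨l, h⟩ j, mul_comm]
    · simp [schur, h, ih i j]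

/-- Once an index has been eliminated, its row vanishes. -/
theorem schur_eq_zero (hp : ∀ l, 0 < pivot G l) {l : ℕ} {a : Fin k} (h : a.val < l) (j : Fin k) :
    schur G l a j = 0 := by
  induction l generalizing j with
  | zero => omega
  | succ l ih =>
    by_cases hl : l < k
    · rw [schur_succ ⟨l, hl⟩]
      rcases Nat.lt_succ_iff_lt_or_eq.1 h with h' | h'
      · simp [ih h']
      · have : a = ⟨l, hl⟩ := Fin.ext h'
        subst this
        have := hp l
        rw [pivot, dif_pos hl] at this
        field_simp; simp
    · have := ih (by omega) j
      simpa [schur, hl] using this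

theorem schur_eq_zero' (hG : ∀ i j, G i j = G j i) (hp : ∀ l, 0 < pivot G l) {l : ℕ} {a : Fin k}
    (h : a.val < l) (j : Fin k) : schur G l j a = 0 := by
  rw [schur_symm hG, schur_eq_zero hp h]

/-- Completing the square. -/
theorem schur_quadForm (hG : ∀ i j, G i j = G j i) (l : Fin k)
    (z : Fin k → ℝ) :
    ∑ a, ∑ c, z a * z c * schur G l a c =
      (∑ a, z a * schur G l l a) ^ 2 / schur G l l l +
      ∑ a, ∑ c, z a * z c * schur G (l + 1) a c := by
  have h1 : (∑ a, z a * schur G l l a) ^ 2 / schur G l l l =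
      ∑ a, ∑ c, z a * z c * (schur G l a l * schur G l l c / schur G l l l) := by
    rw [sq, Finset.sum_mul_sum, Finset.sum_div]
    refine Finset.sum_congr rfl fun a _ => ?_
    rw [Finset.sum_div]
    refine Finset.sum_congr rfl fun c _ => ?_
    rw [schur_symm hG l a l]; ring
  rw [h1, ← Finset.sum_add_distrib]
  refine Finset.sum_congr rfl fun a _ => ?_
  rw [← Finset.sum_add_distrib]
  refine Finset.sum_congr rfl fun c _ => ?_
  rw [schur_succ]; ring

/-- Elimination can only decrease the quadratic form. -/
theorem schur_quadForm_le (hG : ∀ i j, G i j = G j i) (hp : ∀ l, 0 < pivot G l) (l : ℕ)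
    (z : Fin k → ℝ) :
    ∑ a, ∑ c, z a * z c * schur G l a c ≤ ∑ a, ∑ c, z a * z c * G a c := by
  induction l with
  | zero => exact le_rfl
  | succ l ih =>
    by_cases hl : l < k
    · refine le_trans ?_ ih
      have := schur_quadForm hG ⟨l, hl⟩ z
      have h0 := hp l
      rw [pivot, dif_pos hl] at h0
      simp only at this
      rw [this]
      have : 0 ≤ (∑ a, z a * schur G l ⟨l, hl⟩ a) ^ 2 / schur G l ⟨l, hl⟩ ⟨l, hl⟩ := by positivity
      linarith
    · simpa [schur, hl] using ih

/-- A quadratic form is bounded below by one of its pivots on the nonzero integer vectors: if `h` is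
the last index with `z h ≠ 0`, then only `z h ^ 2` times the pivot at `h` is left once the indices
below `h` have been eliminated. -/
theorem exists_pivot_le_quadForm (hG : ∀ i j, G i j = G j i) (hp : ∀ l, 0 < pivot G l)
    (z : Fin k → ℤ) (hz : z ≠ 0) :
    ∃ h : Fin k, pivot G h ≤ ∑ a, ∑ c, (z a : ℝ) * z c * G a c := by
  obtain ⟨h, hh1, hh2⟩ : ∃ h : Fin k, z h ≠ 0 ∧ ∀ a, h < a → z a = 0 := by
    obtain ⟨i, hi⟩ := Function.ne_iff.1 hz
    have hne : (Finset.univ.filter fun a => z a ≠ 0).Nonempty := ⟨i, by simpa using hi⟩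
    refine ⟨(Finset.univ.filter fun a => z a ≠ 0).max' hne, ?_, fun a ha => ?_⟩
    · have := Finset.max'_mem _ hne
      simpa using this
    · by_contra h0
      exact absurd (Finset.le_max' (Finset.univ.filter fun a => z a ≠ 0) a (by simpa using h0))
        (not_le.2 ha)
  refine ⟨h, ?_⟩
  refine le_trans ?_ (schur_quadForm_le hG hp h (fun a => (z a : ℝ)))
  rw [Finset.sum_eq_single h, Finset.sum_eq_single h]
  · rw [← pivot_fin]
    have h1 : (1 : ℝ) ≤ (z h : ℝ) * z h := by
      have : 0 < z h * z h := mul_self_pos.2 hh1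
      exact_mod_cast this
    have := (hp h).le
    nlinarith
  · intro c _ hc
    rcases lt_or_gt_of_ne hc with h' | h'
    · rw [schur_eq_zero' hG hp h']; simp
    · rw [hh2 c h']; simp
  · simp
  · intro a _ ha
    refine Finset.sum_eq_zero fun c _ => ?_
    rcases lt_or_gt_of_ne ha with h' | h'
    · rw [schur_eq_zero hp h']; simp
    · rw [hh2 a h']; simp
  · simp

/-- The pivots of a positive definite matrix are positive. -/
theorem pivot_pos_of_posDef (hG : ∀ i j, G i j = G j i)
    (hpos : ∀ z : Fin k → ℝ, z ≠ 0 → 0 < ∑ a, ∑ c, z a * z c * G a c) (l : ℕ) :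
    0 < pivot G l := by
  have key : ∀ l : ℕ, (∀ r < l, 0 < pivot G r) ∧
      ∀ z : Fin k → ℝ, z ≠ 0 → (∀ a : Fin k, a.val < l → z a = 0) →
      0 < ∑ a, ∑ c, z a * z c * schur G l a c := by
    intro l
    induction l with
    | zero => exact ⟨by simp, fun z hz _ => hpos z hz⟩
    | succ l ih =>
      have hpl : 0 < pivot G l := by
        by_cases hl : l < k
        · have := ih.2 (Pi.single ⟨l, hl⟩ 1) (by simp) (by
            intro a ha
            rw [Pi.single_eq_of_ne]
            rintro rfl; simp at ha)
          simpa [pivot, hl, Pi.single_apply] using this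
        · simp [pivot, hl]
      refine ⟨fun r hr => ?_, fun z hz hz0 => ?_⟩
      · rcases Nat.lt_succ_iff_lt_or_eq.1 hr with h | rfl
        · exact ih.1 r h
        · exact hpl
      by_cases hl : l < k
      swap
      · have h2 := ih.2 z hz (fun a _ => hz0 a (by omega))
        simpa [schur, hl] using h2
      set e : Fin k := ⟨l, hl⟩ with he
      have hpe : 0 < schur G l e e := by simpa [pivot, hl] using hpl
      have hze : z e = 0 := hz0 e (by simp [he])
      -- the coordinate `t` at `e` minimizes the quadratic form, so that the square in
      -- `schur_quadForm` vanishes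
      set t : ℝ := -(∑ a, z a * schur G l e a) / schur G l e e with ht
      set z' : Fin k → ℝ := z + Pi.single e t with hz'
      have hz'a : ∀ a, a ≠ e → z' a = z a := fun a ha => by simp [hz', Pi.single_eq_of_ne ha]
      have hrow : ∀ c, schur G (l + 1) e c = 0 := by
        intro c
        have := schur_succ (G := G) e e c
        simp only [he] at this ⊢
        rw [this]; simp only [he] at hpe; field_simp; simp
      have hcol : ∀ c, schur G (l + 1) c e = 0 := fun c => by rw [schur_symm hG, hrow]
      have h1 := ih.2 z' (by
          obtain ⟨i, hi⟩ := Function.ne_iff.1 hz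
          refine Function.ne_iff.2 ⟨i, ?_⟩
          rw [hz'a i]
          · exact hi
          · rintro rfl; exact hi hze)
        (by
          intro a ha
          rw [hz'a a (by rintro rfl; simp [he] at ha)]
          exact hz0 a (by omega))
      have h2 := schur_quadForm hG e z'
      have h3 : ∑ a, z' a * schur G l e a = 0 := by
        simp only [hz', Pi.add_apply, add_mul, Finset.sum_add_distrib]
        have : ∑ a, (Pi.single e t : Fin k → ℝ) a * schur G l e a = t * schur G l e e := by
          rw [Finset.sum_eq_single e]
          · simp
          · intro a _ ha; simp [Pi.single_eq_of_ne ha]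
          · simp
        rw [this, ht]; field_simp; simp
      have h4 : ∑ a, ∑ c, z' a * z' c * schur G (l + 1) a c =
          ∑ a, ∑ c, z a * z c * schur G (l + 1) a c := by
        refine Finset.sum_congr rfl fun a _ => Finset.sum_congr rfl fun c _ => ?_
        by_cases hae : a = e
        · rw [hae, hrow]; simp
        by_cases hce : c = e
        · rw [hce, hcol]; simp
        rw [hz'a a hae, hz'a c hce]
      simp only [he] at h2 h3
      rw [h3] at h2
      rw [← h4]
      have h5 : (0:ℝ) ^ 2 / schur G l ⟨l, hl⟩ ⟨l, hl⟩ = 0 := by simp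
      rw [h5, zero_add] at h2
      rw [← h2]; exact h1
  exact (key (l + 1)).1 l (Nat.lt_succ_self l)

/-! ### Minors -/

/-- One step of Gaussian elimination in a determinant. -/
theorem det_eq_mul_det_schur {l : ℕ} (M : Matrix (Fin (l + 1)) (Fin (l + 1)) ℝ) (h : M 0 0 ≠ 0) :
    M.det = M 0 0 * (Matrix.of fun i j : Fin l =>
      M i.succ j.succ - M i.succ 0 * M 0 j.succ / M 0 0).det := by
  set B : Matrix (Fin (l + 1)) (Fin (l + 1)) ℝ :=
    Matrix.of fun i j => M i j - (if i = 0 then 0 else M i 0 / M 0 0) * M 0 j with hB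
  have h1 : M.det = B.det := by
    refine Matrix.det_eq_of_forall_row_eq_smul_add_const
      (fun i => if i = 0 then 0 else M i 0 / M 0 0) 0 (by simp) ?_
    intro i j
    simp only [hB, Matrix.of_apply]
    simp
  rw [h1, Matrix.det_succ_column_zero, Fin.sum_univ_succ]
  rw [Finset.sum_eq_zero]
  · have : B 0 0 = M 0 0 := by simp [hB]
    rw [this]
    simp only [Fin.val_zero, pow_zero, one_mul, add_zero]
    congr 2
    ext i j
    simp [hB, Matrix.submatrix_apply, Fin.succ_ne_zero]
    ring
  · intro i _
    have : B i.succ 0 = 0 := by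
      simp only [hB, Matrix.of_apply, Fin.succ_ne_zero, if_false]
      field_simp; simp
    rw [this]; simp

/-- `0, …, l - 1, i`, as indices of the rows (or columns) of a minor that start at `s`. -/
def borderIdx {k : ℕ} (s l : ℕ) (i : Fin k) (r : Fin (l + 1)) : Fin k :=
  if h : r.val < l ∧ s + r.val < k then ⟨s + r.val, h.2⟩ else i

/-- A bordered minor is the product of pivots with an entry of the eliminated matrix. -/
theorem det_border (hp : ∀ l, 0 < pivot G l) (l s : ℕ) (i j : Fin k) (h : s + l ≤ k) :
    (Matrix.of fun r c : Fin (l + 1) => schur G s (borderIdx s l i r) (borderIdx s l j c)).det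
      = (∏ r ∈ Finset.range l, pivot G (s + r)) * schur G (s + l) i j := by
  induction l generalizing s with
  | zero => simp [borderIdx]
  | succ l ih =>
    have hs : s < k := by omega
    have e0 : ∀ i : Fin k, borderIdx s (l + 1) i 0 = ⟨s, hs⟩ := by
      intro i; simp [borderIdx, hs]
    have es : ∀ (i : Fin k) (r : Fin (l + 1)),
        borderIdx s (l + 1) i r.succ = borderIdx (s + 1) l i r := by
      intro i r
      by_cases h1 : r.val < l ∧ s + 1 + r.val < k
      · rw [borderIdx, borderIdx, dif_pos h1, dif_pos (by simp only [Fin.val_succ]; omega)]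
        ext; simp only [Fin.val_succ]; omega
      · rw [borderIdx, borderIdx, dif_neg h1, dif_neg (by simp only [Fin.val_succ]; omega)]
    have hp' := hp s
    rw [pivot, dif_pos hs] at hp'
    rw [det_eq_mul_det_schur _ (by
      simp only [Matrix.of_apply, e0]; exact hp'.ne')]
    simp only [Matrix.of_apply, e0, es]
    have := ih (s + 1) (by omega)
    have e : ∀ a c : Fin k, schur G s a c - schur G s a ⟨s, hs⟩ * schur G s ⟨s, hs⟩ c /
        schur G s ⟨s, hs⟩ ⟨s, hs⟩ = schur G (s + 1) a c := by
      intro a c; exact (schur_succ ⟨s, hs⟩ a c).symm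
    simp only [e]
    rw [this, Finset.prod_range_succ', add_zero,
      show pivot G s = schur G s ⟨s, hs⟩ ⟨s, hs⟩ from dif_pos hs]
    rw [show s + (l + 1) = s + 1 + l by ring]
    have : ∀ r, pivot G (s + 1 + r) = pivot G (s + (r + 1)) := fun r => by congr 1; ring
    simp only [this]
    ring

/-- The trivial bound from the Leibniz formula.  It is linear in the size of each single row, which
is what the analysis of size reduction uses. -/
theorem det_le_prod {l : ℕ} (M : Matrix (Fin l) (Fin l) ℤ) (w : Fin l → ℤ)
    (h : ∀ i j, |M i j| ≤ w i) : |M.det| ≤ l.factorial * ∏ i, w i := by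
  rw [Matrix.det_apply']
  simp only [Int.cast_id]
  calc _ ≤ ∑ σ : Equiv.Perm (Fin l), |((Equiv.Perm.sign σ : ℤˣ) : ℤ) * ∏ i, M (σ i) i| :=
        Finset.abs_sum_le_sum_abs _ _
    _ ≤ ∑ _σ : Equiv.Perm (Fin l), ∏ i, w i := by
        refine Finset.sum_le_sum fun σ _ => ?_
        rw [abs_mul, Finset.abs_prod]
        rw [Int.abs_eq_natAbs, Int.units_natAbs, Nat.cast_one, one_mul, ← Equiv.prod_comp σ w]
        exact Finset.prod_le_prod (fun i _ => abs_nonneg _) fun i _ => h _ _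
    _ = _ := by simp [Finset.card_univ, Fintype.card_perm]

end Schur

section Minors

variable {k d : ℕ}

/-- The Gram matrix of a family of integer vectors, with integer entries. -/
def gramInt (b : Fin k → Fin d → ℤ) (i j : Fin k) : ℤ := ∑ t, b i t * b j t

theorem cast_gramInt (b : Fin k → Fin d → ℤ) (i j : Fin k) :
    (gramInt b i j : ℝ) = gram b i j := by
  simp [gramInt, gram]

/-- The minor of the Gram matrix with rows `0, …, l - 1, i` and columns `0, …, l - 1, j`. -/
def gramMinor (b : Fin k → Fin d → ℤ) (l : ℕ) (i j : Fin k) : ℤ :=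
  (Matrix.of fun r c : Fin (l + 1) => gramInt b (borderIdx 0 l i r) (borderIdx 0 l j c)).det

theorem cast_gramMinor (b : Fin k → Fin d → ℤ) (hp : ∀ l, 0 < pivot (gram b) l) {l : ℕ}
    (hl : l ≤ k) (i j : Fin k) :
    (gramMinor b l i j : ℝ) = pivotProd (gram b) l * schur (gram b) l i j := by
  have h := det_border hp l 0 i j (by omega)
  simp only [zero_add] at h
  rw [pivotProd, ← h, gramMinor, Int.cast_det]
  congr 1
  ext r c
  simp [cast_gramInt, schur]

/-- The minors are bounded by a power of two, linearly in the size of the vector `b i`. -/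
theorem abs_gramMinor_le {b : Fin k → Fin d → ℤ} {h H l : ℕ} {i j : Fin k}
    (hb : ∀ a, a ≠ i → ∀ t, |b a t| ≤ 2 ^ h) (hi : ∀ t, |b i t| ≤ 2 ^ (h + H))
    (hj : ∀ t, |b j t| ≤ 2 ^ h) (hl : l ≤ i.val) :
    |gramMinor b l i j| ≤ 2 ^ (k * k + (d + 2 * h) * k + H) := by
  have hlk : l < k := hl.trans_lt i.2
  set w : Fin (l + 1) → ℤ := fun r => if r.val < l then 2 ^ (d + 2 * h) else 2 ^ (d + 2 * h + H)
  have hrow : ∀ (r : Fin (l + 1)) (t),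
      |b (borderIdx 0 l i r) t| ≤ 2 ^ (if r.val < l then h else h + H) := by
    intro r t
    by_cases hr : r.val < l
    · rw [borderIdx, dif_pos ⟨hr, by omega⟩, if_pos hr]
      apply hb
      intro e; simp [Fin.ext_iff] at e; omega
    · rw [borderIdx, dif_neg (by tauto), if_neg hr]; exact hi t
  have hcol : ∀ (r : Fin (l + 1)) (t), |b (borderIdx 0 l j r) t| ≤ 2 ^ h := by
    intro r t
    by_cases hr : r.val < l
    · rw [borderIdx, dif_pos ⟨hr, by omega⟩]
      apply hb
      intro e; simp [Fin.ext_iff] at e; omega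
    · rw [borderIdx, dif_neg (by tauto)]; exact hj t
  refine (det_le_prod _ w ?_).trans ?_
  · intro r c
    simp only [Matrix.of_apply, gramInt]
    refine (Timed.abs_sum_mul_le (hrow r) (hcol c)).trans ?_
    simp only [w]
    split_ifs <;> exact pow_le_pow_right₀ (by norm_num) (by omega)
  · rw [Fin.prod_univ_castSucc]
    simp only [w, Fin.val_castSucc, Fin.is_lt, if_true, Fin.val_last, lt_irrefl, if_false,
      Finset.prod_const, Finset.card_univ, Fintype.card_fin]
    have h1 : (((l + 1).factorial : ℕ) : ℤ) ≤ 2 ^ (k * k) := by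
      have : (l + 1).factorial ≤ 2 ^ (k * k) := by
        calc (l + 1).factorial ≤ (l + 1) ^ (l + 1) := Nat.factorial_le_pow _
          _ ≤ k ^ k := by
            calc _ ≤ k ^ (l + 1) := Nat.pow_le_pow_left (by omega) _
              _ ≤ k ^ k := Nat.pow_le_pow_right (by omega) (by omega)
          _ ≤ (2 ^ k) ^ k := Nat.pow_le_pow_left Nat.lt_two_pow_self.le _
          _ = _ := (pow_mul _ _ _).symm
      exact_mod_cast this
    calc _ ≤ (2 : ℤ) ^ (k * k) * ((2 ^ (d + 2 * h)) ^ l * 2 ^ (d + 2 * h + H)) := by gcongr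
      _ = 2 ^ (k * k + (d + 2 * h) * (l + 1) + H) := by
        rw [← pow_mul, ← pow_add, ← pow_add]; congr 1; ring
      _ ≤ _ := by
        apply pow_le_pow_right₀ (by norm_num)
        gcongr; omega

/-- The products of pivots are positive integers, being Gram determinants of integer vectors. -/
theorem one_le_pivotProd (b : Fin k → Fin d → ℤ) (hp : ∀ l, 0 < pivot (gram b) l) (l : ℕ) :
    1 ≤ pivotProd (gram b) l := by
  rcases l with _ | l
  · simp [pivotProd]
  by_cases hl : l < k
  · have h1 := cast_gramMinor b hp hl.le ⟨l, hl⟩ ⟨l, hl⟩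
    have h2 := pivotProd_pos hp (l + 1)
    rw [pivotProd_succ, show pivot (gram b) l = _ from dif_pos hl, ← h1] at h2 ⊢
    exact_mod_cast h2
  · have hk : pivotProd (gram b) (l + 1) = pivotProd (gram b) k := by
      obtain ⟨e, he⟩ : ∃ e, l + 1 = k + e := ⟨l + 1 - k, by omega⟩
      rw [he, pivotProd, Finset.prod_range_add, pivotProd, Finset.prod_eq_one (s := Finset.range e)]
      · simp
      · intro x _; simp [pivot]
    rw [hk]
    rcases k with _ | k
    · simp [pivotProd]
    · have h1 := cast_gramMinor b hp (Nat.le_succ k) ⟨k, by omega⟩ ⟨k, by omega⟩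
      have h2 := pivotProd_pos hp (k + 1)
      rw [pivotProd_succ, show pivot (gram b) k = _ from dif_pos (Nat.lt_succ_self k), ← h1] at h2 ⊢
      exact_mod_cast h2

theorem pivot_le_diag (b : Fin k → Fin d → ℤ) (hp : ∀ l, 0 < pivot (gram b) l) (l : Fin k) :
    pivot (gram b) l ≤ gram b l l := by
  have : ∀ r : ℕ, schur (gram b) r l l ≤ gram b l l := by
    intro r
    induction r with
    | zero => exact le_rfl
    | succ r ih =>
      by_cases hr : r < k
      · refine le_trans ?_ ih
        have := schur_succ (G := gram b) ⟨r, hr⟩ l l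
        simp only at this
        rw [this, schur_symm (gram_symm b) r ⟨r, hr⟩ l]
        have h0 := hp r
        rw [pivot, dif_pos hr] at h0
        have := div_nonneg (mul_self_nonneg (schur (gram b) r l ⟨r, hr⟩)) h0.le
        linarith
      · simpa [schur, hr] using ih
  rw [pivot_fin]; exact this l

end Minors

/-! ### Effect of the elementary steps on the pivots -/

section Steps

variable {k : ℕ} {G : Fin k → Fin k → ℝ}

/-- The congruence transformation of a matrix which subtracts `r` times the index `j` from the
index `i`. -/
def rowOp (i j : Fin k) (r : ℝ) (M : Fin k → Fin k → ℝ) (a c : Fin k) : ℝ :=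
  M a c - (if a = i then r * M j c else 0) - (if c = i then r * M a j else 0)
    + (if a = i ∧ c = i then r * r * M j j else 0)

/-- Elimination of indices below `i` commutes with the row operation. -/
theorem schur_rowOp_le {i j : Fin k} (r : ℝ) {l : ℕ} (hl : l ≤ i.val) :
    schur (rowOp i j r G) l = rowOp i j r (schur G l) := by
  induction l with
  | zero => rfl
  | succ l ih =>
    have hlk : l < k := by omega
    have hne : (⟨l, hlk⟩ : Fin k) ≠ i := by rintro rfl; simp at hl
    have ih := ih (by omega)
    ext a c
    have h1 := schur_succ (G := rowOp i j r G) ⟨l, hlk⟩ a c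
    have h2 := fun a c => schur_succ (G := G) ⟨l, hlk⟩ a c
    simp only at h1 h2
    rw [h1, ih]
    simp only [rowOp, h2, hne, if_false, and_false, false_and, sub_zero, add_zero]
    by_cases ha : a = i <;> by_cases hc : c = i <;> simp [ha, hc] <;> ring

/-- The row operation is invisible once the index `j` has been eliminated. -/
theorem schur_rowOp_gt (hG : ∀ i j, G i j = G j i) (hp : ∀ l, 0 < pivot G l) {i j : Fin k}
    (hji : j < i) (r : ℝ) {l : ℕ} (hl : j.val < l) :
    schur (rowOp i j r G) l = schur G l := by
  induction l, hl using Nat.le_induction with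
  | base =>
    have h := schur_rowOp_le (G := G) (i := i) (j := j) r (l := j.val + 1) hji
    rw [h]
    ext a c
    simp [rowOp, schur_eq_zero hp (Nat.lt_succ_self j.val),
      schur_eq_zero' hG hp (Nat.lt_succ_self j.val)]
  | succ l _ ih => simp only [schur, ih]

/-- Size reduction does not change the pivots. -/
theorem pivot_rowOp (hG : ∀ i j, G i j = G j i) (hp : ∀ l, 0 < pivot G l) {i j : Fin k}
    (hji : j < i) (r : ℝ) (l : ℕ) : pivot (rowOp i j r G) l = pivot G l := by
  unfold pivot
  split_ifs with h
  · rcases lt_or_ge j.val l with h' | h'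
    · rw [schur_rowOp_gt hG hp hji r h']
    · have hli : l < i.val := lt_of_le_of_lt h' hji
      have hne : (⟨l, h⟩ : Fin k) ≠ i := by rintro rfl; simp at hli
      rw [schur_rowOp_le r hli.le]
      simp [rowOp, hne]
  · rfl

theorem schur_perm_le {σ : Equiv.Perm (Fin k)} {l : ℕ}
    (hσ : ∀ a : Fin k, a.val < l → σ a = a) :
    schur (fun a c => G (σ a) (σ c)) l = fun a c => schur G l (σ a) (σ c) := by
  induction l with
  | zero => rfl
  | succ l ih =>
    have ih := ih fun a ha => hσ a (by omega)
    ext a c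
    by_cases hl : l < k
    · have h1 := schur_succ (G := fun a c => G (σ a) (σ c)) ⟨l, hl⟩ a c
      have h2 := schur_succ (G := G) ⟨l, hl⟩ (σ a) (σ c)
      simp only at h1 h2
      rw [h1, h2, ih]
      simp only [hσ ⟨l, hl⟩ (Nat.lt_succ_self l)]
    · simp [schur, hl, ih]

variable {lo hi : Fin k}

theorem schur_swap_lo (hhi : hi.val = lo.val + 1) {l : ℕ} (hl : l ≤ lo.val) :
    schur (fun a c => G (Equiv.swap lo hi a) (Equiv.swap lo hi c)) l =
      fun a c => schur G l (Equiv.swap lo hi a) (Equiv.swap lo hi c) := by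
  apply schur_perm_le
  intro a ha
  apply Equiv.swap_apply_of_ne_of_ne <;> rintro rfl <;> omega

/-- The first changed pivot after an exchange of `lo` and `hi = lo + 1`. -/
theorem pivot_swap_lo (hG : ∀ i j, G i j = G j i) (hhi : hi.val = lo.val + 1) :
    pivot (fun a c => G (Equiv.swap lo hi a) (Equiv.swap lo hi c)) lo =
      pivot G hi + schur G lo hi lo ^ 2 / pivot G lo := by
  rw [pivot_fin, schur_swap_lo hhi le_rfl, pivot_fin, pivot_fin, hhi, schur_succ]
  simp only [Equiv.swap_apply_left]
  rw [schur_symm hG lo.val lo hi]; ring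

/-- Eliminating both `lo` and `hi` does not depend on the order in which this is done. -/
theorem schur_swap_gt (hG : ∀ i j, G i j = G j i) (hp : ∀ l, 0 < pivot G l)
    (hhi : hi.val = lo.val + 1) {l : ℕ} (hl : hi.val < l) :
    schur (fun a c => G (Equiv.swap lo hi a) (Equiv.swap lo hi c)) l =
      fun a c => schur G l (Equiv.swap lo hi a) (Equiv.swap lo hi c) := by
  induction l, hl using Nat.le_induction with
  | base =>
    have hplo := hp lo
    have hphi := hp hi
    have hq : 0 < pivot (fun a c => G (Equiv.swap lo hi a) (Equiv.swap lo hi c)) lo := by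
      rw [pivot_swap_lo hG hhi]; positivity
    rw [pivot_fin, schur_swap_lo hhi le_rfl] at hq
    simp only [Equiv.swap_apply_left] at hq
    rw [pivot_fin] at hplo hphi
    rw [hhi, schur_succ] at hphi
    ext a c
    rw [schur_succ, schur_succ, hhi, schur_succ, schur_succ, schur_succ, schur_succ, schur_succ,
      schur_succ, schur_succ, schur_succ, schur_swap_lo hhi le_rfl]
    simp only [Equiv.swap_apply_left, Equiv.swap_apply_right]
    generalize Equiv.swap lo hi a = a
    generalize Equiv.swap lo hi c = c
    rw [schur_symm hG lo.val lo hi, schur_symm hG lo.val lo c, schur_symm hG lo.val hi c] at *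
    set A := schur G lo lo lo
    set B := schur G lo hi lo
    set C := schur G lo hi hi
    set X := schur G lo a lo
    set Y := schur G lo c lo
    set U := schur G lo a hi
    set V := schur G lo c hi
    have hdet : A * C - B * B ≠ 0 := by
      have : A * (C - B * B / A) = A * C - B * B := by field_simp
      rw [← this]; positivity
    have h1 : C - B * B / A = (A * C - B * B) / A := by field_simp
    have h2 : A - B * B / C = (A * C - B * B) / C := by field_simp
    rw [h1, h2]
    -- both sides become rational functions with the common denominator `Δ`
    obtain ⟨Δ, hΔ⟩ : ∃ Δ, Δ = A * C - B * B := ⟨_, rfl⟩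
    rw [← hΔ] at hdet ⊢
    field_simp
    rw [hΔ]
    ring
  | succ l hl ih =>
    ext a c
    by_cases hlk : l < k
    · have h1 := schur_succ (G := fun a c => G (Equiv.swap lo hi a) (Equiv.swap lo hi c))
        ⟨l, hlk⟩ a c
      have h2 := schur_succ (G := G) ⟨l, hlk⟩ (Equiv.swap lo hi a) (Equiv.swap lo hi c)
      have e : Equiv.swap lo hi ⟨l, hlk⟩ = ⟨l, hlk⟩ := by
        apply Equiv.swap_apply_of_ne_of_ne <;> rintro rfl <;> simp at hl hhi <;> omega
      simp only at h1 h2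
      rw [h1, h2, ih]
      simp only [e]
    · simp only [schur, hlk, dif_neg, not_false_iff]; rw [ih]

theorem pivot_swap_of_ne (hG : ∀ i j, G i j = G j i) (hp : ∀ l, 0 < pivot G l)
    (hhi : hi.val = lo.val + 1) {l : ℕ} (h1 : l ≠ lo.val) (h2 : l ≠ hi.val) :
    pivot (fun a c => G (Equiv.swap lo hi a) (Equiv.swap lo hi c)) l = pivot G l := by
  unfold pivot
  split_ifs with h
  · have e : Equiv.swap lo hi ⟨l, h⟩ = ⟨l, h⟩ := by
      apply Equiv.swap_apply_of_ne_of_ne <;> rintro rfl <;> simp at h1 h2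
    rcases lt_or_ge l lo.val with h' | h'
    · rw [schur_swap_lo hhi h'.le]; simp only [e]
    · rw [schur_swap_gt hG hp hhi (by omega)]; simp only [e]
  · rfl

/-- The product of the two changed pivots is preserved by the exchange. -/
theorem pivot_swap_mul (hG : ∀ i j, G i j = G j i) (hp : ∀ l, 0 < pivot G l)
    (hhi : hi.val = lo.val + 1) :
    pivot (fun a c => G (Equiv.swap lo hi a) (Equiv.swap lo hi c)) lo *
      pivot (fun a c => G (Equiv.swap lo hi a) (Equiv.swap lo hi c)) hi =
    pivot G lo * pivot G hi := by
  have hplo := hp lo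
  have hphi := hp hi
  have hq := pivot_swap_lo hG hhi
  have hq' : 0 < pivot (fun a c => G (Equiv.swap lo hi a) (Equiv.swap lo hi c)) lo := by
    rw [hq]; positivity
  have e1 : ∀ G' : Fin k → Fin k → ℝ, pivot G' hi =
      schur G' lo hi hi - schur G' lo hi lo * schur G' lo lo hi / schur G' lo lo lo := by
    intro G'; rw [pivot_fin, hhi, schur_succ]
  rw [e1 (fun a c => G (Equiv.swap lo hi a) (Equiv.swap lo hi c)), e1 G]
  rw [pivot_fin] at *
  rw [schur_swap_lo hhi le_rfl] at *
  simp only [Equiv.swap_apply_left, Equiv.swap_apply_right] at *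
  rw [pivot_fin]
  field_simp

end Steps

namespace Timed

/-! ### Powers of a common bound -/

/-- Costs are bounded by powers of a number `B ≥ 4`, so that adding two of them raises the exponent
by one. -/
theorem add_le_pow_succ {B a b e : ℕ} (hB : 4 ≤ B) (ha : a ≤ B ^ e) (hb : b ≤ B ^ e) :
    a + b ≤ B ^ (e + 1) := by
  calc a + b ≤ 2 * B ^ e := by omega
    _ ≤ B * B ^ e := Nat.mul_le_mul_right _ (by omega)
    _ = _ := (pow_succ' _ _).symm

theorem pow_le_pow_of_le' {B a e f : ℕ} (hB : 4 ≤ B) (ha : a ≤ B ^ e) (h : e ≤ f) : a ≤ B ^ f :=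
  ha.trans (Nat.pow_le_pow_right (by omega) h)

theorem cost_forEach_le_pow {α : Type} {k B e : ℕ} {f : Fin k → Timed α} (hB : 4 ≤ B)
    (hk : k ≤ B) (h : ∀ i, (f i).cost ≤ B ^ e) : (forEach f).cost ≤ B ^ (e + 2) := by
  refine (cost_forEach_le h).trans ?_
  calc k * (B ^ e + 1) ≤ B ^ 1 * B ^ (e + 1) := Nat.mul_le_mul (by simpa using hk)
        (add_le_pow_succ hB le_rfl (Nat.one_le_pow _ _ (by omega)))
    _ = _ := by ring

theorem bits_mul_bits_le_pow {B f s : ℕ} (e : ℕ) (hB : 4 ≤ B) {x y : ℤ} (hx : |x| ≤ 2 ^ s)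
    (hy : |y| ≤ 2 ^ s) (hs : s ≤ B ^ (e + 1)) (hf : 2 * e + 4 ≤ f := by norm_num) :
    bits x * bits y ≤ B ^ f := by
  refine (bits_mul_bits_le hx hy).trans ?_
  have h1 : s + 2 ≤ B ^ (e + 2) := add_le_pow_succ hB hs (by
    calc 2 ≤ B ^ 1 := by rw [pow_one]; omega
      _ ≤ _ := Nat.pow_le_pow_right (by omega) (by omega))
  calc (s + 2) ^ 2 ≤ (B ^ (e + 2)) ^ 2 := Nat.pow_le_pow_left h1 2
    _ = B ^ (2 * e + 4) := by ring
    _ ≤ _ := Nat.pow_le_pow_right (by omega) hf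

/-! ### Gram-Schmidt data -/

section GSO

variable {k d : ℕ}

/-- The fraction-free elimination is exact, by the identity of Sylvester: its entries are bordered
minors of the Gram matrix, that is, products of pivots with entries of the eliminated matrix. -/
theorem gso_spec {b : Fin k → Fin d → ℤ} {h B : ℕ} (hp : ∀ l, 0 < pivot (gram b) l)
    (hb : ∀ a t, |b a t| ≤ 2 ^ h) (hB : 4 ≤ B) (hk : k ≤ B) (hd : d ≤ B) (hh : h ≤ B) :
    (∀ i j, (gso b).val i j = gramMinor b (min i j) i j) ∧
    (∀ i j, |(gso b).val i j| ≤ 2 ^ (B ^ 3)) ∧ (gso b).cost ≤ B ^ 17 := by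
  -- the bit length of the minors
  set E := k * k + (d + 2 * h) * k with hE
  have hEB : E ≤ B ^ 3 := by
    calc E ≤ B * B + (B + 2 * B) * B := by rw [hE]; gcongr
      _ = 4 * B ^ 2 := by ring
      _ ≤ B * B ^ 2 := by gcongr
      _ = _ := by ring
  have hminor : ∀ (l : ℕ) (i j : Fin k), l ≤ i.val → |gramMinor b l i j| ≤ 2 ^ (B ^ 3) := by
    intro l i j hl
    refine (abs_gramMinor_le (h := h) (H := 0) (fun a _ => hb a) (by simpa using hb i) (hb j)
      hl).trans ?_
    exact pow_le_pow_right₀ (by norm_num) (by simpa [hE] using hEB)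
  let G := forEach fun i => forEach fun j => dot (b i) (b j)
  have hGv : G.val = fun i j => gramMinor b (min 0 (min i.val j.val)) i j := by
    ext i j
    have := (dot_spec (hb i) (hb j)).1
    change (dot (b i) (b j)).val = _
    rw [this]
    have e : gramMinor b 0 i j = gramInt b i j := by
      rw [gramMinor, Matrix.det_fin_one]; simp [borderIdx]
    simp only [Nat.zero_min, e]
    rfl
  have hGc : G.cost ≤ B ^ 11 := by
    apply cost_forEach_le_pow hB hk
    intro i
    apply cost_forEach_le_pow hB hk (e := 7)
    intro j
    refine (dot_spec (hb i) (hb j)).2.trans ?_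
    have : d + (h + h) + 2 ≤ B ^ 2 := by nlinarith
    calc d * (2 * (d + (h + h) + 2) ^ 2) ≤ B * (B * (B ^ 2) ^ 2) := by gcongr; omega
      _ = B ^ 6 := by ring
      _ ≤ B ^ 7 := Nat.pow_le_pow_right (by omega) (by norm_num)
  -- after `l` rounds the entry `(i, j)` is the minor bordered by the first `min l (min i j)`
  -- indices
  have key := foldlM_finRange_spec (fun (s : (Fin k → Fin k → ℤ) × ℤ) l => do
      let A ← gsoStep l s.1 s.2
      pure (A, s.1 l l))
    (fun l s => s.1 = (fun i j => gramMinor b (min l (min i.val j.val)) i j) ∧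
      (s.2 : ℝ) = pivotProd (gram b) l ∧ |s.2| ≤ 2 ^ (B ^ 3)) (B ^ 15) (G.val, 1)
    ⟨hGv, by simp [pivotProd], by simpa using one_le_pow₀ (by norm_num)⟩ (by
      rintro l ⟨A, piv⟩ ⟨hA, hpiv, hpb⟩
      simp only at hA hpiv hpb
      have hlk : l.val < k := l.2
      have hAb : ∀ i j, |A i j| ≤ 2 ^ (B ^ 3) := fun i j => by
        rw [hA]; exact hminor _ _ _ (by omega)
      have hll : (A l l : ℝ) = pivotProd (gram b) l * pivot (gram b) l := by
        rw [hA]; simp only [min_self]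
        rw [cast_gramMinor b hp l.2.le, pivot_fin]
      refine ⟨⟨?_, ?_, hAb l l⟩, ?_⟩
      · ext i j
        change (if l < i ∧ l < j then do
            let x ← mul (A l l) (A i j)
            let y ← mul (A i l) (A l j)
            let t ← sub x y
            quo t piv
          else pure (A i j) : Timed ℤ).val = _
        split_ifs with hlt
        · have h1 : l.val < i.val := hlt.1
          have h2 : l.val < j.val := hlt.2
          change (A l l * A i j - A i l * A l j) / piv = _
          have e1 : min (l.val + 1) (min i.val j.val) = l.val + 1 := by omega
          rw [e1]
          have hpiv0 : (piv : ℝ) ≠ 0 := by rw [hpiv]; exact (pivotProd_pos hp _).ne'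
          apply Int.ediv_eq_of_eq_mul_right (by exact_mod_cast hpiv0)
          have c1 := cast_gramMinor b hp (l := l) l.2.le
          have e2 : ∀ i' j' : Fin k, l.val ≤ i'.val → l.val ≤ j'.val →
              (A i' j' : ℝ) = pivotProd (gram b) l * schur (gram b) l i' j' := by
            intro i' j' hi' hj'
            rw [hA]; simp only
            rw [show min l.val (min i'.val j'.val) = l.val by omega, c1]
          have c2 := cast_gramMinor b hp (l := l + 1) hlk i j
          have hpl := hp l
          rw [pivot_fin] at hpl
          rify
          rw [c2, hpiv, e2 l l le_rfl le_rfl, e2 i j h1.le h2.le, e2 i l h1.le le_rfl,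
            e2 l j le_rfl h2.le, pivotProd_succ, pivot_fin, schur_succ]
          field_simp
        · change A i j = _
          rw [hA]; simp only
          congr 1
          have : ¬ (l.val < i.val ∧ l.val < j.val) := hlt
          omega
      · change (A l l : ℝ) = _
        rw [hll, pivotProd_succ]
      · change (gsoStep l A piv).cost + 0 ≤ _
        rw [add_zero]
        apply cost_forEach_le_pow hB hk
        intro i
        apply cost_forEach_le_pow hB hk
        intro j
        split_ifs with hlt
        · change bits (A l l) * bits (A i j) + (bits (A i l) * bits (A l j) +
            (bits (A l l * A i j) * bits (A i l * A l j) +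
              bits (A l l * A i j - A i l * A l j) * bits piv)) ≤ _
          have hB3 : 1 ≤ B ^ 3 := Nat.one_le_pow _ _ (by omega)
          have hs : 3 * B ^ 3 ≤ B ^ (3 + 1) := by
            rw [pow_succ B 3, mul_comm]; gcongr; omega
          have h0 : ∀ {x : ℤ}, |x| ≤ 2 ^ (B ^ 3) → |x| ≤ 2 ^ (3 * B ^ 3) := fun hx =>
            hx.trans (pow_le_pow_right₀ (by norm_num) (by omega))
          have hm : ∀ {x y : ℤ}, |x| ≤ 2 ^ (B ^ 3) → |y| ≤ 2 ^ (B ^ 3) →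
              |x * y| ≤ 2 ^ (2 * B ^ 3) := fun hx hy => by
            rw [abs_mul, two_mul, pow_add]
            exact mul_le_mul hx hy (abs_nonneg _) (by positivity)
          have hm' : ∀ {x : ℤ}, |x| ≤ 2 ^ (2 * B ^ 3) → |x| ≤ 2 ^ (3 * B ^ 3) := fun hx =>
            hx.trans (pow_le_pow_right₀ (by norm_num) (by omega))
          have hsub : |A l l * A i j - A i l * A l j| ≤ 2 ^ (3 * B ^ 3) := by
            calc _ ≤ |A l l * A i j| + |A i l * A l j| := abs_sub _ _
              _ ≤ 2 ^ (2 * B ^ 3) + 2 ^ (2 * B ^ 3) :=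
                add_le_add (hm (hAb _ _) (hAb _ _)) (hm (hAb _ _) (hAb _ _))
              _ = 2 ^ (2 * B ^ 3 + 1) := by ring
              _ ≤ _ := pow_le_pow_right₀ (by norm_num) (by omega)
          have c1 := bits_mul_bits_le_pow (f := 10) 3 hB (h0 (hAb l l)) (h0 (hAb i j)) hs
          have c2 := bits_mul_bits_le_pow (f := 10) 3 hB (h0 (hAb i l)) (h0 (hAb l j)) hs
          have c3 := bits_mul_bits_le_pow (f := 10) 3 hB (hm' (hm (hAb l l) (hAb i j)))
            (hm' (hm (hAb i l) (hAb l j))) hs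
          have c4 := bits_mul_bits_le_pow (f := 10) 3 hB hsub (h0 hpb) hs
          calc _ ≤ 4 * B ^ 10 := by omega
            _ ≤ B * B ^ 10 := by gcongr
            _ = B ^ 11 := by ring
        · exact Nat.zero_le _)
  have hval : (gso b).val = fun i j : Fin k => gramMinor b (min i.val j.val) i j := by
    have := key.1.1
    change Prod.fst (Timed.val _) = _
    rw [this]
    ext i j
    congr 1
    omega
  refine ⟨fun i j => by rw [hval], fun i j => ?_, ?_⟩
  · rw [hval]; exact hminor _ _ _ (by simp)
  · change G.cost + (_ + 0) ≤ _
    have h2 := key.2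
    have h3 : k * B ^ 15 ≤ B ^ 16 := by rw [pow_succ' B 15]; gcongr
    refine add_le_pow_succ hB (pow_le_pow_of_le' hB hGc (by norm_num)) ?_
    rw [add_zero]
    exact h2.trans h3

/-! ### Size reduction -/

theorem gram_update (b : Fin k → Fin d → ℤ) {i j : Fin k} (r : ℤ) :
    gram (Function.update b i (fun t => b i t - r * b j t)) = rowOp i j r (gram b) := by
  ext a c
  simp only [gram, rowOp, Function.update_apply]
  by_cases ha : a = i <;> by_cases hc : c = i <;>
    simp only [ha, hc, if_true, if_false, and_self, and_false, false_and, sub_zero,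
      add_zero, Int.cast_sub, Int.cast_mul, Finset.mul_sum, ← Finset.sum_sub_distrib,
      ← Finset.sum_add_distrib] <;>
    refine Finset.sum_congr rfl fun t _ => ?_ <;> ring

theorem span_update (b : Fin k → Fin d → ℤ) {i j : Fin k} (hji : j ≠ i) (r : ℤ) :
    Submodule.span ℤ (Set.range (Function.update b i (fun t => b i t - r * b j t))) =
      Submodule.span ℤ (Set.range b) := by
  have e : (fun t => b i t - r * b j t) = b i - r • b j := by ext t; simp
  rw [e]
  apply le_antisymm
  · rw [Submodule.span_le]
    rintro _ ⟨a, rfl⟩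
    by_cases ha : a = i
    · subst ha
      rw [Function.update_self]
      exact Submodule.sub_mem _ (Submodule.subset_span ⟨a, rfl⟩)
        (Submodule.smul_mem _ _ (Submodule.subset_span ⟨j, rfl⟩))
    · rw [Function.update_of_ne ha]; exact Submodule.subset_span ⟨a, rfl⟩
  · rw [Submodule.span_le]
    rintro _ ⟨a, rfl⟩
    have hm : ∀ a, a ≠ i →
        b a ∈ Submodule.span ℤ (Set.range (Function.update b i (b i - r • b j))) :=
      fun a ha => Submodule.subset_span ⟨a, Function.update_of_ne ha _ _⟩
    by_cases ha : a = i
    · subst ha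
      have h1 : b a - r • b j ∈
          Submodule.span ℤ (Set.range (Function.update b a (b a - r • b j))) :=
        Submodule.subset_span ⟨a, Function.update_self _ _ _⟩
      have := Submodule.add_mem _ h1 (Submodule.smul_mem _ r (hm j hji))
      simpa using this
    · exact hm a ha

/-- One reduction step: the multiplier is the integer nearest to the Gram-Schmidt coefficient, and
it is bounded linearly in the size of the vector to be reduced. -/
theorem reduceWith_spec {b : Fin k → Fin d → ℤ} {h H B : ℕ} (hp : ∀ l, 0 < pivot (gram b) l)
    {i j : Fin k} (hji : j < i) (hb : ∀ a, a ≠ i → ∀ t, |b a t| ≤ 2 ^ h)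
    (hi : ∀ t, |b i t| ≤ 2 ^ (h + H)) (hB : 4 ≤ B) (hk : k ≤ B) (hd : d ≤ B) (hh : h + H ≤ B) :
    ∃ r : ℤ, (reduceWith b i j).val = Function.update b i (fun t => b i t - r * b j t) ∧
      |r| ≤ 2 ^ (k * k + (d + 2 * h) * k + H + 1) ∧
      |schur (gram b) j i j - r * pivot (gram b) j| ≤ pivot (gram b) j / 2 ∧
      (reduceWith b i j).cost ≤ B ^ 18 := by
  have hball : ∀ a t, |b a t| ≤ 2 ^ (h + H) := fun a t => by
    by_cases ha : a = i
    · rw [ha]; exact hi t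
    · exact (hb a ha t).trans (pow_le_pow_right₀ (by norm_num) (by omega))
  obtain ⟨hv, hvb, hc⟩ := gso_spec hp hball hB hk hd hh
  set A := (gso b).val with hA
  have hji' : j.val < i.val := hji
  have hAij : (A i j : ℝ) = pivotProd (gram b) j * schur (gram b) j i j := by
    rw [hv, show min i.val j.val = j.val by omega, cast_gramMinor b hp j.2.le]
  have hAjj : (A j j : ℝ) = pivotProd (gram b) j * pivot (gram b) j := by
    rw [hv, min_self, cast_gramMinor b hp j.2.le, pivot_fin]
  have hP := pivotProd_pos hp j
  have hpj := hp j
  have hjpos : 0 < A j j := by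
    have : (0 : ℝ) < A j j := by rw [hAjj]; positivity
    exact_mod_cast this
  have hAijb : |A i j| ≤ 2 ^ (k * k + (d + 2 * h) * k + H) := by
    rw [hv]
    exact abs_gramMinor_le hb hi (hb j hji.ne) (by omega)
  set r : ℤ := (2 * A i j + A j j) / (2 * A j j) with hr
  have hr1 : r * (2 * A j j) ≤ 2 * A i j + A j j := Int.ediv_mul_le _ (by omega)
  have hr2 : 2 * A i j + A j j < (r + 1) * (2 * A j j) := Int.lt_ediv_add_one_mul_self _ (by omega)
  have hrb : |r| ≤ |A i j| + 1 := by
    rw [abs_le]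
    constructor
    · by_contra! hlt
      have h1 : r + 1 ≤ -|A i j| := by omega
      have h2 : (r + 1) * (2 * A j j) ≤ -|A i j| * (2 * A j j) :=
        mul_le_mul_of_nonneg_right h1 (by omega)
      have h3 : -|A i j| ≤ A i j := neg_abs_le _
      nlinarith [abs_nonneg (A i j)]
    · by_contra! hlt
      have h1 : |A i j| + 1 + 1 ≤ r := by omega
      have h2 : (|A i j| + 1 + 1) * (2 * A j j) ≤ r * (2 * A j j) :=
        mul_le_mul_of_nonneg_right h1 (by omega)
      have h3 : A i j ≤ |A i j| := le_abs_self _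
      nlinarith [abs_nonneg (A i j)]
  have hrb1 : |r| ≤ 2 ^ (k * k + (d + 2 * h) * k + H + 1) := by
    have : (1 : ℤ) ≤ 2 ^ (k * k + (d + 2 * h) * k + H) := one_le_pow₀ (by norm_num)
    rw [pow_succ]; linarith
  refine ⟨r, rfl, hrb1, ?_, ?_⟩
  · have h1 : (r : ℝ) * (2 * A j j) ≤ 2 * A i j + A j j := by exact_mod_cast hr1
    have h2 : (2 * A i j + A j j : ℝ) < (r + 1) * (2 * A j j) := by exact_mod_cast hr2
    rw [hAij, hAjj] at h1 h2
    rw [abs_le]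
    constructor
    · by_contra! hlt
      have := mul_lt_mul_of_pos_left hlt hP
      nlinarith
    · by_contra! hlt
      have := mul_lt_mul_of_pos_left hlt hP
      nlinarith
  · have hb3 : 1 ≤ B ^ 3 := Nat.one_le_pow _ _ (by omega)
    have hBle : B ≤ B ^ 3 := Nat.le_self_pow (by norm_num) B
    have hs : 4 * B ^ 3 ≤ B ^ (3 + 1) := by
      rw [pow_succ B 3, mul_comm]; gcongr
    have hle : ∀ {x : ℤ} {s : ℕ}, |x| ≤ 2 ^ s → s ≤ 4 * B ^ 3 → |x| ≤ 2 ^ (4 * B ^ 3) :=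
      fun hx hs => hx.trans (pow_le_pow_right₀ (by norm_num) hs)
    have hdbl : ∀ {x : ℤ} {s : ℕ}, |x| ≤ 2 ^ s → |2 * x| ≤ 2 ^ (s + 1) := fun hx => by
      rw [abs_mul, pow_succ', abs_of_pos (by norm_num : (0 : ℤ) < 2)]; linarith
    have hadd : ∀ {x y : ℤ} {s : ℕ}, |x| ≤ 2 ^ s → |y| ≤ 2 ^ s → |x + y| ≤ 2 ^ (s + 1) :=
      fun {x y s} hx hy => by
        have := abs_add_le x y
        rw [pow_succ']; linarith
    have hr4 : |r| ≤ 2 ^ (B ^ 3 + 1) := by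
      have h1 := hvb i j
      have : (1 : ℤ) ≤ 2 ^ (B ^ 3) := one_le_pow₀ (by norm_num)
      rw [pow_succ]; linarith
    have two_le : |(2 : ℤ)| ≤ 2 ^ 1 := by norm_num
    have hrow : (forEach fun t => do
        let x ← mul r (b j t)
        sub (b i t) x).cost ≤ B ^ 13 := by
      apply cost_forEach_le_pow hB hd
      intro t
      change bits r * bits (b j t) + bits (b i t) * bits (r * b j t) ≤ _
      apply add_le_pow_succ hB
      · exact bits_mul_bits_le_pow 3 hB (hle hr4 (by omega)) (hle (hball j t) (by omega)) hs
      · refine bits_mul_bits_le_pow 3 hB (hle (hball i t) (by omega))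
          (hle (s := B ^ 3 + 1 + (h + H)) ?_ (by omega)) hs
        rw [abs_mul, pow_add _ (B ^ 3 + 1)]
        exact mul_le_mul hr4 (hball j t) (abs_nonneg _) (by positivity)
    change (gso b).cost + (bits 2 * bits (A i j) + (bits (2 * A i j) * bits (A j j) +
      (bits 2 * bits (A j j) + (bits (2 * A i j + A j j) * bits (2 * A j j) +
        (Timed.cost (forEach _) + 0))))) ≤ _
    have c1 := bits_mul_bits_le_pow (f := 10) 3 hB (hle two_le (by omega))
      (hle (hvb i j) (by omega)) hs
    have c2 := bits_mul_bits_le_pow (f := 10) 3 hB (hle (hdbl (hvb i j)) (by omega))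
      (hle (hvb j j) (by omega)) hs
    have c3 := bits_mul_bits_le_pow (f := 10) 3 hB (hle two_le (by omega))
      (hle (hvb j j) (by omega)) hs
    have c4 := bits_mul_bits_le_pow (f := 10) 3 hB
      (hle (hadd (hdbl (hvb i j))
        ((hvb j j).trans (pow_le_pow_right₀ (by norm_num) (Nat.le_succ _)))) (by omega))
      (hle (hdbl (hvb j j)) (by omega)) hs
    refine add_le_pow_succ hB hc ?_
    calc _ ≤ 4 * B ^ 10 + B ^ 13 := by
          refine le_trans (b := B ^ 10 + (B ^ 10 + (B ^ 10 + (B ^ 10 + (B ^ 13 + 0))))) ?_ (by omega)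
          gcongr
          exact hrow
      _ ≤ B ^ 14 := by
        apply add_le_pow_succ hB _ le_rfl
        calc 4 * B ^ 10 ≤ B * B ^ 10 := by gcongr
          _ = B ^ 11 := by ring
          _ ≤ _ := Nat.pow_le_pow_right (by omega) (by norm_num)
      _ ≤ _ := Nat.pow_le_pow_right (by omega) (by norm_num)

end GSO

end Timed

namespace Timed

section LLL

variable {k d : ℕ}

theorem abs_le_two_pow_of_gram_le {b : Fin k → Fin d → ℤ} {h : ℕ} {i : Fin k}
    (hi : gram b i i ≤ 4 ^ h) (t : Fin d) : |b i t| ≤ 2 ^ h := by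
  have h1 : ((b i t : ℝ)) ^ 2 ≤ 4 ^ h := by
    refine le_trans ?_ hi
    rw [sq, gram]
    exact Finset.single_le_sum (f := fun t => (b i t : ℝ) * b i t)
      (fun t _ => mul_self_nonneg _) (Finset.mem_univ t)
  have h2 : (b i t) ^ 2 ≤ (2 ^ h) ^ 2 := by
    rw [← pow_mul, mul_comm, pow_mul]; norm_num
    exact_mod_cast h1
  exact abs_le_of_sq_le_sq h2 (by positivity)

/-- The square of the length of a size-reduced vector is at most the sum of the pivots, so it is
small whatever the length was before the reduction. -/
theorem gram_diag_le {b : Fin k → Fin d → ℤ} {Bn : ℝ} (hp : ∀ l, 0 < pivot (gram b) l)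
    (hle : ∀ l : Fin k, pivot (gram b) l ≤ Bn) {i : Fin k}
    (hr : ∀ j : Fin k, j < i → |schur (gram b) j i j| ≤ pivot (gram b) j / 2) :
    gram b i i ≤ k * Bn := by
  have key : ∀ r : ℕ, r ≤ i.val → gram b i i ≤ r * Bn + schur (gram b) r i i := by
    intro r
    induction r with
    | zero => intro _; simp [schur]
    | succ r ih =>
      intro hri
      have hrk : r < k := by omega
      have h1 := ih (by omega)
      have h2 := schur_succ (G := gram b) ⟨r, hrk⟩ i i
      have h3 := hr ⟨r, hrk⟩ (by exact hri)
      have h4 := hp r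
      have h5 := hle ⟨r, hrk⟩
      simp only at h2 h3 h5
      rw [schur_symm (gram_symm b) r ⟨r, hrk⟩ i, ← pivot_fin ⟨r, hrk⟩] at h2
      simp only at h2
      set m := schur (gram b) r i ⟨r, hrk⟩
      have h6 : m * m / pivot (gram b) r ≤ Bn := by
        rw [div_le_iff₀ h4]
        have := abs_le.1 h3
        nlinarith
      push_cast
      linarith
  have h1 := key i le_rfl
  rw [← pivot_fin] at h1
  have h2 := hle i
  have h3 : ((i : ℕ) : ℝ) + 1 ≤ k := by exact_mod_cast i.2
  have h4 : 0 ≤ Bn := (hp i).le.trans h2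
  nlinarith

/-- Size reduction keeps the lattice, the pivots and the bound on the entries.  During the reduction
the entries of `b i` may grow, but only by `E + 2` bits in each of the at most `k` steps. -/
theorem sizeReduce_spec {b : Fin k → Fin d → ℤ} {h B : ℕ} {Bn : ℝ}
    (hp : ∀ l, 0 < pivot (gram b) l) (hle : ∀ l : Fin k, pivot (gram b) l ≤ Bn)
    (hBn : k * Bn ≤ 4 ^ h) (hb : ∀ a t, |b a t| ≤ 2 ^ h) (i : Fin k)
    (hB : 4 ≤ B) (hk : k ≤ B) (hd : d ≤ B) (hh : h ≤ B) :
    Submodule.span ℤ (Set.range (sizeReduce b i).val) = Submodule.span ℤ (Set.range b) ∧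
    (∀ l, pivot (gram (sizeReduce b i).val) l = pivot (gram b) l) ∧
    (∀ a t, |(sizeReduce b i).val a t| ≤ 2 ^ h) ∧
    (∀ j : Fin k, j < i → |schur (gram (sizeReduce b i).val) j i j| ≤ pivot (gram b) j / 2) ∧
    (sizeReduce b i).cost ≤ B ^ 109 := by
  set E := k * k + (d + 2 * h) * k with hE
  have hEB : E ≤ B ^ 3 := by
    calc E ≤ B * B + (B + 2 * B) * B := by rw [hE]; gcongr
      _ = 4 * B ^ 2 := by ring
      _ ≤ B * B ^ 2 := by gcongr
      _ = _ := by ring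
  set L := ((List.finRange k).filter (· < i)).reverse with hL
  have hLmem : ∀ x, x ∈ L ↔ x < i := by intro x; simp [hL]
  have hLsort : L.Pairwise (· > ·) := by
    rw [hL, List.pairwise_reverse]
    exact (List.pairwise_lt_finRange k).filter _
  have hLlen : L.length ≤ k := by
    rw [hL, List.length_reverse]
    simpa using List.length_filter_le (fun x => decide (x < i)) (List.finRange k)
  have key := foldlM_spec (fun b j => reduceWith b i j)
    (fun done b' => (∀ a, a ≠ i → b' a = b a) ∧
      (∀ t, |b' i t| ≤ 2 ^ (h + done.length * (E + 2))) ∧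
      (∀ l, pivot (gram b') l = pivot (gram b) l) ∧
      Submodule.span ℤ (Set.range b') = Submodule.span ℤ (Set.range b) ∧
      ∀ j ∈ done, |schur (gram b') j i j| ≤ pivot (gram b) j / 2) (B ^ 108) L b
    ⟨fun _ _ => rfl, by simpa using hb i, fun _ => rfl, rfl, by simp⟩ (by
      rintro done x rest s e ⟨hs1, hs2, hs3, hs4, hs5⟩
      have hxi : x < i := (hLmem x).1 (by rw [e]; simp)
      have hps : ∀ l, 0 < pivot (gram s) l := fun l => by rw [hs3]; exact hp l
      have hdone : ∀ y ∈ done, x < y ∧ y < i := by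
        intro y hy
        refine ⟨?_, (hLmem y).1 (by rw [e]; simp [hy])⟩
        rw [e, List.pairwise_append] at hLsort
        exact hLsort.2.2 y hy x (by simp)
      have hlen : done.length + 1 ≤ k := by
        have := congrArg List.length e
        simp at this; omega
      have hsize : h + done.length * (E + 2) ≤ B ^ 6 := by
        have h1 : done.length * (E + 2) ≤ B ^ 5 := by
          calc done.length * (E + 2) ≤ B ^ 1 * B ^ 4 := Nat.mul_le_mul (by rw [pow_one]; omega)
                (add_le_pow_succ hB hEB (le_trans (by omega : 2 ≤ B) (Nat.le_self_pow (by norm_num) B)))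
            _ = _ := by ring
        exact add_le_pow_succ hB (hh.trans (Nat.le_self_pow (by norm_num) B)) h1
      have hBB : B ≤ B ^ 6 := Nat.le_self_pow (by norm_num) B
      obtain ⟨r, hr1, hr2, hr3, hr4⟩ := reduceWith_spec (b := s) (h := h)
        (H := done.length * (E + 2)) (B := B ^ 6) hps hxi
        (fun a ha => by rw [hs1 a ha]; exact hb a) hs2 (hB.trans hBB) (hk.trans hBB)
        (hd.trans hBB) hsize
      have hgr : gram (reduceWith s i x).val = rowOp i x r (gram s) := by
        rw [hr1]; exact gram_update s r
      refine ⟨⟨?_, ?_, ?_, ?_, ?_⟩, ?_⟩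
      · intro a ha
        rw [hr1, Function.update_of_ne ha]; exact hs1 a ha
      · intro t
        rw [hr1, Function.update_self]
        have h1 : |r * s x t| ≤ 2 ^ (h + done.length * (E + 2) + E + 1) := by
          rw [abs_mul]
          calc |r| * |s x t| ≤ 2 ^ (E + done.length * (E + 2) + 1) * 2 ^ h := by
                refine mul_le_mul hr2 ?_ (abs_nonneg _) (by positivity)
                rw [hs1 x hxi.ne]; exact hb x t
            _ = _ := by rw [← pow_add]; congr 1; ring
        have h2 : (2 : ℤ) ^ (h + done.length * (E + 2)) ≤ 2 ^ (h + done.length * (E + 2) + E + 1) :=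
          pow_le_pow_right₀ (by norm_num) (by omega)
        calc |s i t - r * s x t| ≤ |s i t| + |r * s x t| := abs_sub _ _
          _ ≤ 2 ^ (h + done.length * (E + 2) + E + 1) + 2 ^ (h + done.length * (E + 2) + E + 1) :=
            add_le_add ((hs2 t).trans h2) h1
          _ = 2 ^ (h + (done ++ [x]).length * (E + 2)) := by
            rw [← two_mul, ← pow_succ']; congr 1; simp; ring
      · intro l
        rw [hgr, pivot_rowOp (gram_symm s) hps hxi, hs3]
      · rw [hr1, span_update s hxi.ne, hs4]
      · intro j hj
        rw [hgr]
        rcases List.mem_append.1 hj with hj | hj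
        · rw [schur_rowOp_gt (gram_symm s) hps hxi _ (hdone j hj).1]
          exact hs5 j hj
        · rw [List.mem_singleton.1 hj, schur_rowOp_le _ (le_of_lt (show x.val < i.val from hxi))]
          rw [← hs3]
          simpa [rowOp, hxi.ne, pivot_fin] using hr3
      · exact hr4.trans (le_of_eq (by ring)))
  obtain ⟨⟨h1, h2, h3, h4, h5⟩, h6⟩ := key
  have hred : ∀ j : Fin k, j < i →
      |schur (gram (sizeReduce b i).val) j i j| ≤ pivot (gram b) j / 2 :=
    fun j hj => h5 j ((hLmem j).2 hj)
  refine ⟨h4, h3, fun a t => ?_, hred, ?_⟩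
  · by_cases ha : a = i
    · subst ha
      apply abs_le_two_pow_of_gram_le
      refine (gram_diag_le (Bn := Bn) (fun l => ?_) (fun l => ?_) (fun j hj => ?_)).trans hBn
      · exact (h3 l).symm ▸ hp l
      · exact (h3 l).symm ▸ hle l
      · exact (h3 j).symm ▸ hred j hj
    · have : (sizeReduce b i).val a = b a := h1 a ha
      rw [this]; exact hb a t
  · refine h6.trans ?_
    calc L.length * B ^ 108 ≤ B * B ^ 108 := Nat.mul_le_mul_right _ (hLlen.trans hk)
      _ = _ := by ring

/-! ### The main loop -/

/-- The potential of the LLL algorithm, the product of all Gram determinants. -/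
noncomputable def potential (b : Fin k → Fin d → ℤ) : ℝ :=
  ∏ l ∈ Finset.range (k + 1), pivotProd (gram b) l

theorem one_le_potential (b : Fin k → Fin d → ℤ) (hp : ∀ l, 0 < pivot (gram b) l) :
    1 ≤ potential b :=
  Finset.prod_induction _ (fun x => 1 ≤ x) (fun _ _ => one_le_mul_of_one_le_of_one_le) le_rfl
    fun _ _ => one_le_pivotProd b hp _

/-- The invariants of the main loop at stage `i`: `b` is a basis of the lattice `Λ` with positive
pivots at most `Bn` and entries at most `2 ^ h`, and the pivots before stage `i` decrease at most
by a factor two from one to the next. -/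
structure LLLInv (Λ : Submodule ℤ (Fin d → ℤ)) (Bn : ℝ) (h : ℕ) (b : Fin k → Fin d → ℤ) (i : ℕ) :
    Prop where
  span : Submodule.span ℤ (Set.range b) = Λ
  pos : ∀ l, 0 < pivot (gram b) l
  le : ∀ l : Fin k, pivot (gram b) l ≤ Bn
  size : ∀ a t, |b a t| ≤ 2 ^ h
  one_le : 1 ≤ i
  le_card : i ≤ k
  stage : ∀ l, l + 1 < i → pivot (gram b) l ≤ 2 * pivot (gram b) (l + 1)

theorem potential_congr {b b' : Fin k → Fin d → ℤ}
    (h : ∀ l, pivot (gram b') l = pivot (gram b) l) : potential b' = potential b := by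
  unfold potential pivotProd; simp only [h]

/-- An exchange made because the Lovász condition fails keeps the invariants, and it reduces the
potential by the factor `3 / 4`: among the Gram determinants only that of `b 0, …, b lo` changes. -/
theorem LLLInv.swap {Λ : Submodule ℤ (Fin d → ℤ)} {Bn : ℝ} {h i : ℕ} {b : Fin k → Fin d → ℤ}
    (hI : LLLInv Λ Bn h b i) {lo hi : Fin k} (hlo : lo.val = i - 1) (hhi : hi.val = i)
    (hlt : pivot (gram b) hi + schur (gram b) lo hi lo ^ 2 / pivot (gram b) lo <
      3 / 4 * pivot (gram b) lo) :
    LLLInv Λ Bn h (fun j => b (Equiv.swap lo hi j)) (max (i - 1) 1) ∧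
      potential (fun j => b (Equiv.swap lo hi j)) ≤ 3 / 4 * potential b := by
  have h1i := hI.one_le
  have hhl : hi.val = lo.val + 1 := by omega
  have hg : gram (fun j => b (Equiv.swap lo hi j)) =
      fun a c => gram b (Equiv.swap lo hi a) (Equiv.swap lo hi c) := rfl
  have hq := pivot_swap_lo (gram_symm b) hhl
  have hmul := pivot_swap_mul (gram_symm b) hI.pos hhl
  have hne := fun l => pivot_swap_of_ne (gram_symm b) hI.pos hhl (l := l)
  rw [← hg] at hq hmul hne
  set b' := fun j => b (Equiv.swap lo hi j) with hb'
  have hplo := hI.pos lo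
  have hphi := hI.pos hi
  have hlo' : 0 < pivot (gram b') lo := by rw [hq]; positivity
  have hlo'' : pivot (gram b') lo < 3 / 4 * pivot (gram b) lo := by rw [hq]; exact hlt
  have hhi' : 0 < pivot (gram b') hi := by
    have : 0 < pivot (gram b') lo * pivot (gram b') hi := by rw [hmul]; positivity
    exact (pos_iff_pos_of_mul_pos this).1 hlo'
  have hhi'' : pivot (gram b') hi ≤ pivot (gram b) lo := by
    have h1 : pivot (gram b) hi ≤ pivot (gram b') lo := by
      rw [hq]
      have : 0 ≤ schur (gram b) lo hi lo ^ 2 / pivot (gram b) lo := by positivity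
      linarith
    have h2 : pivot (gram b') lo * pivot (gram b') hi ≤ pivot (gram b') lo * pivot (gram b) lo := by
      rw [hmul, mul_comm]; exact mul_le_mul_of_nonneg_right h1 hplo.le
    exact le_of_mul_le_mul_left h2 hlo'
  have hpos : ∀ l, 0 < pivot (gram b') l := by
    intro l
    by_cases h1 : l = lo.val
    · rw [h1]; exact hlo'
    by_cases h2 : l = hi.val
    · rw [h2]; exact hhi'
    rw [hne l h1 h2]; exact hI.pos l
  refine ⟨⟨?_, hpos, ?_, fun a t => hI.size _ t, le_max_right _ _, ?_, ?_⟩, ?_⟩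
  · rw [← hI.span]
    congr 1
    exact (Equiv.swap lo hi).surjective.range_comp b
  · intro l
    by_cases h1 : l = lo
    · rw [h1]; have := hI.le lo; linarith
    by_cases h2 : l = hi
    · rw [h2]; exact hhi''.trans (hI.le lo)
    rw [hne l (fun h => h1 (Fin.ext h)) (fun h => h2 (Fin.ext h))]; exact hI.le l
  · have := hI.le_card; omega
  · intro l hl
    rw [hne l (by omega) (by omega), hne (l + 1) (by omega) (by omega)]
    exact hI.stage l (by omega)
  · have hpp : ∀ l, l ≠ hi.val → pivotProd (gram b') l = pivotProd (gram b) l := by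
      intro l hl
      rcases Nat.lt_or_ge l hi.val with h1 | h1
      · refine Finset.prod_congr rfl fun r hr => ?_
        have := Finset.mem_range.1 hr
        exact hne r (by omega) (by omega)
      · have h2 : lo.val + 2 ≤ l := by omega
        clear hl h1
        induction l, h2 using Nat.le_induction with
        | base =>
          have e : pivotProd (gram b') lo = pivotProd (gram b) lo := by
            refine Finset.prod_congr rfl fun r hr => ?_
            have := Finset.mem_range.1 hr
            exact hne r (by omega) (by omega)
          rw [show lo.val + 2 = lo.val + 1 + 1 from rfl, pivotProd_succ, pivotProd_succ,
            pivotProd_succ, pivotProd_succ, e, ← hhl, mul_assoc, hmul, mul_assoc]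
        | succ l hl ih =>
          rw [pivotProd_succ, pivotProd_succ, ih, hne l (by omega) (by omega)]
    have hpphi : pivotProd (gram b') hi ≤ 3 / 4 * pivotProd (gram b) hi := by
      rw [hhl, pivotProd_succ, pivotProd_succ, hpp lo (by omega)]
      have := pivotProd_pos hI.pos lo
      nlinarith
    have hmem : hi.val ∈ Finset.range (k + 1) := by simp
    unfold potential
    rw [← Finset.mul_prod_erase _ _ hmem, ← Finset.mul_prod_erase _ _ hmem, ← mul_assoc]
    have e : ∏ x ∈ (Finset.range (k + 1)).erase hi.val, pivotProd (gram b') x =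
        ∏ x ∈ (Finset.range (k + 1)).erase hi.val, pivotProd (gram b) x :=
      Finset.prod_congr rfl fun x hx => hpp x (Finset.ne_of_mem_erase hx)
    rw [e]
    refine mul_le_mul_of_nonneg_right hpphi ?_
    exact Finset.prod_nonneg fun x _ => (pivotProd_pos hI.pos x).le

/-- In one iteration either the stage increases and the potential is unchanged, or the stage
decreases by at most one and the potential drops by the factor `3 / 4`. -/
theorem lllStep_spec {Λ : Submodule ℤ (Fin d → ℤ)} {Bn : ℝ} {h i B : ℕ} {b : Fin k → Fin d → ℤ}
    (hI : LLLInv Λ Bn h b i) (hik : i < k) (hBn : k * Bn ≤ 4 ^ h)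
    (hB : 4 ≤ B) (hk : k ≤ B) (hd : d ≤ B) (hh : h ≤ B) :
    ∃ b' i', (lllStep b i).val = Sum.inl (b', i') ∧ LLLInv Λ Bn h b' i' ∧
      ((i' = i + 1 ∧ potential b' = potential b) ∨
        (i ≤ i' + 1 ∧ potential b' ≤ 3 / 4 * potential b)) ∧
      (lllStep b i).cost ≤ B ^ 110 := by
  have h1i := hI.one_le
  set hi : Fin k := ⟨i, hik⟩ with hhi
  set lo : Fin k := ⟨i - 1, by omega⟩ with hlo
  obtain ⟨hs1, hs2, hs3, hs4, hs5⟩ := sizeReduce_spec hI.pos hI.le hBn hI.size hi hB hk hd hh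
  set b₁ := (sizeReduce b hi).val with hb₁
  have hI₁ : LLLInv Λ Bn h b₁ i :=
    ⟨hs1.trans hI.span, fun l => by rw [hs2]; exact hI.pos l, fun l => by rw [hs2]; exact hI.le l,
      hs3, h1i, hI.le_card, fun l hl => by rw [hs2, hs2]; exact hI.stage l hl⟩
  obtain ⟨hg1, hg2, hg3⟩ := gso_spec hI₁.pos hs3 hB hk hd hh
  set A := (gso b₁).val with hA
  set D : ℤ := if 2 ≤ i then A ⟨i - 2, by omega⟩ ⟨i - 2, by omega⟩ else 1 with hD
  have hDr : (D : ℝ) = pivotProd (gram b₁) lo := by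
    rw [hD]
    split_ifs with h2
    · rw [hg1, min_self, cast_gramMinor b₁ hI₁.pos (by simp only; omega), ← pivot_fin,
        ← pivotProd_succ]
      congr 1; simp only [hlo]; omega
    · have : (lo : ℕ) = 0 := by simp only [hlo]; omega
      rw [this]; simp [pivotProd]
  have hDb : |D| ≤ 2 ^ (B ^ 3) := by
    rw [hD]
    split_ifs
    · exact hg2 _ _
    · simpa using one_le_pow₀ (by norm_num)
  have hlolt : lo.val < hi.val := by simp only [hlo, hhi]; omega
  have hhl : hi.val = lo.val + 1 := by simp only [hlo, hhi]; omega
  have hAhh : (A hi hi : ℝ) = pivotProd (gram b₁) lo * pivot (gram b₁) lo * pivot (gram b₁) hi := by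
    rw [hg1, min_self, cast_gramMinor b₁ hI₁.pos hi.2.le, ← pivot_fin, hhl, pivotProd_succ, ← hhl]
  have hAhl : (A hi lo : ℝ) = pivotProd (gram b₁) lo * schur (gram b₁) lo hi lo := by
    rw [hg1, min_eq_right hlolt.le, cast_gramMinor b₁ hI₁.pos lo.2.le]
  have hAll : (A lo lo : ℝ) = pivotProd (gram b₁) lo * pivot (gram b₁) lo := by
    rw [hg1, min_self, cast_gramMinor b₁ hI₁.pos lo.2.le, ← pivot_fin]
  have hP := pivotProd_pos hI₁.pos lo
  have hplo := hI₁.pos lo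
  have hphi := hI₁.pos hi
  set S := schur (gram b₁) lo hi lo with hS
  -- the integer test is the Lovász condition after multiplication by a positive number
  have htest : (3 * (A lo lo * A lo lo) ≤ 4 * (A hi hi * D + A hi lo * A hi lo)) ↔
      3 / 4 * pivot (gram b₁) lo ≤ pivot (gram b₁) hi + S ^ 2 / pivot (gram b₁) lo := by
    rify
    rw [hAhh, hAhl, hAll, hDr]
    have e1 : 4 * (pivotProd (gram b₁) lo * pivot (gram b₁) lo * pivot (gram b₁) hi *
        pivotProd (gram b₁) lo + pivotProd (gram b₁) lo * S * (pivotProd (gram b₁) lo * S)) =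
        (4 * pivotProd (gram b₁) lo ^ 2 * pivot (gram b₁) lo) *
          (pivot (gram b₁) hi + S ^ 2 / pivot (gram b₁) lo) := by
      field_simp
    have e2 : 3 * (pivotProd (gram b₁) lo * pivot (gram b₁) lo *
        (pivotProd (gram b₁) lo * pivot (gram b₁) lo)) =
        (4 * pivotProd (gram b₁) lo ^ 2 * pivot (gram b₁) lo) *
          (3 / 4 * pivot (gram b₁) lo) := by
      field_simp
    rw [e1, e2]
    exact mul_le_mul_iff_of_pos_left (by positivity)
  have hcost : (lllStep b i).cost ≤ B ^ 110 := by
    have hb3 : 4 ^ 3 ≤ B ^ 3 := Nat.pow_le_pow_left hB 3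
    have hs : 4 * B ^ 3 ≤ B ^ (3 + 1) := by
      rw [pow_succ B 3, mul_comm]; gcongr
    have hle : ∀ {x : ℤ} {s : ℕ}, |x| ≤ 2 ^ s → s ≤ 4 * B ^ 3 → |x| ≤ 2 ^ (4 * B ^ 3) :=
      fun hx hs => hx.trans (pow_le_pow_right₀ (by norm_num) hs)
    have hm : ∀ {x y : ℤ}, |x| ≤ 2 ^ (B ^ 3) → |y| ≤ 2 ^ (B ^ 3) →
        |x * y| ≤ 2 ^ (2 * B ^ 3) := fun hx hy => by
      rw [abs_mul, two_mul, pow_add]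
      exact mul_le_mul hx hy (abs_nonneg _) (by positivity)
    have hx := hm (hg2 hi hi) hDb
    have hy := hm (hg2 hi lo) (hg2 hi lo)
    have hz := hm (hg2 lo lo) (hg2 lo lo)
    have hxy : |A hi hi * D + A hi lo * A hi lo| ≤ 2 ^ (2 * B ^ 3 + 1) := by
      refine (abs_add_le _ _).trans ?_
      rw [pow_succ']; linarith
    have h4xy : |4 * (A hi hi * D + A hi lo * A hi lo)| ≤ 2 ^ (2 * B ^ 3 + 3) := by
      rw [abs_mul, show (2 : ℤ) ^ (2 * B ^ 3 + 3) = 4 * 2 ^ (2 * B ^ 3 + 1) by ring]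
      exact mul_le_mul_of_nonneg_left hxy (by norm_num)
    have h3z : |3 * (A lo lo * A lo lo)| ≤ 2 ^ (2 * B ^ 3 + 2) := by
      rw [abs_mul, show (2 : ℤ) ^ (2 * B ^ 3 + 2) = 4 * 2 ^ (2 * B ^ 3) by ring]
      exact mul_le_mul (by norm_num) hz (abs_nonneg _) (by norm_num)
    have c1 := bits_mul_bits_le_pow (f := 10) 3 hB (hle (hg2 hi hi) (by omega))
      (hle hDb (by omega)) hs
    have c2 := bits_mul_bits_le_pow (f := 10) 3 hB (hle (hg2 hi lo) (by omega))
      (hle (hg2 hi lo) (by omega)) hs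
    have c3 := bits_mul_bits_le_pow (f := 10) 3 hB (hle hx (by omega)) (hle hy (by omega)) hs
    have c4 := bits_mul_bits_le_pow (f := 10) 3 hB (x := 4) (hle (s := 2) (by norm_num) (by omega))
      (hle hxy (by omega)) hs
    have c5 := bits_mul_bits_le_pow (f := 10) 3 hB (hle (hg2 lo lo) (by omega))
      (hle (hg2 lo lo) (by omega)) hs
    have c6 := bits_mul_bits_le_pow (f := 10) 3 hB (x := 3) (hle (s := 2) (by norm_num) (by omega))
      (hle hz (by omega)) hs
    have c7 := bits_mul_bits_le_pow (f := 10) 3 hB (hle h3z (by omega)) (hle h4xy (by omega)) hs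
    have hc : (lllStep b i).cost = (sizeReduce b hi).cost + ((gso b₁).cost +
        (bits (A hi hi) * bits D + (bits (A hi lo) * bits (A hi lo) +
        (bits (A hi hi * D) * bits (A hi lo * A hi lo) +
        (bits 4 * bits (A hi hi * D + A hi lo * A hi lo) +
        (bits (A lo lo) * bits (A lo lo) + (bits 3 * bits (A lo lo * A lo lo) +
        (bits (3 * (A lo lo * A lo lo)) * bits (4 * (A hi hi * D + A hi lo * A hi lo)) + 0)))))))) := by
      rw [lllStep, dif_pos hik]
      simp only [cost_bind]
      congr 9
      split_ifs <;> rfl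
    rw [hc]
    refine add_le_pow_succ hB hs5 ?_
    calc _ ≤ B ^ 17 + 7 * B ^ 10 := by omega
      _ ≤ B ^ 18 := by
        apply add_le_pow_succ hB le_rfl
        calc 7 * B ^ 10 ≤ (4 * 4) * B ^ 10 := by gcongr; norm_num
          _ ≤ (B * B) * B ^ 10 := by gcongr
          _ = B ^ 12 := by ring
          _ ≤ _ := Nat.pow_le_pow_right (by omega) (by norm_num)
      _ ≤ _ := Nat.pow_le_pow_right (by omega) (by norm_num)
  have hval : (lllStep b i).val =
      if 3 * (A lo lo * A lo lo) ≤ 4 * (A hi hi * D + A hi lo * A hi lo) then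
        Sum.inl (b₁, i + 1) else Sum.inl (fun j => b₁ (Equiv.swap lo hi j), max (i - 1) 1) := by
    rw [lllStep, dif_pos hik]
    change (if decide (3 * (A lo lo * A lo lo) ≤ 4 * (A hi hi * D + A hi lo * A hi lo)) = true then
      _ else _ : Timed _).val = _
    rw [Equiv.swap_comm lo hi]
    simp only [decide_eq_true_eq]
    split_ifs <;> rfl
  by_cases hok : 3 * (A lo lo * A lo lo) ≤ 4 * (A hi hi * D + A hi lo * A hi lo)
  · rw [if_pos hok] at hval
    refine ⟨_, _, hval, ⟨hI₁.span, hI₁.pos, hI₁.le, hI₁.size, by omega, hik, ?_⟩,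
      Or.inl ⟨rfl, potential_congr hs2⟩, hcost⟩
    intro l hl
    by_cases hli : l + 1 < i
    · exact hI₁.stage l hli
    · have e : l = lo.val := by simp only [hlo]; omega
      have h1 := htest.1 hok
      have h2 := hs4 lo hlolt
      rw [← hs2] at h2
      rw [e, ← hhl]
      have h3 : S ^ 2 / pivot (gram b₁) lo ≤ 1 / 4 * pivot (gram b₁) lo := by
        rw [div_le_iff₀ hplo]
        have := abs_le.1 h2
        nlinarith
      linarith
  · rw [if_neg hok] at hval
    rw [htest, not_le] at hok
    obtain ⟨h1, h2⟩ := hI₁.swap (lo := lo) (hi := hi) rfl rfl hok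
    refine ⟨_, _, hval, h1, Or.inr ⟨by omega, ?_⟩, hcost⟩
    rwa [potential_congr hs2] at h2

/-- The number `2 s + (k - i)` decreases in each iteration, where `(4 / 3) ^ s` bounds the
potential: an exchange lowers `s` by one and raises `k - i` by at most one. -/
theorem lllLoop_spec {Λ : Submodule ℤ (Fin d → ℤ)} {Bn : ℝ} {h B : ℕ} (hBn : k * Bn ≤ 4 ^ h)
    (hB : 4 ≤ B) (hk : k ≤ B) (hd : d ≤ B) (hh : h ≤ B) :
    ∀ (fuel s i : ℕ) (b : Fin k → Fin d → ℤ), LLLInv Λ Bn h b i →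
      potential b ≤ (4 / 3) ^ s → 2 * s + (k - i) + 1 ≤ fuel →
      ∃ b', (lllLoop fuel b i).val = some b' ∧ LLLInv Λ Bn h b' k ∧
        (lllLoop fuel b i).cost ≤ fuel * B ^ 110 := by
  intro fuel
  induction fuel with
  | zero => intro s i b _ _ h; omega
  | succ fuel ih =>
    intro s i b hI hpot hfuel
    have hc : ∀ a, (lllStep b i).val = a → (lllLoop (fuel + 1) b i).cost =
        (lllStep b i).cost + (match a with
          | Sum.inl (b', i') => lllLoop fuel b' i'
          | Sum.inr b' => pure (some b')).cost := by rintro a rfl; rfl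
    have hv : ∀ a, (lllStep b i).val = a → (lllLoop (fuel + 1) b i).val =
        (match a with
          | Sum.inl (b', i') => lllLoop fuel b' i'
          | Sum.inr b' => pure (some b')).val := by rintro a rfl; rfl
    by_cases hik : i < k
    · obtain ⟨b', i', h1, h2, h3, h4⟩ := lllStep_spec hI hik hBn hB hk hd hh
      obtain ⟨s', hs', hf'⟩ : ∃ s', potential b' ≤ (4 / 3) ^ s' ∧ 2 * s' + (k - i') + 1 ≤ fuel := by
        rcases h3 with ⟨e1, e2⟩ | ⟨e1, e2⟩
        · exact ⟨s, e2 ▸ hpot, by omega⟩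
        · rcases s with _ | s
          · have := one_le_potential b' h2.pos
            rw [pow_zero] at hpot; linarith
          · refine ⟨s, ?_, by omega⟩
            rw [pow_succ] at hpot; linarith
      obtain ⟨b'', g1, g2, g3⟩ := ih s' i' b' h2 hs' hf'
      refine ⟨b'', ?_, g2, ?_⟩
      · rw [hv _ h1]; exact g1
      · rw [hc _ h1, add_mul, one_mul, add_comm]
        exact add_le_add g3 h4
    · have hik' : i = k := le_antisymm hI.le_card (not_lt.1 hik)
      have h1 : lllStep b i = ⟨Sum.inr b, 1⟩ := by rw [lllStep, dif_neg hik]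
      refine ⟨b, ?_, hik' ▸ hI, ?_⟩
      · rw [hv _ (by rw [h1])]; rfl
      · rw [hc (Sum.inr b) (by rw [h1]), h1, cost_pure]
        have : 1 ≤ B ^ 110 := Nat.one_le_pow _ _ (by omega)
        nlinarith

/-- The potential at the start, with `4 ≤ (4 / 3) ^ 6`. -/
theorem potential_le {b : Fin k → Fin d → ℤ} {h : ℕ} (hp : ∀ l, 0 < pivot (gram b) l)
    (hle : ∀ l : Fin k, pivot (gram b) l ≤ 4 ^ h) :
    potential b ≤ (4 / 3) ^ (6 * (h * k * (k + 1))) := by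
  have h1 : ∀ l, pivot (gram b) l ≤ 4 ^ h := by
    intro l
    by_cases hl : l < k
    · exact hle ⟨l, hl⟩
    · rw [pivot, dif_neg hl]; exact one_le_pow₀ (by norm_num)
  have h2 : ∀ l ∈ Finset.range (k + 1), pivotProd (gram b) l ≤ (4 ^ h) ^ k := by
    intro l hl
    calc pivotProd (gram b) l ≤ ∏ _r ∈ Finset.range l, (4 : ℝ) ^ h :=
          Finset.prod_le_prod (fun r _ => (hp r).le) fun r _ => h1 r
      _ = (4 ^ h) ^ l := by simp
      _ ≤ (4 ^ h) ^ k := pow_le_pow_right₀ (one_le_pow₀ (by norm_num)) (by simp at hl; omega)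
  calc potential b ≤ ∏ _l ∈ Finset.range (k + 1), ((4 : ℝ) ^ h) ^ k :=
        Finset.prod_le_prod (fun r _ => (pivotProd_pos hp r).le) h2
    _ = 4 ^ (h * k * (k + 1)) := by simp [← pow_mul]
    _ ≤ ((4 / 3) ^ 6) ^ (h * k * (k + 1)) := pow_le_pow_left₀ (by norm_num) (by norm_num) _
    _ = _ := (pow_mul _ _ _).symm

theorem sum_sq_eq_quadForm (b : Fin k → Fin d → ℤ) (c : Fin k → ℤ) :
    ∑ t, (((∑ a, c a • b a) t : ℤ) : ℝ) ^ 2 = ∑ a, ∑ a', (c a : ℝ) * c a' * gram b a a' := by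
  simp only [gram, Finset.mul_sum]
  rw [Finset.sum_congr rfl fun a _ => Finset.sum_comm, Finset.sum_comm]
  refine Finset.sum_congr rfl fun t _ => ?_
  simp only [Finset.sum_apply, Pi.smul_apply, smul_eq_mul, Int.cast_sum, Int.cast_mul, sq,
    Finset.sum_mul_sum]
  exact Finset.sum_congr rfl fun a _ => Finset.sum_congr rfl fun a' _ => by ring

/-- The LLL algorithm ends after polynomially many bit operations with a nonzero lattice vector
which is a shortest one up to the factor `2 ^ ((k - 1) / 2)`. -/
theorem lll_spec {b : Fin k → Fin d → ℤ} {h B : ℕ} (hk0 : 0 < k)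
    (hp : ∀ l, 0 < pivot (gram b) l) (hb : ∀ a t, |b a t| ≤ 2 ^ h)
    (hB : 4 ≤ B) (hk : k ≤ B) (hd : d ≤ B) (hh : h ≤ B) :
    ∃ fuel z, (lll fuel b).val = some z ∧ z ∈ Submodule.span ℤ (Set.range b) ∧ z ≠ 0 ∧
      (∀ v ∈ Submodule.span ℤ (Set.range b), v ≠ 0 →
        ∑ t, z t ^ 2 ≤ 2 ^ (k - 1) * ∑ t, v t ^ 2) ∧
      (lll fuel b).cost ≤ B ^ 228 := by
  set h' := h + k + d with hh'
  set Bn : ℝ := d * 4 ^ h with hBn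
  have hkd : ∀ m : ℕ, (m : ℝ) ≤ 4 ^ m := fun m => by
    exact_mod_cast (Nat.lt_pow_self (n := m) (a := 4) (by norm_num)).le
  have hdiag : ∀ a, gram b a a ≤ Bn := by
    intro a
    calc gram b a a ≤ ∑ _t : Fin d, (4 : ℝ) ^ h := by
          refine Finset.sum_le_sum fun t _ => ?_
          have h1 : ((b a t : ℤ) : ℝ) * b a t ≤ 2 ^ h * 2 ^ h := by
            have := mul_self_le_mul_self (abs_nonneg _) (hb a t)
            rw [abs_mul_abs_self] at this
            exact_mod_cast this
          rwa [← mul_pow, show (2 : ℝ) * 2 = 4 by norm_num] at h1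
      _ = Bn := by simp [hBn]
  have hkBn : k * Bn ≤ 4 ^ h' := by
    calc (k : ℝ) * Bn ≤ 4 ^ k * (4 ^ d * 4 ^ h) := by
          rw [hBn]; gcongr <;> exact hkd _
      _ = _ := by rw [hh']; ring
  have hBn0 : 0 ≤ Bn := by positivity
  have hle4 : ∀ l : Fin k, pivot (gram b) l ≤ 4 ^ h' := fun l => by
    have h1 := (pivot_le_diag b hp l).trans (hdiag l)
    have h2 : (1 : ℝ) ≤ k := by exact_mod_cast hk0
    nlinarith
  have hI : LLLInv (Submodule.span ℤ (Set.range b)) Bn h' b 1 :=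
    ⟨rfl, hp, fun l => (pivot_le_diag b hp l).trans (hdiag l),
      fun a t => (hb a t).trans (pow_le_pow_right₀ (by norm_num) (by omega)), le_rfl, hk0,
      by intro l hl; omega⟩
  have hBB : B ≤ B ^ 2 := Nat.le_self_pow (by norm_num) B
  have hh'B : h' ≤ B ^ 2 := by
    calc h' ≤ 4 * B := by omega
      _ ≤ B * B := by gcongr
      _ = _ := (sq B).symm
  -- `lllLoop_spec` with `s = 6 h' k (k + 1)`, the exponent in `potential_le`
  set fuel := 2 * (6 * (h' * k * (k + 1))) + (k - 1) + 1 with hfuel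
  obtain ⟨b', g1, g2, g3⟩ := lllLoop_spec hkBn (hB.trans hBB) (hk.trans hBB) (hd.trans hBB) hh'B
    fuel (6 * (h' * k * (k + 1))) 1 b hI (potential_le hp hle4) le_rfl
  set z : Fin d → ℤ := b' ⟨0, hk0⟩ with hz
  have hv : ∀ a, (lllLoop fuel b 1).val = a → (lll fuel b).val = (match a with
      | none => (pure none : Timed (Option (Fin d → ℤ)))
      | some b' => pure (some fun t => if h : 0 < k then b' ⟨0, h⟩ t else 0)).val := by
    rintro a rfl; rfl
  have hc : (lll fuel b).cost = (lllLoop fuel b 1).cost := by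
    have : ∀ a, (lllLoop fuel b 1).val = a → (lll fuel b).cost = (lllLoop fuel b 1).cost +
      (match a with
      | none => (pure none : Timed (Option (Fin d → ℤ)))
      | some b' => pure (some fun t => if h : 0 < k then b' ⟨0, h⟩ t else 0)).cost := by
      rintro a rfl; rfl
    rw [this _ g1]; rfl
  have hzz : ∑ t, ((z t : ℤ) : ℝ) ^ 2 = pivot (gram b') 0 := by
    rw [pivot, dif_pos hk0]
    simp [schur, gram, hz, sq]
  refine ⟨fuel, z, ?_, ?_, ?_, ?_, ?_⟩
  · rw [hv _ g1]
    simp [hk0, hz]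
  · rw [← g2.span]; exact Submodule.subset_span ⟨_, rfl⟩
  · intro h0
    have h1 := g2.pos 0
    rw [← hzz, h0] at h1
    simp at h1
  · intro v hv hv0
    rw [← g2.span, Submodule.mem_span_range_iff_exists_fun] at hv
    obtain ⟨c, rfl⟩ := hv
    have hc0 : c ≠ 0 := by rintro rfl; simp at hv0
    obtain ⟨m, hm⟩ := exists_pivot_le_quadForm (gram_symm b') g2.pos c hc0
    rw [← sum_sq_eq_quadForm] at hm
    -- along the reduced basis the pivots decrease at most by a factor two
    have hchain : ∀ m : ℕ, m < k → pivot (gram b') 0 ≤ 2 ^ m * pivot (gram b') m := by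
      intro m
      induction m with
      | zero => intro _; simp
      | succ m ih =>
        intro hm
        have h1 := ih (by omega)
        have h2 := g2.stage m hm
        calc _ ≤ _ := h1
          _ ≤ 2 ^ m * (2 * pivot (gram b') (m + 1)) := by gcongr
          _ = _ := by ring
    have h1 := hchain m m.2
    have h2 : (2 : ℝ) ^ (m : ℕ) ≤ 2 ^ (k - 1) := pow_le_pow_right₀ (by norm_num) (by omega)
    have h3 : ∑ t, ((z t : ℤ) : ℝ) ^ 2 ≤
        2 ^ (k - 1) * ∑ t, (((∑ a, c a • b' a) t : ℤ) : ℝ) ^ 2 := by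
      rw [hzz]
      refine h1.trans (mul_le_mul h2 hm (g2.pos m).le (by positivity))
    exact_mod_cast h3
  · rw [hc]
    refine g3.trans ?_
    have h1 : fuel ≤ B ^ 8 := by
      have h2 : h' * k * (k + 1) ≤ B ^ 5 := by
        calc h' * k * (k + 1) ≤ B ^ 2 * B * (B + B) := by gcongr; omega
          _ = 2 * B ^ 4 := by ring
          _ ≤ B * B ^ 4 := by gcongr; omega
          _ = _ := by ring
      have h3 : k ≤ B ^ 5 := hk.trans (Nat.le_self_pow (by norm_num) B)
      have hk1 : k - 1 + 1 = k := by omega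
      calc fuel ≤ 16 * B ^ 5 := by omega
        _ ≤ (B * B) * B ^ 5 := by gcongr; nlinarith
        _ = B ^ 7 := by ring
        _ ≤ _ := Nat.pow_le_pow_right (by omega) (by norm_num)
    calc fuel * (B ^ 2) ^ 110 ≤ B ^ 8 * (B ^ 2) ^ 110 := Nat.mul_le_mul_right _ h1
      _ = _ := by ring

end LLL

end Timed

namespace Timed

/-! ### Euclid's algorithm -/

theorem euclid_zero (a : ℤ) : euclid a 0 = ⟨a, 1⟩ := by rw [euclid, dif_pos rfl]

theorem euclid_of_ne {a b : ℤ} (hb : b ≠ 0) :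
    euclid a b = ⟨(euclid b (Int.tmod a b)).val,
      bits a * bits b + (euclid b (Int.tmod a b)).cost⟩ := by
  rw [euclid, dif_neg hb]

theorem one_le_bits (x : ℤ) : 1 ≤ bits x := by unfold bits; omega

/-- The number of division steps is logarithmic since two steps halve the second argument. -/
theorem euclid_cost_aux {s : ℕ} (n : ℕ) : ∀ a b : ℤ, |a| ≤ 2 ^ s → |b| ≤ 2 ^ s →
    b.natAbs < 2 ^ n →
    |(euclid a b).val| ≤ 2 ^ s ∧ (euclid a b).cost ≤ (2 * n + 1) * (s + 2) ^ 2 := by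
  have hC : 1 ≤ (s + 2) ^ 2 := Nat.one_le_pow _ _ (by omega)
  induction n with
  | zero =>
    intro a b ha _ hn
    have : b = 0 := by simpa using hn
    subst this
    rw [euclid_zero]
    exact ⟨ha, by simp only; omega⟩
  | succ n ih =>
    intro a b ha hb hn
    by_cases hb0 : b = 0
    · subst hb0
      rw [euclid_zero]
      exact ⟨ha, by simp only; nlinarith⟩
    have h1 := bits_mul_bits_le ha hb
    have hr : (Int.tmod a b).natAbs < b.natAbs := by
      rw [Int.natAbs_tmod]; exact Nat.mod_lt _ (Int.natAbs_pos.2 hb0)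
    have hrs : |Int.tmod a b| ≤ 2 ^ s := by
      refine le_trans ?_ hb
      rw [Int.abs_eq_natAbs, Int.abs_eq_natAbs]; exact_mod_cast hr.le
    rw [euclid_of_ne hb0]
    by_cases hr0 : Int.tmod a b = 0
    · rw [hr0, euclid_zero]
      exact ⟨hb, by simp only; nlinarith⟩
    rw [euclid_of_ne hr0]
    have h2 := bits_mul_bits_le hb hrs
    have h3 : (Int.tmod b (Int.tmod a b)).natAbs < 2 ^ n := by
      rw [Int.natAbs_tmod]
      have hpos := Int.natAbs_pos.2 hr0
      have hlt := Nat.mod_lt b.natAbs hpos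
      have := Nat.mod_add_div b.natAbs (Int.tmod a b).natAbs
      have hdiv : 1 ≤ b.natAbs / (Int.tmod a b).natAbs := Nat.div_pos hr.le hpos
      have hm : (Int.tmod a b).natAbs ≤
          (Int.tmod a b).natAbs * (b.natAbs / (Int.tmod a b).natAbs) := Nat.le_mul_of_pos_right _ hdiv
      rw [pow_succ] at hn
      omega
    have h4 : |Int.tmod b (Int.tmod a b)| ≤ 2 ^ s := by
      refine le_trans ?_ hrs
      rw [Int.abs_eq_natAbs, Int.abs_eq_natAbs, Int.natAbs_tmod b]
      exact_mod_cast (Nat.mod_lt _ (Int.natAbs_pos.2 hr0)).le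
    have h5 := ih _ _ hrs h4 h3
    refine ⟨h5.1, ?_⟩
    simp only
    nlinarith [h5.2]

theorem euclid_cost {s : ℕ} {a b : ℤ} (ha : |a| ≤ 2 ^ s) (hb : |b| ≤ 2 ^ s) :
    |(euclid a b).val| ≤ 2 ^ s ∧ (euclid a b).cost ≤ (2 * (s + 1) + 1) * (s + 2) ^ 2 := by
  apply euclid_cost_aux (s + 1) a b ha hb
  have h1 : b.natAbs ≤ 2 ^ s := by zify; simpa using hb
  exact h1.trans_lt (Nat.pow_lt_pow_right (by norm_num) (Nat.lt_succ_self s))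

theorem mul_tmod_mul (q a b : ℤ) : Int.tmod (q * a) (q * b) = q * Int.tmod a b := by
  rcases lt_trichotomy q 0 with h | rfl | h
  · have h' : 0 < -q := by omega
    have := Int.mul_tmod_mul_of_pos a b h'
    rw [neg_mul, neg_mul, Int.neg_tmod, Int.tmod_neg] at this
    linarith
  · simp
  · exact Int.mul_tmod_mul_of_pos a b h

/-- Since remainders are rounded towards zero, Euclid's algorithm commutes with multiplication by an
integer of either sign. -/
theorem euclid_mul (q : ℤ) (a b : ℕ) : (euclid (q * a) (q * b)).val = q * (Nat.gcd b a : ℕ) := by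
  rcases eq_or_ne q 0 with rfl | hq
  · simp [euclid_zero]
  induction b using Nat.strong_induction_on generalizing a with
  | _ b ih =>
    rcases Nat.eq_zero_or_pos b with rfl | hb
    · simp [euclid_zero]
    · have hb' : q * (b : ℤ) ≠ 0 := mul_ne_zero hq (by exact_mod_cast hb.ne')
      rw [euclid_of_ne hb']
      simp only
      rw [mul_tmod_mul, ← Int.ofNat_tmod, ih _ (Nat.mod_lt _ hb), Nat.gcd_rec b a]

theorem gcdAll_spec {p s : ℕ} {z : Fin p → ℤ} (q : ℤ) (b : Fin p → ℕ) (hz : ∀ j, z j = q * b j)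
    (hs : ∀ j, |z j| ≤ 2 ^ s) :
    (gcdAll z).val = q * (Finset.univ.gcd b : ℕ) ∧
      (gcdAll z).cost ≤ p * ((2 * (s + 1) + 1) * (s + 2) ^ 2) := by
  have key := foldlM_finRange_spec (fun g j => euclid g (z j))
    (fun l v => v = q * ((Finset.univ.filter fun j : Fin p => j.val < l).gcd b : ℕ) ∧ |v| ≤ 2 ^ s)
    ((2 * (s + 1) + 1) * (s + 2) ^ 2) 0 (by simp) (by
      rintro l v ⟨hv, hb⟩
      obtain ⟨h1, h2⟩ := euclid_cost hb (hs l)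
      refine ⟨⟨?_, h1⟩, h2⟩
      have : (Finset.univ.filter fun i : Fin p => i.val < l + 1) =
          insert l (Finset.univ.filter fun i : Fin p => i.val < l) := by
        ext i; simp [Fin.ext_iff]; omega
      rw [this, Finset.gcd_insert, hv, hz, euclid_mul]
      rfl)
  refine ⟨?_, key.2⟩
  rw [gcdAll, key.1.1]; simp

/-! ### The lattice of the extended Lagarias-Odlyzko algorithm -/

section Lattice

variable {n p : ℕ}

/-- The columns of the matrix of the extended Lagarias-Odlyzko algorithm. -/
def eloMatrix (m : ℤ) (X : Fin n → Fin p → ℤ) (Y : Fin n → ℤ) :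
    Fin (p + n + n) → Fin (n + p + n) → ℤ :=
  Fin.append (Fin.append
    (fun j => Fin.append (Fin.append (fun i => m * X i j) (Pi.single j 1)) 0)
    (fun i => Fin.append (Fin.append (Pi.single i (0 - m * Y i)) 0) 0))
    (fun i => Fin.append (Fin.append (Pi.single i m) 0) (Pi.single i 1))

variable {S : Type*} [CommRing S] (m : ℤ) (X : Fin n → Fin p → ℤ) (Y : Fin n → ℤ)
  (c : Fin (p + n + n) → S)

/-- The top block of a lattice vector is `m (X x - Y ∘ y + v)`, where `x`, `y`, `v` are the three
blocks of the coefficient vector `c`; the other two blocks are `x` and `v`. -/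
theorem sum_eloMatrix_top (i : Fin n) :
    ∑ s, c s * (eloMatrix m X Y s (Fin.castAdd n (Fin.castAdd p i)) : S) =
      m * (∑ j, (X i j : S) * c (Fin.castAdd n (Fin.castAdd n j))
        - Y i * c (Fin.castAdd n (Fin.natAdd p i)) + c (Fin.natAdd (p + n) i)) := by
  rw [Fin.sum_univ_add, Fin.sum_univ_add]
  simp only [eloMatrix, Fin.append_left, Fin.append_right, Pi.single_apply, Int.cast_ite,
    Int.cast_zero, mul_ite, mul_zero, Finset.sum_ite_eq, Finset.mem_univ, if_true]
  have : ∑ j, c (Fin.castAdd n (Fin.castAdd n j)) * ((m * X i j : ℤ) : S) =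
      m * ∑ j, (X i j : S) * c (Fin.castAdd n (Fin.castAdd n j)) := by
    rw [Finset.mul_sum]; refine Finset.sum_congr rfl fun j _ => ?_; push_cast; ring
  rw [this]; push_cast; ring

theorem sum_eloMatrix_mid (j : Fin p) :
    ∑ s, c s * (eloMatrix m X Y s (Fin.castAdd n (Fin.natAdd n j)) : S) =
      c (Fin.castAdd n (Fin.castAdd n j)) := by
  rw [Fin.sum_univ_add, Fin.sum_univ_add]
  simp [eloMatrix, Fin.append_left, Fin.append_right, Pi.single_apply]

theorem sum_eloMatrix_bot (i : Fin n) :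
    ∑ s, c s * (eloMatrix m X Y s (Fin.natAdd (n + p) i) : S) = c (Fin.natAdd (p + n) i) := by
  rw [Fin.sum_univ_add, Fin.sum_univ_add]
  simp [eloMatrix, Fin.append_left, Fin.append_right, Pi.single_apply]

/-- The columns are linearly independent, as `x` and `v` can be read off and `Y ∘ y` then determines
`y`. -/
theorem pivot_eloMatrix_pos {m : ℤ} (hm : m ≠ 0) {Y : Fin n → ℤ} (hY : ∀ i, Y i ≠ 0) (l : ℕ) :
    0 < pivot (gram (eloMatrix m X Y)) l := by
  refine pivot_pos_of_posDef (gram_symm _) (fun z hz => ?_) l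
  have e : ∑ a, ∑ c, z a * z c * gram (eloMatrix m X Y) a c =
      ∑ t, (∑ a, z a * (eloMatrix m X Y a t : ℝ)) ^ 2 := by
    simp only [gram, Finset.mul_sum]
    rw [Finset.sum_congr rfl fun a _ => Finset.sum_comm, Finset.sum_comm]
    refine Finset.sum_congr rfl fun t _ => ?_
    rw [sq, Finset.sum_mul_sum]
    exact Finset.sum_congr rfl fun a _ => Finset.sum_congr rfl fun a' _ => by ring
  rw [e]
  refine lt_of_le_of_ne (Finset.sum_nonneg fun t _ => sq_nonneg _) fun h0 => hz ?_
  have h1 := (Finset.sum_eq_zero_iff_of_nonneg (fun t _ => sq_nonneg _)).1 h0.symm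
  have h2 : ∀ t, ∑ a, z a * (eloMatrix m X Y a t : ℝ) = 0 := fun t => by
    simpa using h1 t (Finset.mem_univ t)
  have hx : ∀ j, z (Fin.castAdd n (Fin.castAdd n j)) = 0 := fun j => by
    rw [← sum_eloMatrix_mid m X Y z j]; exact h2 _
  have hw : ∀ i, z (Fin.natAdd (p + n) i) = 0 := fun i => by
    rw [← sum_eloMatrix_bot m X Y z i]; exact h2 _
  have hy : ∀ i, z (Fin.castAdd n (Fin.natAdd p i)) = 0 := fun i => by
    have := h2 (Fin.castAdd n (Fin.castAdd p i))
    rw [sum_eloMatrix_top m X Y z i] at this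
    have hm' : (m : ℝ) ≠ 0 := by exact_mod_cast hm
    have hY' : (Y i : ℝ) ≠ 0 := by exact_mod_cast hY i
    simpa [hx, hw, hm', hY'] using this
  ext a
  induction a using Fin.addCases with
  | left a =>
    induction a using Fin.addCases with
    | left a => exact hx a
    | right a => exact hy a
  | right a => exact hw a

theorem abs_eloMatrix_le {m : ℤ} {X : Fin n → Fin p → ℤ} {Y : Fin n → ℤ} {h : ℕ}
    (hm : |m| ≤ 2 ^ h) (hX : ∀ i j, |m * X i j| ≤ 2 ^ h) (hY : ∀ i, |m * Y i| ≤ 2 ^ h)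
    (s : Fin (p + n + n)) (t : Fin (n + p + n)) : |eloMatrix m X Y s t| ≤ 2 ^ h := by
  have h0 : (0 : ℤ) ≤ 2 ^ h := by positivity
  have h1 : (1 : ℤ) ≤ 2 ^ h := one_le_pow₀ (by norm_num)
  unfold eloMatrix
  induction s using Fin.addCases with
  | left s =>
    induction s using Fin.addCases with
    | left s =>
      induction t using Fin.addCases with
      | left t =>
        induction t using Fin.addCases with
        | left t => simpa using hX t s
        | right t =>
          simp only [Fin.append_left, Fin.append_right, Pi.single_apply]
          split_ifs <;> simp [h0, h1]
      | right t => simp [h0]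
    | right s =>
      induction t using Fin.addCases with
      | left t =>
        induction t using Fin.addCases with
        | left t =>
          simp only [Fin.append_left, Fin.append_right, Pi.single_apply]
          split_ifs with hts
          · rw [zero_sub, abs_neg]; exact hY s
          · simp [h0]
        | right t => simp [h0]
      | right t => simp [h0]
  | right s =>
    induction t using Fin.addCases with
    | left t =>
      induction t using Fin.addCases with
      | left t =>
        simp only [Fin.append_left, Fin.append_right, Pi.single_apply]
        split_ifs <;> simp [h0, hm]
      | right t => simp [h0]
    | right t =>
      simp only [Fin.append_right, Pi.single_apply]
      split_ifs <;> simp [h0, h1]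

theorem sum_sq_append (v : Fin (n + p + n) → ℤ) :
    ∑ t, v t ^ 2 = ∑ i, v (Fin.castAdd n (Fin.castAdd p i)) ^ 2 +
      ∑ j, v (Fin.castAdd n (Fin.natAdd n j)) ^ 2 + ∑ i, v (Fin.natAdd (n + p) i) ^ 2 := by
  rw [Fin.sum_univ_add, Fin.sum_univ_add]

end Lattice

end Timed

namespace Timed

/-! ### The extended Lagarias-Odlyzko algorithm on a good input -/

section ELO

variable {n p : ℕ}

/-- The entries of `Y₁ = Y + X Z`, with those of absolute value less than `3` replaced by `3`. -/
def shiftedObs (Y : Fin n → ℤ) (X : Fin n → Fin p → ℤ) (Z : Fin p → ℤ) (i : Fin n) : ℤ :=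
  if 3 ≤ |Y i + ∑ j, X i j * Z j| then Y i + ∑ j, X i j * Z j else 3

theorem three_le_abs_shiftedObs (Y : Fin n → ℤ) (X : Fin n → Fin p → ℤ) (Z : Fin p → ℤ)
    (i : Fin n) : 3 ≤ |shiftedObs Y X Z i| := by
  unfold shiftedObs; split_ifs with h
  · exact h
  · norm_num

theorem abs_le_pow_mono {x : ℤ} {s t : ℕ} (hx : |x| ≤ 2 ^ s) (h : s ≤ t) : |x| ≤ 2 ^ t :=
  hx.trans (pow_le_pow_right₀ (by norm_num) h)

theorem abs_mul_le_pow {x y : ℤ} {s t u : ℕ} (hx : |x| ≤ 2 ^ s) (hy : |y| ≤ 2 ^ t)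
    (h : s + t ≤ u) : |x * y| ≤ 2 ^ u := by
  refine abs_le_pow_mono (s := s + t) ?_ h
  rw [abs_mul, pow_add]
  exact mul_le_mul hx hy (abs_nonneg _) (by positivity)

theorem abs_add_le_pow {x y : ℤ} {s u : ℕ} (hx : |x| ≤ 2 ^ s) (hy : |y| ≤ 2 ^ s)
    (h : s + 1 ≤ u) : |x + y| ≤ 2 ^ u := by
  refine abs_le_pow_mono (s := s + 1) ?_ h
  have := abs_add_le x y
  rw [pow_succ']; linarith

/-- The scaling factor `m` of the algorithm. -/
def eloScale (n p : ℕ) (R W : ℤ) : ℤ :=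
  (pow2 (n + (p + 1) / 2 + 3)).val * (p * (R * (ceilSqrt p).val + W * (ceilSqrt n).val))

/-- The last steps of the algorithm, which read off the result from a short lattice vector. -/
def eloReadout (Z : Fin p → ℤ) (z : Fin (n + p + n) → ℤ) : Timed (Option (Fin p → ℤ)) := do
  let x : Fin p → ℤ := fun j => z (Fin.castAdd n (Fin.natAdd n j))
  let g ← gcdAll x
  if g = 0 then pure (some 0)
  else do
    let out ← forEach fun j => do
      let q ← quo (x j) g
      sub q (Z j)
    pure (some out)

/-- The value and the cost of the algorithm, given the result of the lattice reduction. -/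
theorem ELO_of_lll {fuel : ℕ} {Y : Fin n → ℤ} {X : Fin n → Fin p → ℤ} {R W : ℤ} {Z : Fin p → ℤ}
    {Y₂ : Fin n → ℤ} {z : Fin (n + p + n) → ℤ}
    (hY₂ : Y₂ = fun i => if decide (3 ≤ |Y i + (dot (X i) Z).val|) = true then
      Y i + (dot (X i) Z).val else 3)
    (hl : (lll fuel (eloMatrix (eloScale n p R W) X Y₂)).val = some z) :
    (ELO fuel Y X R W Z).val = (eloReadout Z z).val ∧
    (ELO fuel Y X R W Z).cost =
      (forEach fun j => (⟨Z j, bits (Z j)⟩ : Timed ℤ)).cost +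
      ((forEach fun i => (do
        let s ← dot (X i) Z
        add (Y i) s : Timed ℤ)).cost +
      ((forEach fun i => (do
        let large ← le 3 |Y i + (dot (X i) Z).val|
        pure (if large then Y i + (dot (X i) Z).val else 3) : Timed ℤ)).cost +
      ((pow2 (n + (p + 1) / 2 + 3)).cost + ((ceilSqrt p).cost + ((ceilSqrt n).cost +
      (bits R * bits (ceilSqrt p).val + (bits W * bits (ceilSqrt n).val +
      (bits (R * (ceilSqrt p).val) * bits (W * (ceilSqrt n).val) +
      (bits p * bits (R * (ceilSqrt p).val + W * (ceilSqrt n).val) +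
      (bits (pow2 (n + (p + 1) / 2 + 3)).val *
        bits (p * (R * (ceilSqrt p).val + W * (ceilSqrt n).val)) +
      ((eloBasis (eloScale n p R W) X Y₂).cost +
      ((lll fuel (eloMatrix (eloScale n p R W) X Y₂)).cost +
      (eloReadout Z z).cost)))))))))))) := by
  subst hY₂
  constructor
  · have : ∀ a, (lll fuel (eloMatrix (eloScale n p R W) X fun i =>
        if decide (3 ≤ |Y i + (dot (X i) Z).val|) = true then
          Y i + (dot (X i) Z).val else 3)).val = a → (ELO fuel Y X R W Z).val =
        (match a with
          | none => (pure none : Timed (Option (Fin p → ℤ)))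
          | some z => eloReadout Z z).val := by rintro a rfl; rfl
    rw [this _ hl]
  · rw [show (eloReadout Z z).cost = (match some z with
          | none => (pure none : Timed (Option (Fin p → ℤ)))
          | some z => eloReadout Z z).cost from rfl, ← hl]
    rfl

/-- If the middle part of the lattice vector is a nonzero multiple of `b = β + Z` with coprime
entries, then `β` is read off, whatever the sign of the multiple. -/
theorem eloReadout_spec {s : ℕ} {Z β : Fin p → ℤ} {z : Fin (n + p + n) → ℤ} {b : Fin p → ℕ}
    {q : ℤ} (hq : q ≠ 0) (hz : ∀ j, z (Fin.castAdd n (Fin.natAdd n j)) = q * b j)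
    (hb : ∀ j, (b j : ℤ) = β j + Z j) (hgcd : Finset.univ.gcd b = 1)
    (hs : ∀ j, |q * (b j : ℤ)| ≤ 2 ^ s) (hbs : ∀ j, |(b j : ℤ)| ≤ 2 ^ s)
    (hqs : |q| ≤ 2 ^ s) (hZ : ∀ j, |Z j| ≤ 2 ^ s) :
    (eloReadout Z z).val = some β ∧
      (eloReadout Z z).cost ≤ p * ((2 * (s + 1) + 1) * (s + 2) ^ 2) + p * (2 * (s + 2) ^ 2 + 1) := by
  obtain ⟨hg, hgc⟩ := gcdAll_spec (s := s) q b hz (fun j => by rw [hz]; exact hs j)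
  rw [hgcd, Nat.cast_one, mul_one] at hg
  have hdiv : ∀ j, q * (b j : ℤ) / q = b j := fun j => Int.mul_ediv_cancel_left _ hq
  have hv : (eloReadout Z z).val = some fun j => q * (b j : ℤ) / q - Z j := by
    have : ∀ g, (gcdAll fun j => z (Fin.castAdd n (Fin.natAdd n j))).val = g →
        (eloReadout Z z).val = (if g = 0 then pure (some 0)
          else do
            let out ← forEach fun j => do
              let q ← quo (z (Fin.castAdd n (Fin.natAdd n j))) g
              sub q (Z j)
            pure (some out) : Timed (Option (Fin p → ℤ))).val := by rintro g rfl; rfl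
    rw [this q hg, if_neg hq]
    simp only [hz]
    rfl
  refine ⟨?_, ?_⟩
  · rw [hv]
    congr 1
    ext j
    rw [hdiv, hb]; ring
  · have : ∀ g, (gcdAll fun j => z (Fin.castAdd n (Fin.natAdd n j))).val = g →
        (eloReadout Z z).cost = (gcdAll fun j => z (Fin.castAdd n (Fin.natAdd n j))).cost +
        (if g = 0 then pure (some 0)
          else do
            let out ← forEach fun j => do
              let q ← quo (z (Fin.castAdd n (Fin.natAdd n j))) g
              sub q (Z j)
            pure (some out) : Timed (Option (Fin p → ℤ))).cost := by rintro g rfl; rfl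
    rw [this q hg, if_neg hq]
    refine add_le_add hgc ?_
    simp only [hz]
    rw [cost_bind, cost_pure, add_zero]
    apply cost_forEach_le
    intro j
    change bits (q * (b j : ℤ)) * bits q + bits (q * (b j : ℤ) / q) * bits (Z j) ≤ _
    rw [hdiv]
    have h1 := bits_mul_bits_le (hs j) hqs
    have h2 := bits_mul_bits_le (hbs j) (hZ j)
    omega

/-- The scaling factor exceeds the approximation factor `2 ^ ((p + 2 n - 1) / 2)` times the length
of a vector whose squared length `q₀` is bounded in terms of the input. -/
theorem eloScale_spec {R W q₀ : ℤ} (hp0 : 0 < p) (hR : 1 ≤ R) (hW : 1 ≤ W)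
    (hq₀le : q₀ ≤ 64 * (p ^ 2 * (R ^ 2 * p + W ^ 2 * n))) :
    1 ≤ eloScale n p R W ∧ 2 ^ (p + n + n - 1) * q₀ < eloScale n p R W ^ 2 := by
  obtain ⟨rp0, -, rpk, -⟩ := ceilSqrt_spec p
  obtain ⟨rn0, -, rnk, -⟩ := ceilSqrt_spec n
  rw [eloScale, (pow2_spec _).1]
  generalize (ceilSqrt p).val = rp at *
  generalize (ceilSqrt n).val = rn at *
  have hp1 : (1 : ℤ) ≤ p := by exact_mod_cast hp0
  have hrp1 : 1 ≤ rp := by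
    by_contra! h
    have : rp = 0 := by omega
    rw [this] at rpk; norm_num at rpk; omega
  obtain ⟨U, hU⟩ : ∃ U : ℤ, U = p * (R * rp + W * rn) := ⟨_, rfl⟩
  rw [← hU]
  have hU2 : p ^ 2 * (R ^ 2 * p + W ^ 2 * n) ≤ U ^ 2 := by
    have h1 : R ^ 2 * p ≤ R ^ 2 * rp ^ 2 := mul_le_mul_of_nonneg_left rpk (sq_nonneg R)
    have h2 : W ^ 2 * n ≤ W ^ 2 * rn ^ 2 := mul_le_mul_of_nonneg_left rnk (sq_nonneg W)
    have h3 : 0 ≤ (R * rp) * (W * rn) := by positivity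
    rw [hU, mul_pow]
    apply mul_le_mul_of_nonneg_left _ (sq_nonneg _)
    nlinarith
  have hU1 : 1 ≤ U := by
    have h1 : 1 ≤ R * rp := by nlinarith
    have h2 : 0 ≤ W * rn := by positivity
    rw [hU]; nlinarith
  have he1 : (1 : ℤ) ≤ 2 ^ (n + (p + 1) / 2 + 3) := one_le_pow₀ (by norm_num)
  refine ⟨by nlinarith, ?_⟩
  have h1 : (2 : ℤ) ^ (p + n + n - 1) * 64 < (2 ^ (n + (p + 1) / 2 + 3)) ^ 2 := by
    have : (64 : ℤ) = 2 ^ 6 := by norm_num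
    rw [this, ← pow_add, ← pow_mul]
    exact pow_lt_pow_right₀ (by norm_num) (by omega)
  have h2 : 0 < U ^ 2 := by positivity
  calc 2 ^ (p + n + n - 1) * q₀ ≤ 2 ^ (p + n + n - 1) * (64 * U ^ 2) := by
        apply mul_le_mul_of_nonneg_left _ (by positivity); linarith
    _ = 2 ^ (p + n + n - 1) * 64 * U ^ 2 := by ring
    _ < (2 ^ (n + (p + 1) / 2 + 3)) ^ 2 * U ^ 2 := mul_lt_mul_of_pos_right h1 h2
    _ = _ := by ring

/-- The output of the reduction, for a scaling factor which exceeds the approximation factor times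
the length of the planted vector `(0, b, Y₂ - X b)`: the top part of a short lattice vector
vanishes. -/
theorem lll_eloMatrix_spec {B : ℕ} (hp0 : 0 < p) {X : Fin n → Fin p → ℤ} {m : ℤ} (hm : 1 ≤ m)
    {Y₂ : Fin n → ℤ} (hY₂ : ∀ i, 3 ≤ |Y₂ i|) (b : Fin p → ℕ) (hb0 : ∀ j, 0 < b j)
    {q₀ : ℤ} (hq₀ : q₀ = ∑ j, (b j : ℤ) ^ 2 + ∑ i, (Y₂ i - ∑ j, X i j * b j) ^ 2)
    (hlt : 2 ^ (p + n + n - 1) * q₀ < m ^ 2) {h : ℕ}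
    (hA : ∀ s t, |eloMatrix m X Y₂ s t| ≤ 2 ^ h)
    (hB : 4 ≤ B) (hk : p + n + n ≤ B) (hh : h ≤ B)
    (hkey : ∀ (x : Fin p → ℤ) (y v : Fin n → ℤ),
      ∑ j, x j ^ 2 + ∑ i, v i ^ 2 ≤ 2 ^ (p + n + n - 1) * q₀ →
      (∀ i, ∑ j, X i j * x j - Y₂ i * y i + v i = 0) →
      (x ≠ 0 ∨ y ≠ 0 ∨ v ≠ 0) → ∃ q : ℤ, q ≠ 0 ∧ ∀ j, x j = q * b j) :
    ∃ fuel z, ∃ q : ℤ, (lll fuel (eloMatrix m X Y₂)).val = some z ∧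
      q ≠ 0 ∧ (∀ j, z (Fin.castAdd n (Fin.natAdd n j)) = q * b j) ∧
      (∀ j, |q * (b j : ℤ)| ≤ m) ∧ (lll fuel (eloMatrix m X Y₂)).cost ≤ B ^ 228 := by
  have hY2ne : ∀ i, Y₂ i ≠ 0 := fun i h => by
    have := hY₂ i
    rw [h] at this; norm_num at this
  obtain ⟨fuel, z, hl1, hl2, hl3, hl4, hl5⟩ := lll_spec (by omega)
    (pivot_eloMatrix_pos X (by omega) hY2ne) hA hB hk (by omega) hh
  refine ⟨fuel, z, ?_⟩
  obtain ⟨c, hc⟩ := (Submodule.mem_span_range_iff_exists_fun ℤ).1 hl2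
  have happ : ∀ (c : Fin (p + n + n) → ℤ) t, (∑ s, c s • eloMatrix m X Y₂ s) t =
      ∑ s, c s * ((eloMatrix m X Y₂ s t : ℤ) : ℤ) := fun c t => by simp [Finset.sum_apply]
  have htop := fun c i => (happ c _).trans (sum_eloMatrix_top m X Y₂ c i)
  have hmid := fun c j => (happ c _).trans (sum_eloMatrix_mid m X Y₂ c j)
  have hbot := fun c i => (happ c _).trans (sum_eloMatrix_bot m X Y₂ c i)
  simp only [Int.cast_id] at htop
  -- comparison with the planted vector
  have hnorm : ∑ t, z t ^ 2 ≤ 2 ^ (p + n + n - 1) * q₀ := by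
    let c₀ : Fin (p + n + n) → ℤ := Fin.append (Fin.append (fun j => (b j : ℤ)) (fun _ => 1))
      (fun i => Y₂ i - ∑ j, X i j * b j)
    have h1 : ∑ t, (∑ s, c₀ s • eloMatrix m X Y₂ s) t ^ 2 = q₀ := by
      rw [sum_sq_append, hq₀]
      simp only [htop, hmid, hbot]
      simp only [c₀, Fin.append_left, Fin.append_right]
      rw [Finset.sum_eq_zero]
      · rw [zero_add]
      · intro i _
        ring
    rw [← h1]
    refine hl4 _ ((Submodule.mem_span_range_iff_exists_fun ℤ).2 ⟨c₀, rfl⟩) fun h0 => ?_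
    have h2 := congrFun h0 (Fin.castAdd n (Fin.natAdd n ⟨0, hp0⟩))
    rw [hmid] at h2
    simp only [c₀, Fin.append_left, Pi.zero_apply] at h2
    have := hb0 ⟨0, hp0⟩
    omega
  have hzm : ∀ j, z (Fin.castAdd n (Fin.natAdd n j)) = c (Fin.castAdd n (Fin.castAdd n j)) :=
    fun j => by rw [← hc]; exact hmid c j
  rw [sum_sq_append] at hnorm
  simp only [hzm] at hnorm
  simp only [← hc, htop, hbot] at hnorm
  obtain ⟨x, hx⟩ : ∃ x : Fin p → ℤ, x = fun j => c (Fin.castAdd n (Fin.castAdd n j)) := ⟨_, rfl⟩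
  obtain ⟨y, hy⟩ : ∃ y : Fin n → ℤ, y = fun i => c (Fin.castAdd n (Fin.natAdd p i)) := ⟨_, rfl⟩
  obtain ⟨v, hv⟩ : ∃ v : Fin n → ℤ, v = fun i => c (Fin.natAdd (p + n) i) := ⟨_, rfl⟩
  have hnorm' : ∑ i, m ^ 2 * (∑ j, X i j * x j - Y₂ i * y i + v i) ^ 2 + ∑ j, x j ^ 2
      + ∑ i, v i ^ 2 ≤ 2 ^ (p + n + n - 1) * q₀ := by
    simpa only [hx, hy, hv, mul_pow] using hnorm
  have hsx : 0 ≤ ∑ j, x j ^ 2 := Finset.sum_nonneg fun _ _ => sq_nonneg _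
  have hsv : 0 ≤ ∑ i, v i ^ 2 := Finset.sum_nonneg fun _ _ => sq_nonneg _
  have hst : 0 ≤ ∑ i, m ^ 2 * (∑ j, X i j * x j - Y₂ i * y i + v i) ^ 2 :=
    Finset.sum_nonneg fun _ _ => mul_nonneg (sq_nonneg _) (sq_nonneg _)
  -- a nonzero entry of the top block would contribute at least `m ^ 2`
  have hzero : ∀ i, ∑ j, X i j * x j - Y₂ i * y i + v i = 0 := by
    intro i
    by_contra hne
    have h1 := Finset.single_le_sum
      (f := fun i => m ^ 2 * (∑ j, X i j * x j - Y₂ i * y i + v i) ^ 2)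
      (fun _ _ => mul_nonneg (sq_nonneg _) (sq_nonneg _)) (Finset.mem_univ i)
    have h2 : 1 ≤ (∑ j, X i j * x j - Y₂ i * y i + v i) ^ 2 := by
      have : 0 < (∑ j, X i j * x j - Y₂ i * y i + v i) ^ 2 := by positivity
      omega
    have h3 : m ^ 2 * 1 ≤ m ^ 2 * (∑ j, X i j * x j - Y₂ i * y i + v i) ^ 2 :=
      mul_le_mul_of_nonneg_left h2 (sq_nonneg m)
    linarith
  obtain ⟨q, hq0, hxq⟩ := hkey x y v (by linarith) hzero (by
    by_contra! h
    obtain ⟨h1, h2, h3⟩ := h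
    apply hl3
    have : c = 0 := by
      ext a
      induction a using Fin.addCases with
      | left a =>
        induction a using Fin.addCases with
        | left a => exact congrFun (hx.symm.trans h1) a
        | right a => exact congrFun (hy.symm.trans h2) a
      | right a => exact congrFun (hv.symm.trans h3) a
    rw [← hc, this]; simp)
  have hzx : ∀ j, z (Fin.castAdd n (Fin.natAdd n j)) = x j := fun j => by rw [hzm, hx]
  refine ⟨q, hl1, hq0, fun j => (hzx j).trans (hxq j), fun j => ?_, hl5⟩
  rw [← hxq]
  apply abs_le_of_sq_le_sq _ (by omega)
  have := Finset.single_le_sum (f := fun j => x j ^ 2) (fun _ _ => sq_nonneg _)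
    (Finset.mem_univ j)
  linarith

theorem eloBasis_cost {B : ℕ} (hB : 4 ≤ B) (hnB : n ≤ B) (hpB : p ≤ B) {m : ℤ}
    {X : Fin n → Fin p → ℤ} {Y : Fin n → ℤ} (hm : |m| ≤ 2 ^ (16 * B))
    (hX : ∀ i j, |X i j| ≤ 2 ^ (16 * B)) (hY : ∀ i, |Y i| ≤ 2 ^ (16 * B))
    (hmY : ∀ i, |m * Y i| ≤ 2 ^ (16 * B)) : (eloBasis m X Y).cost ≤ B ^ 20 := by
  have h4 : 4 * B ≤ B ^ 2 := by rw [sq]; exact Nat.mul_le_mul_right _ hB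
  have h16 : 16 * B ≤ B ^ (2 + 1) := by
    calc 16 * B ≤ (B * B) * B := Nat.mul_le_mul_right _ (Nat.mul_le_mul hB hB)
      _ = _ := by ring
  have d1 : (forEach fun i => forEach fun j => mul m (X i j)).cost ≤ B ^ 12 :=
    cost_forEach_le_pow hB hnB fun i => cost_forEach_le_pow hB hpB fun j =>
      bits_mul_bits_le_pow (f := 8) 2 hB hm (hX i j) h16
  have d2 : (forEach fun i => (do
      let y ← mul m (Y i)
      sub 0 y : Timed ℤ)).cost ≤ B ^ 11 :=
    cost_forEach_le_pow hB hnB fun i => add_le_pow_succ hB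
      (bits_mul_bits_le_pow (f := 8) 2 hB hm (hY i) h16)
      (bits_mul_bits_le_pow (f := 8) (x := 0) 2 hB (by rw [abs_zero]; positivity) (hmY i) h16)
  have d3 : (forEach fun s => forEach fun t => (⟨eloMatrix m X Y s t, 1⟩ : Timed ℤ)).cost ≤
      (B ^ 2) ^ 4 :=
    cost_forEach_le_pow (e := 2) (by omega) (by omega) fun s =>
      cost_forEach_le_pow (e := 0) (by omega) (by omega) fun t => by rw [pow_zero]
  refine le_trans (add_le_pow_succ hB (e := 13) (pow_le_pow_of_le' hB d1 (by norm_num))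
    (add_le_pow_succ hB (e := 12) (pow_le_pow_of_le' hB d2 (by norm_num)) ?_))
    (Nat.pow_le_pow_right (by omega) (by norm_num))
  refine d3.trans ?_
  rw [← pow_mul]
  exact Nat.pow_le_pow_right (by omega) (by norm_num)

/-- If the vectors of the lattice that are as short as the first vector of the reduced basis all
have a middle part which is a nonzero multiple of the positive vector `b = β + Z` with coprime
entries, then the algorithm recovers `β`. -/
theorem ELO_spec {B : ℕ} (hp0 : 0 < p) {Y : Fin n → ℤ} {X : Fin n → Fin p → ℤ}
    {R W : ℤ} {Z β : Fin p → ℤ} (b : Fin p → ℕ) (hb : ∀ j, (b j : ℤ) = β j + Z j)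
    (hb0 : ∀ j, 0 < b j) (hgcd : Finset.univ.gcd b = 1) (hR : 1 ≤ R) (hW : 1 ≤ W)
    (hB : 4 ≤ B) (hnB : n ≤ B) (hpB : p ≤ B) (hYB : ∀ i, |Y i| ≤ 2 ^ B)
    (hXB : ∀ i j, |X i j| ≤ 2 ^ B) (hZB : ∀ j, |Z j| ≤ 2 ^ B) (hRB : |R| ≤ 2 ^ B)
    (hWB : |W| ≤ 2 ^ B) {q₀ : ℤ}
    (hq₀ : q₀ = ∑ j, (b j : ℤ) ^ 2 + ∑ i, (shiftedObs Y X Z i - ∑ j, X i j * b j) ^ 2)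
    (hq₀le : q₀ ≤ 64 * (p ^ 2 * (R ^ 2 * p + W ^ 2 * n)))
    (hkey : ∀ (x : Fin p → ℤ) (y v : Fin n → ℤ),
      ∑ j, x j ^ 2 + ∑ i, v i ^ 2 ≤ 2 ^ (p + n + n - 1) * q₀ →
      (∀ i, ∑ j, X i j * x j - shiftedObs Y X Z i * y i + v i = 0) →
      (x ≠ 0 ∨ y ≠ 0 ∨ v ≠ 0) → ∃ q : ℤ, q ≠ 0 ∧ ∀ j, x j = q * b j) :
    ∃ fuel, (ELO fuel Y X R W Z).val = some β ∧ (ELO fuel Y X R W Z).cost ≤ B ^ 700 := by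
  obtain ⟨hm1, hlt⟩ := eloScale_spec hp0 hR hW hq₀le
  obtain ⟨rp0, rpp, -, rpc⟩ := ceilSqrt_spec p
  obtain ⟨rn0, rnn, -, rnc⟩ := ceilSqrt_spec n
  obtain ⟨hev, hec⟩ := pow2_spec (n + (p + 1) / 2 + 3)
  have hB3 : 16 * B ≤ B ^ 3 := by
    calc 16 * B ≤ (B * B) * B := Nat.mul_le_mul_right _ (Nat.mul_le_mul hB hB)
      _ = _ := by ring
  have hpz : |(p : ℤ)| ≤ 2 ^ B := by
    rw [abs_of_nonneg (Int.natCast_nonneg p)]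
    exact (nat_le_two_pow p).trans (pow_le_pow_right₀ (by norm_num) hpB)
  have hrpz : |(ceilSqrt p).val| ≤ 2 ^ B := by
    rw [abs_of_nonneg rp0]
    exact rpp.trans ((nat_le_two_pow p).trans (pow_le_pow_right₀ (by norm_num) hpB))
  have hrnz : |(ceilSqrt n).val| ≤ 2 ^ B := by
    rw [abs_of_nonneg rn0]
    exact rnn.trans ((nat_le_two_pow n).trans (pow_le_pow_right₀ (by norm_num) hnB))
  have hu := abs_mul_le_pow hRB hrpz (le_refl (B + B))
  have hv := abs_mul_le_pow hWB hrnz (le_refl (B + B))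
  have hs := abs_add_le_pow hu hv (le_refl (B + B + 1))
  have ht := abs_mul_le_pow hpz hs (show B + (B + B + 1) ≤ 4 * B by omega)
  have hez : |(pow2 (n + (p + 1) / 2 + 3)).val| ≤ 2 ^ (3 * B) := by
    rw [hev, abs_of_nonneg (pow_nonneg (by norm_num) _)]
    exact pow_le_pow_right₀ (by norm_num) (by omega)
  have hmz : |eloScale n p R W| ≤ 2 ^ (7 * B) := abs_mul_le_pow hez ht (by omega)
  have hXZ : ∀ i, (dot (X i) Z).val = ∑ j, X i j * Z j ∧
      (dot (X i) Z).cost ≤ p * (2 * (p + (B + B) + 2) ^ 2) := fun i => dot_spec (hXB i) hZB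
  have hXZb : ∀ i, |∑ j, X i j * Z j| ≤ 2 ^ (3 * B) := fun i =>
    abs_le_pow_mono (abs_sum_mul_le (hXB i) hZB) (by omega)
  have hY1b : ∀ i, |Y i + ∑ j, X i j * Z j| ≤ 2 ^ (4 * B) := fun i =>
    abs_add_le_pow (abs_le_pow_mono (hYB i) (by omega)) (hXZb i) (by omega)
  have hY2b : ∀ i, |shiftedObs Y X Z i| ≤ 2 ^ (4 * B) := fun i => by
    rw [shiftedObs]; split_ifs
    · exact hY1b i
    · exact abs_le_pow_mono (s := 2) (by norm_num) (by omega)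
  have hmX : ∀ i j, |eloScale n p R W * X i j| ≤ 2 ^ (11 * B) := fun i j =>
    abs_mul_le_pow hmz (hXB i j) (by omega)
  have hmY : ∀ i, |eloScale n p R W * shiftedObs Y X Z i| ≤ 2 ^ (11 * B) := fun i =>
    abs_mul_le_pow hmz (hY2b i) (by omega)
  have hBB3 : B ≤ B ^ 3 := Nat.le_self_pow (by norm_num) B
  obtain ⟨fuel, z, q, hl, hq, hz, hzb, hlc⟩ := lll_eloMatrix_spec (B := B ^ 3) hp0 hm1
    (three_le_abs_shiftedObs Y X Z) b hb0 hq₀ hlt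
    (abs_eloMatrix_le (abs_le_pow_mono hmz (by omega)) hmX hmY) (by omega) (by omega) (by omega)
    hkey
  have hY₂ : shiftedObs Y X Z = fun i => if decide (3 ≤ |Y i + (dot (X i) Z).val|) = true then
      Y i + (dot (X i) Z).val else 3 := by
    ext i
    simp only [(hXZ i).1, shiftedObs, decide_eq_true_eq]
  obtain ⟨e1, e2⟩ := ELO_of_lll hY₂ hl
  have hqb : ∀ j, |q * (b j : ℤ)| ≤ 2 ^ (7 * B) := fun j =>
    (hzb j).trans ((le_abs_self _).trans hmz)
  obtain ⟨r1, r2⟩ := eloReadout_spec (s := 7 * B) hq hz hb hgcd hqb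
    (fun j => by
      refine le_trans ?_ (hqb j)
      rw [abs_mul]
      exact le_mul_of_one_le_left (abs_nonneg _) (Int.one_le_abs hq))
    (by
      refine le_trans ?_ (hqb ⟨0, hp0⟩)
      rw [abs_mul]
      refine le_mul_of_one_le_right (abs_nonneg _) (Int.one_le_abs ?_)
      have := hb0 ⟨0, hp0⟩
      omega)
    (fun j => abs_le_pow_mono (hZB j) (by omega))
  refine ⟨fuel, e1.trans r1, ?_⟩
  rw [e2]
  have h16 : 16 * B ≤ B ^ (2 + 1) := hB3
  have two_B : ∀ {x : ℤ} {s : ℕ}, |x| ≤ 2 ^ s → s ≤ 16 * B → |x| ≤ 2 ^ (16 * B) :=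
    fun hx h => abs_le_pow_mono hx h
  have hbits : ∀ {x y : ℤ} {s t : ℕ}, |x| ≤ 2 ^ s → |y| ≤ 2 ^ t → s ≤ 16 * B → t ≤ 16 * B →
      bits x * bits y ≤ B ^ 8 := fun hx hy h1 h2 =>
    bits_mul_bits_le_pow (f := 8) 2 hB (two_B hx h1) (two_B hy h2) h16
  have hone : ∀ {x : ℤ} {s : ℕ}, |x| ≤ 2 ^ s → s ≤ 16 * B → bits x ≤ B ^ 8 := fun hx h1 =>
    (Nat.le_mul_of_pos_right _ (one_le_bits _)).trans (hbits hx hx h1 h1)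
  have hdot : p * (2 * (p + (B + B) + 2) ^ 2) ≤ B ^ 8 := by
    calc p * (2 * (p + (B + B) + 2) ^ 2) ≤ B * (B * (4 * B) ^ 2) := by gcongr <;> omega
      _ ≤ B * (B * (B * B) ^ 2) := by gcongr
      _ = B ^ 6 := by ring
      _ ≤ _ := Nat.pow_le_pow_right (by omega) (by norm_num)
  have hsqrt : ∀ k ≤ B, k * (3 * (2 * k + 2) ^ 2) ≤ B ^ 8 := by
    intro k hk
    calc k * (3 * (2 * k + 2) ^ 2) ≤ B * (B * (4 * B) ^ 2) := by gcongr <;> omega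
      _ ≤ B * (B * (B * B) ^ 2) := by gcongr
      _ = B ^ 6 := by ring
      _ ≤ _ := Nat.pow_le_pow_right (by omega) (by norm_num)
  have c1 : (forEach fun j => (⟨Z j, bits (Z j)⟩ : Timed ℤ)).cost ≤ B ^ 10 :=
    cost_forEach_le_pow hB hpB fun j => hone (hZB j) (by omega)
  have c2 : (forEach fun i => (do
        let s ← dot (X i) Z
        add (Y i) s : Timed ℤ)).cost ≤ B ^ 11 :=
    cost_forEach_le_pow hB hnB fun i => by
      refine add_le_pow_succ hB ((hXZ i).2.trans hdot) ?_
      change bits (Y i) * bits (dot (X i) Z).val ≤ _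
      rw [(hXZ i).1]
      exact hbits (hYB i) (hXZb i) (by omega) (by omega)
  have c3 : (forEach fun i => (do
        let large ← le 3 |Y i + (dot (X i) Z).val|
        pure (if large then Y i + (dot (X i) Z).val else 3) : Timed ℤ)).cost ≤ B ^ 10 :=
    cost_forEach_le_pow hB hnB fun i => by
      rw [(hXZ i).1]
      change bits 3 * bits |Y i + ∑ j, X i j * Z j| + 0 ≤ _
      exact hbits (s := 2) (by norm_num) (by rw [abs_abs]; exact hY1b i) (by omega) (by omega)
  have c4 : (pow2 (n + (p + 1) / 2 + 3)).cost ≤ B ^ 8 := by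
    refine hec.trans ?_
    calc (n + (p + 1) / 2 + 3) * (n + (p + 1) / 2 + 3 + 3) ^ 2 ≤ (4 * B) * (4 * B) ^ 2 := by
          gcongr <;> omega
      _ ≤ (B * B) * (B * B) ^ 2 := by gcongr
      _ = B ^ 6 := by ring
      _ ≤ _ := Nat.pow_le_pow_right (by omega) (by norm_num)
  have c5 := rpc.trans (hsqrt p hpB)
  have c6 := rnc.trans (hsqrt n hnB)
  have c7 := hbits hRB hrpz (by omega) (by omega)
  have c8 := hbits hWB hrnz (by omega) (by omega)
  have c9 := hbits hu hv (by omega) (by omega)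
  have c10 := hbits hpz hs (by omega) (by omega)
  have c11 := hbits hez ht (by omega) (by omega)
  have c12 : (eloBasis (eloScale n p R W) X (shiftedObs Y X Z)).cost ≤ B ^ 20 :=
    eloBasis_cost hB hnB hpB (abs_le_pow_mono hmz (by omega))
      (fun i j => abs_le_pow_mono (hXB i j) (by omega))
      (fun i => abs_le_pow_mono (hY2b i) (by omega))
      fun i => abs_le_pow_mono (hmY i) (by omega)
  have c13 : (lll fuel (eloMatrix (eloScale n p R W) X (shiftedObs Y X Z))).cost ≤ B ^ 684 :=
    hlc.trans (le_of_eq (by rw [← pow_mul]))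
  have c14 : (eloReadout Z z).cost ≤ B ^ 20 := by
    refine r2.trans ?_
    have h7 : 7 * B + 2 ≤ B ^ 3 := by omega
    have h15 : 2 * (7 * B + 1) + 1 ≤ B ^ 3 := by omega
    refine le_trans (add_le_pow_succ hB (e := 10) ?_ ?_)
      (Nat.pow_le_pow_right (by omega) (by norm_num))
    · calc p * ((2 * (7 * B + 1) + 1) * (7 * B + 2) ^ 2) ≤ B * (B ^ 3 * (B ^ 3) ^ 2) := by gcongr
        _ = B ^ 10 := by ring
    · calc p * (2 * (7 * B + 2) ^ 2 + 1) ≤ B * (2 * (B ^ 3) ^ 2 + (B ^ 3) ^ 2) := by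
            gcongr
            exact Nat.one_le_pow _ _ (by positivity)
        _ = 3 * B ^ 7 := by ring
        _ ≤ B * B ^ 7 := by gcongr; omega
        _ = B ^ 8 := by ring
        _ ≤ _ := Nat.pow_le_pow_right (by omega) (by norm_num)
  have L : ∀ {a e f : ℕ}, a ≤ B ^ e → e ≤ f → a ≤ B ^ f := fun h1 h2 =>
    pow_le_pow_of_le' hB h1 h2
  have A : ∀ {a b e f : ℕ}, a ≤ B ^ e → b ≤ B ^ f → e ≤ f → a + b ≤ B ^ (f + 1) :=
    fun h1 h2 h => add_le_pow_succ hB (L h1 h) h2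
  have k13 := add_le_pow_succ hB c13 (L c14 (by norm_num))
  have k11 := A c11 (A c12 k13 (by norm_num)) (by norm_num)
  have k9 := A c9 (A c10 k11 (by norm_num)) (by norm_num)
  have k7 := A c7 (A c8 k9 (by norm_num)) (by norm_num)
  have k5 := A c5 (A c6 k7 (by norm_num)) (by norm_num)
  have k3 := A c3 (A c4 k5 (by norm_num)) (by norm_num)
  have k1 := A c1 (A c2 k3 (by norm_num)) (by norm_num)
  exact L k1 (by norm_num)

end ELO

end Timed

/-! ### Truncation -/

theorem abs_truncInt (N : ℕ) (x : ℝ) : |(truncInt N x : ℝ)| = ⌊(2 : ℝ) ^ N * |x|⌋ := by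
  have h0 : (0 : ℝ) ≤ ⌊(2 : ℝ) ^ N * |x|⌋ := by
    exact_mod_cast Int.floor_nonneg.2 (by positivity)
  rcases lt_trichotomy x 0 with h | h | h
  · simp [truncInt, h, abs_of_nonneg h0, abs_neg]
  · simp [truncInt, h]
  · simp [truncInt, h, abs_of_nonneg h0]

theorem abs_truncInt_le (N : ℕ) (x : ℝ) : |(truncInt N x : ℝ)| ≤ 2 ^ N * |x| := by
  rw [abs_truncInt]; exact Int.floor_le _

theorem abs_truncInt_sub_le (N : ℕ) (x : ℝ) : |(truncInt N x : ℝ) - 2 ^ N * x| ≤ 1 := by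
  have h1 := Int.floor_le ((2 : ℝ) ^ N * |x|)
  have h2 := (Int.lt_floor_add_one ((2 : ℝ) ^ N * |x|)).le
  rcases lt_trichotomy x 0 with h | h | h
  · have e : (truncInt N x : ℝ) = -(⌊(2 : ℝ) ^ N * |x|⌋ : ℝ) := by simp [truncInt, h]
    rw [e]
    rw [abs_of_neg h] at *
    rw [abs_le]; constructor <;> linarith
  · simp [truncInt, h]
  · have e : (truncInt N x : ℝ) = (⌊(2 : ℝ) ^ N * |x|⌋ : ℝ) := by simp [truncInt, h]
    rw [e]
    rw [abs_of_pos h] at *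
    rw [abs_le]; constructor <;> linarith

/-! ### Short vectors of the lattice -/

/-- For a typical sample, the middle part of a short lattice vector is a multiple of `b`.
The last hypothesis excludes all near-solutions of the truncated linear system other than these
multiples; the bound on `y` comes from the lower bound for the entries of `Y₂`. -/
theorem exists_eq_mul_of_short {n p : ℕ} {X : Fin n → Fin p → ℝ} {XE : Fin n → Fin p → ℤ}
    {E A P C H : ℝ} {b : Fin p → ℕ} {Y₂ : Fin n → ℤ} (hpP : (p : ℝ) ≤ P)
    (hA : 1 ≤ A) (hP : 1 ≤ P) (hC : 1 ≤ C) (hH : 1 ≤ H) (hE : 40 * (H * C * P ^ 3 * A) ≤ E)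
    (hXE : ∀ i j, |(XE i j : ℝ) - E * X i j| ≤ 1) (hXE' : ∀ i j, |(XE i j : ℝ)| ≤ E * |X i j|)
    (hb : ∑ j, (b j : ℝ) ≤ 4 * (P * A))
    (hw : ∀ i, |(Y₂ i : ℝ) - ∑ j, (XE i j : ℝ) * b j| ≤ 10 * (P * A))
    (hX : ∀ i, ∑ j, |X i j| ≤ P ^ 3)
    (hlow : ∀ i, 1 / (C * P ^ 2) ≤ |∑ j, X i j * b j|)
    (hunion : ∀ (x : Fin p → ℤ) (y : Fin n → ℤ), (∀ j, |(x j : ℝ)| ≤ 8 * (H * P * A)) →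
      (∀ i, |(y i : ℝ)| ≤ 32 * (H * C * P ^ 6 * A)) → (∀ i, ∃ j, x j ≠ y i * b j) →
      ∃ i, 480 * (H * C * P ^ 7 * A ^ 2) / E < |∑ j, X i j * ((x j - y i * b j : ℤ) : ℝ)|)
    (x : Fin p → ℤ) (y v : Fin n → ℤ) (hx : ∀ j, |(x j : ℝ)| ≤ 8 * (H * P * A))
    (hv : ∀ i, |(v i : ℝ)| ≤ 8 * (H * P * A))
    (heq : ∀ i, ∑ j, XE i j * x j - Y₂ i * y i + v i = 0) (hne : x ≠ 0 ∨ y ≠ 0 ∨ v ≠ 0) :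
    ∃ q : ℤ, q ≠ 0 ∧ ∀ j, x j = q * b j := by
  have hC0 : 0 < C := by linarith
  have hP0 : 0 < P := by linarith
  have hA0 : 0 < A := by linarith
  have hH0 : 0 < H := by linarith
  have hE0 : 0 < E := lt_of_lt_of_le (by positivity) hE
  have heq' : ∀ i, ∑ j, (XE i j : ℝ) * x j - Y₂ i * y i + v i = 0 := fun i => by
    exact_mod_cast heq i
  have hPA : P * A ≤ H * C * P ^ 3 * A := by
    have h1 : 1 ≤ H * C * P ^ 2 := one_le_mul_of_one_le_of_one_le
      (one_le_mul_of_one_le_of_one_le hH hC) (one_le_pow₀ hP)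
    calc P * A = 1 * (P * A) := (one_mul _).symm
      _ ≤ H * C * P ^ 2 * (P * A) := by gcongr
      _ = _ := by ring
  -- replacing `E X` by its integer part
  have hround : ∀ (i : Fin n) (u : Fin p → ℝ),
      |∑ j, (XE i j : ℝ) * u j - E * ∑ j, X i j * u j| ≤ ∑ j, |u j| := by
    intro i u
    rw [Finset.mul_sum, ← Finset.sum_sub_distrib]
    refine (Finset.abs_sum_le_sum_abs _ _).trans (Finset.sum_le_sum fun j _ => ?_)
    rw [← mul_assoc, ← sub_mul, abs_mul]
    exact mul_le_of_le_one_left (abs_nonneg _) (hXE i j)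
  have hbabs : ∑ j, |(b j : ℝ)| = ∑ j, (b j : ℝ) := by simp
  have hC2 : 0 < C * P ^ 2 := by positivity
  -- the entries of `Y₂` are close to those of `E X b`, which are not small
  have hY : ∀ i, E / (2 * (C * P ^ 2)) ≤ |(Y₂ i : ℝ)| := by
    intro i
    have h1 := hround i fun j => (b j : ℝ)
    rw [hbabs] at h1
    have h2 := hw i
    have h3 : E * (1 / (C * P ^ 2)) ≤ |E * ∑ j, X i j * (b j : ℝ)| := by
      rw [abs_mul, abs_of_pos hE0]; exact mul_le_mul_of_nonneg_left (hlow i) hE0.le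
    have h4 : 14 * (P * A) ≤ E / (2 * (C * P ^ 2)) := by
      rw [le_div_iff₀ (by positivity)]
      calc 14 * (P * A) * (2 * (C * P ^ 2)) = 28 * (1 * C * P ^ 3 * A) := by ring
        _ ≤ 40 * (H * C * P ^ 3 * A) := by gcongr; norm_num
        _ ≤ E := hE
    have h5 : E * (1 / (C * P ^ 2)) = E / (2 * (C * P ^ 2)) + E / (2 * (C * P ^ 2)) := by
      field_simp; norm_num
    have h6 := abs_sub_abs_le_abs_sub (E * ∑ j, X i j * (b j : ℝ)) (∑ j, (XE i j : ℝ) * b j)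
    rw [abs_sub_comm] at h1 h2
    have h7 := abs_sub_abs_le_abs_sub (∑ j, (XE i j : ℝ) * b j) (Y₂ i : ℝ)
    linarith
  -- hence the equation bounds `y`
  have hylt : ∀ i, |(y i : ℝ)| ≤ 32 * (H * C * P ^ 6 * A) := by
    intro i
    have h1 : |(Y₂ i : ℝ)| * |(y i : ℝ)| ≤ 8 * (H * P * A) * (E * P ^ 3 + 1) := by
      have e : (Y₂ i : ℝ) * y i = ∑ j, (XE i j : ℝ) * x j + v i := by linarith [heq' i]
      rw [← abs_mul, e]
      refine (abs_add_le _ _).trans ?_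
      have h2 : |∑ j, (XE i j : ℝ) * x j| ≤ E * P ^ 3 * (8 * (H * P * A)) := by
        calc _ ≤ ∑ j, |(XE i j : ℝ) * x j| := Finset.abs_sum_le_sum_abs _ _
          _ ≤ ∑ j, E * |X i j| * (8 * (H * P * A)) := Finset.sum_le_sum fun j _ => by
            rw [abs_mul]
            exact mul_le_mul (hXE' i j) (hx j) (abs_nonneg _) (by positivity)
          _ = E * (∑ j, |X i j|) * (8 * (H * P * A)) := by
            rw [← Finset.sum_mul, ← Finset.mul_sum]
          _ ≤ _ := by gcongr; exact hX i
      linarith [hv i]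
    have h2 : E / (2 * (C * P ^ 2)) * |(y i : ℝ)| ≤ 8 * (H * P * A) * (E * P ^ 3 + 1) :=
      (mul_le_mul_of_nonneg_right (hY i) (abs_nonneg _)).trans h1
    have h3 : E * P ^ 3 + 1 ≤ 2 * (E * P ^ 3) := by
      have hE1 : 1 ≤ E := by
        have h4 := one_le_mul_of_one_le_of_one_le hP hA
        linarith
      have := one_le_mul_of_one_le_of_one_le hE1 (one_le_pow₀ (n := 3) hP)
      linarith
    rw [div_mul_eq_mul_div, div_le_iff₀ (by positivity)] at h2
    have h4 : E * |(y i : ℝ)| ≤ E * (32 * (H * C * P ^ 6 * A)) := by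
      calc _ ≤ _ := h2
        _ ≤ 8 * (H * P * A) * (2 * (E * P ^ 3)) * (2 * (C * P ^ 2)) := by gcongr
        _ = _ := by ring
    exact le_of_mul_le_mul_left h4 hE0
  -- if `x` is none of the vectors `y i • b`, then the equation makes the measurements of all
  -- `x - y i • b` small, which was excluded
  by_cases hex : ∀ i, ∃ j, x j ≠ y i * b j
  · exfalso
    obtain ⟨i, hi⟩ := hunion x y hx hylt hex
    refine absurd hi (not_lt.2 ?_)
    rw [le_div_iff₀ hE0, ← abs_of_pos hE0, ← abs_mul, mul_comm]
    have h1 := hround i fun j => ((x j - y i * b j : ℤ) : ℝ)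
    have h2 : ∑ j, (XE i j : ℝ) * ((x j - y i * b j : ℤ) : ℝ) =
        ((Y₂ i : ℝ) - ∑ j, (XE i j : ℝ) * b j) * y i - v i := by
      have e : ∑ j, (XE i j : ℝ) * ((x j - y i * b j : ℤ) : ℝ) =
          ∑ j, (XE i j : ℝ) * x j - (∑ j, (XE i j : ℝ) * b j) * y i := by
        rw [Finset.sum_mul, ← Finset.sum_sub_distrib]
        refine Finset.sum_congr rfl fun j _ => ?_
        push_cast; ring
      rw [e]; linarith [heq' i]
    have h3 : |∑ j, (XE i j : ℝ) * ((x j - y i * b j : ℤ) : ℝ)| ≤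
        10 * (P * A) * (32 * (H * C * P ^ 6 * A)) + 8 * (H * P * A) := by
      rw [h2]
      refine (abs_sub _ _).trans (add_le_add ?_ (hv i))
      rw [abs_mul]
      exact mul_le_mul (hw i) (hylt i) (abs_nonneg _) (by positivity)
    have h4 : ∑ j, |((x j - y i * b j : ℤ) : ℝ)| ≤
        P * (8 * (H * P * A)) + 32 * (H * C * P ^ 6 * A) * (4 * (P * A)) := by
      calc _ ≤ ∑ j, (8 * (H * P * A) + 32 * (H * C * P ^ 6 * A) * b j) := by
            refine Finset.sum_le_sum fun j _ => ?_
            push_cast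
            refine (abs_sub _ _).trans (add_le_add (hx j) ?_)
            rw [abs_mul, Nat.abs_cast]
            exact mul_le_mul_of_nonneg_right (hylt i) (Nat.cast_nonneg _)
        _ = p * (8 * (H * P * A)) + 32 * (H * C * P ^ 6 * A) * ∑ j, (b j : ℝ) := by
            rw [Finset.sum_add_distrib, Finset.mul_sum]; simp
        _ ≤ _ := by gcongr
    have h5 : |E * ∑ j, X i j * ((x j - y i * b j : ℤ) : ℝ)| ≤
        10 * (P * A) * (32 * (H * C * P ^ 6 * A)) + 8 * (H * P * A) +
        (P * (8 * (H * P * A)) + 32 * (H * C * P ^ 6 * A) * (4 * (P * A))) := by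
      have h6 := abs_sub_abs_le_abs_sub (E * ∑ j, X i j * ((x j - y i * b j : ℤ) : ℝ))
        (∑ j, (XE i j : ℝ) * ((x j - y i * b j : ℤ) : ℝ))
      rw [abs_sub_comm] at h6
      linarith
    refine h5.trans ?_
    have hHA : 0 ≤ H * A := by positivity
    have h7 : H * P * A ≤ H * C * P ^ 7 * A ^ 2 := by
      calc H * P * A = H * 1 * P ^ 1 * A ^ 1 := by ring
        _ ≤ H * C * P ^ 7 * A ^ 2 := by gcongr <;> first | assumption | norm_num
    have h8 : P * (H * P * A) ≤ H * C * P ^ 7 * A ^ 2 := by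
      calc P * (H * P * A) = H * 1 * P ^ 2 * A ^ 1 := by ring
        _ ≤ H * C * P ^ 7 * A ^ 2 := by gcongr <;> first | assumption | norm_num
    nlinarith
  -- if `x = y i • b` then `y i ≠ 0`: otherwise `x` vanishes, and so do `y` and `v`, because an
  -- entry of `Y₂` is larger than all entries of `v`
  · push Not at hex
    obtain ⟨i, hi⟩ := hex
    refine ⟨y i, fun hy0 => ?_, hi⟩
    have hx0 : x = 0 := by ext j; rw [hi j, hy0]; simp
    have hzero : ∀ i', y i' = 0 ∧ v i' = 0 := by
      intro i'
      have h1 := heq i'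
      rw [hx0] at h1
      simp only [Pi.zero_apply, mul_zero, Finset.sum_const_zero, zero_sub] at h1
      have h2 : v i' = Y₂ i' * y i' := by linarith
      by_cases hyi : y i' = 0
      · exact ⟨hyi, by rw [h2, hyi, mul_zero]⟩
      · exfalso
        have h3 : (1 : ℝ) ≤ |(y i' : ℝ)| := by
          exact_mod_cast Int.one_le_abs hyi
        have h4 : |(v i' : ℝ)| = |(Y₂ i' : ℝ)| * |(y i' : ℝ)| := by
          rw [h2, ← abs_mul]; push_cast; rfl
        have h5 := hY i'
        have h6 : 16 * (H * P * A) ≤ E / (2 * (C * P ^ 2)) := by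
          rw [le_div_iff₀ (by positivity)]
          calc 16 * (H * P * A) * (2 * (C * P ^ 2)) = 32 * (H * C * P ^ 3 * A) := by ring
            _ ≤ 40 * (H * C * P ^ 3 * A) := by gcongr; norm_num
            _ ≤ E := hE
        have h7 : |(Y₂ i' : ℝ)| ≤ |(Y₂ i' : ℝ)| * |(y i' : ℝ)| :=
          le_mul_of_one_le_right (abs_nonneg _) h3
        have h8 : 0 < H * P * A := by positivity
        linarith [hv i']
    rcases hne with h | h | h
    · exact h hx0
    · exact h (funext fun i' => (hzero i').1)
    · exact h (funext fun i' => (hzero i').2)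

/-! ### The lattice-based regression algorithm on a typical sample -/

/-- The value and the cost of the algorithm, given the result of its subroutine. -/
theorem LBR_of_ELO {n p fuel : ℕ} {Y : Fin n → ℝ} {X : Fin n → Fin p → ℝ} {N Q R : ℕ} {W : ℝ}
    {Z β : Fin p → ℤ}
    (h : (Timed.ELO fuel (fun i => Q * truncInt N (Y i)) (fun i j => truncInt N (X i j)) (Q * R)
      (2 * (Q * (⌈(2 : ℝ) ^ N * W⌉ + R * p))) Z).val = some β) :
    (LBR fuel Y X N Q R W Z).val = some (fun j => (β j : ℚ) / Q) ∧
    (LBR fuel Y X N Q R W Z).cost =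
      (Timed.forEach fun i => (⟨truncInt N (Y i), N + Timed.bits (truncInt N (Y i))⟩ : Timed ℤ)).cost
      + ((Timed.forEach fun i => Timed.forEach fun j =>
        (⟨truncInt N (X i j), N + Timed.bits (truncInt N (X i j))⟩ : Timed ℤ)).cost
      + ((N + Timed.bits ⌈(2 : ℝ) ^ N * W⌉)
      + ((Timed.forEach fun i => Timed.mul Q (truncInt N (Y i))).cost
      + (Timed.bits Q * Timed.bits R + (Timed.bits R * Timed.bits p
      + (Timed.bits ⌈(2 : ℝ) ^ N * W⌉ * Timed.bits (R * p)
      + (Timed.bits Q * Timed.bits (⌈(2 : ℝ) ^ N * W⌉ + R * p)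
      + (Timed.bits 2 * Timed.bits (Q * (⌈(2 : ℝ) ^ N * W⌉ + R * p))
      + ((Timed.ELO fuel (fun i => Q * truncInt N (Y i)) (fun i j => truncInt N (X i j)) (Q * R)
          (2 * (Q * (⌈(2 : ℝ) ^ N * W⌉ + R * p))) Z).cost
      + (Timed.forEach fun j =>
        (⟨(β j : ℚ) / Q, Timed.bits (β j) * Timed.bits Q⟩ : Timed ℚ)).cost))))))))) := by
  constructor
  · have : ∀ a, (Timed.ELO fuel (fun i => Q * truncInt N (Y i)) (fun i j => truncInt N (X i j))
        (Q * R) (2 * (Q * (⌈(2 : ℝ) ^ N * W⌉ + R * p))) Z).val = a →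
        (LBR fuel Y X N Q R W Z).val = (match a with
          | none => (pure none : Timed (Option (Fin p → ℚ)))
          | some b => do
            let out ← Timed.forEach fun j =>
              (⟨(b j : ℚ) / Q, Timed.bits (b j) * Timed.bits Q⟩ : Timed ℚ)
            pure (some out)).val := by rintro a rfl; rfl
    rw [this _ h]; rfl
  · rw [show (Timed.forEach fun j =>
        (⟨(β j : ℚ) / Q, Timed.bits (β j) * Timed.bits Q⟩ : Timed ℚ)).cost = (match some β with
          | none => (pure none : Timed (Option (Fin p → ℚ)))
          | some b => do
            let out ← Timed.forEach fun j =>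
              (⟨(b j : ℚ) / Q, Timed.bits (b j) * Timed.bits Q⟩ : Timed ℚ)
            pure (some out)).cost from rfl, ← h]
    rfl

/-- The noise in the integer system, in terms of the noise of the observations. -/
theorem abs_shiftedObs_sub_le {n p N Q R : ℕ} (hQ : 0 < Q) (hR : 0 < R) (hp : 0 < p)
    {X : Fin n → Fin p → ℝ} {β : Fin p → ℝ} {W : Fin n → ℝ} {βq Z : Fin p → ℤ} {b : Fin p → ℕ}
    (hβ : ∀ j, |β j| ≤ R) (hβq : ∀ j, (βq j : ℝ) = Q * β j) (hb : ∀ j, (b j : ℤ) = βq j + Z j)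
    (i : Fin n) :
    |(Timed.shiftedObs (fun i => Q * truncInt N (observations X β W i))
      (fun i j => truncInt N (X i j)) Z i : ℝ) - ∑ j, (truncInt N (X i j) : ℝ) * b j| ≤
      7 * ((Q : ℝ) * R * p) + Q * 2 ^ N * |W i| := by
  set XE : Fin n → Fin p → ℤ := fun i j => truncInt N (X i j) with hXE
  set Yi : ℤ := truncInt N (observations X β W i) with hYi
  have hQ1 : (1 : ℝ) ≤ Q := by exact_mod_cast hQ
  have hR1 : (1 : ℝ) ≤ R := by exact_mod_cast hR
  have hp1 : (1 : ℝ) ≤ p := by exact_mod_cast hp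
  have h1 : |((Q * Yi + ∑ j, XE i j * Z j : ℤ) : ℝ) - ∑ j, (XE i j : ℝ) * b j| ≤
      Q + Q * R * p + Q * 2 ^ N * |W i| := by
    have e1 : ((Q * Yi + ∑ j, XE i j * Z j : ℤ) : ℝ) - ∑ j, (XE i j : ℝ) * b j =
        Q * (Yi - 2 ^ N * observations X β W i) + Q * 2 ^ N * W i +
          ∑ j, (2 ^ N * X i j - XE i j) * βq j := by
      have e2 : ∀ j, (b j : ℝ) = βq j + Z j := fun j => by exact_mod_cast hb j
      have e3 : ∑ j, (2 ^ N * X i j - XE i j) * (βq j : ℝ) =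
          Q * 2 ^ N * ∑ j, X i j * β j - ∑ j, (XE i j : ℝ) * βq j := by
        rw [Finset.mul_sum, ← Finset.sum_sub_distrib]
        refine Finset.sum_congr rfl fun j _ => ?_
        rw [hβq]; ring
      rw [e3, observations]
      simp only [e2, mul_add, Finset.sum_add_distrib]
      push_cast
      ring
    rw [e1]
    have h2 : |(Q : ℝ) * (Yi - 2 ^ N * observations X β W i)| ≤ Q := by
      rw [abs_mul, Nat.abs_cast]
      exact mul_le_of_le_one_right (by positivity) (abs_truncInt_sub_le N _)
    have h3 : |(Q : ℝ) * 2 ^ N * W i| = Q * 2 ^ N * |W i| := by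
      rw [abs_mul, abs_of_nonneg (by positivity)]
    have h4 : |∑ j, (2 ^ N * X i j - XE i j) * (βq j : ℝ)| ≤ Q * R * p := by
      calc _ ≤ ∑ j, |(2 ^ N * X i j - XE i j) * (βq j : ℝ)| := Finset.abs_sum_le_sum_abs _ _
        _ ≤ ∑ _j : Fin p, 1 * ((Q : ℝ) * R) := by
          refine Finset.sum_le_sum fun j _ => ?_
          rw [abs_mul]
          refine mul_le_mul ?_ ?_ (abs_nonneg _) (by norm_num)
          · rw [abs_sub_comm]; exact abs_truncInt_sub_le N _
          · rw [hβq, abs_mul, Nat.abs_cast]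
            exact mul_le_mul_of_nonneg_left (hβ j) (by positivity)
        _ = _ := by simp; ring
    refine (abs_add_le _ _).trans ?_
    have := abs_add_le ((Q : ℝ) * (Yi - 2 ^ N * observations X β W i)) (Q * 2 ^ N * W i)
    linarith
  have h2 : |(Timed.shiftedObs (fun i => Q * truncInt N (observations X β W i)) XE Z i : ℝ) -
      ((Q * Yi + ∑ j, XE i j * Z j : ℤ) : ℝ)| ≤ 5 := by
    have : |Timed.shiftedObs (fun i => Q * truncInt N (observations X β W i)) XE Z i -
        (Q * Yi + ∑ j, XE i j * Z j)| ≤ 5 := by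
      rw [Timed.shiftedObs]
      split_ifs with h
      · simp [hYi]
      · rw [not_le, abs_lt] at h
        rw [abs_le]; constructor <;> linarith [h.1, h.2]
    exact_mod_cast this
  have h3 : (Q : ℝ) ≤ Q * R * p := by
    calc (Q : ℝ) = Q * 1 * 1 := by ring
      _ ≤ Q * R * p := by gcongr
  have h4 : (1 : ℝ) ≤ Q * R * p := hQ1.trans h3
  have := abs_sub_le (Timed.shiftedObs (fun i => Q * truncInt N (observations X β W i)) XE Z i : ℝ)
    ((Q * Yi + ∑ j, XE i j * Z j : ℤ) : ℝ) (∑ j, (XE i j : ℝ) * b j)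
  linarith

theorem Timed.abs_le_two_pow_of_cast {x : ℤ} {s : ℕ} (h : |(x : ℝ)| ≤ 2 ^ s) : |x| ≤ 2 ^ s := by
  exact_mod_cast h

/-- The cost of the algorithm outside of the subroutine is small. -/
theorem LBR_cost_le {n p fuel B : ℕ} {Y : Fin n → ℝ} {X : Fin n → Fin p → ℝ} {N Q R : ℕ} {W : ℝ}
    {Z β : Fin p → ℤ} (hB : 4 ≤ B) (hn : n ≤ B) (hp : p ≤ B) (hN : N ≤ B)
    (hY : ∀ i, |truncInt N (Y i)| ≤ 2 ^ B) (hX : ∀ i j, |truncInt N (X i j)| ≤ 2 ^ B)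
    (hW : |⌈(2 : ℝ) ^ N * W⌉| ≤ 2 ^ B) (hQ : |(Q : ℤ)| ≤ 2 ^ B) (hR : |(R : ℤ)| ≤ 2 ^ B)
    (hp' : |(p : ℤ)| ≤ 2 ^ B)
    (hRp : |(R * p : ℤ)| ≤ 2 ^ B) (hS : |⌈(2 : ℝ) ^ N * W⌉ + R * p| ≤ 2 ^ B)
    (hQS : |Q * (⌈(2 : ℝ) ^ N * W⌉ + R * p)| ≤ 2 ^ B) (hβ : ∀ j, |β j| ≤ 2 ^ B)
    (h : (Timed.ELO fuel (fun i => Q * truncInt N (Y i)) (fun i j => truncInt N (X i j)) (Q * R)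
      (2 * (Q * (⌈(2 : ℝ) ^ N * W⌉ + R * p))) Z).val = some β)
    (hc : (Timed.ELO fuel (fun i => Q * truncInt N (Y i)) (fun i j => truncInt N (X i j)) (Q * R)
      (2 * (Q * (⌈(2 : ℝ) ^ N * W⌉ + R * p))) Z).cost ≤ B ^ 700) :
    (LBR fuel Y X N Q R W Z).cost ≤ B ^ 703 := by
  rw [(LBR_of_ELO h).2]
  have hB1 : B ≤ B ^ (0 + 1) := by rw [zero_add, pow_one]
  have hbits : ∀ {x y : ℤ}, |x| ≤ 2 ^ B → |y| ≤ 2 ^ B → Timed.bits x * Timed.bits y ≤ B ^ 4 :=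
    fun hx hy => Timed.bits_mul_bits_le_pow 0 hB hx hy hB1
  have hone : ∀ {x : ℤ}, |x| ≤ 2 ^ B → N + Timed.bits x ≤ B ^ 5 := fun hx =>
    Timed.add_le_pow_succ hB (hN.trans (Nat.le_self_pow (by norm_num) B))
      ((Nat.le_mul_of_pos_right _ (Timed.one_le_bits _)).trans (hbits hx hx))
  have two : |(2 : ℤ)| ≤ 2 ^ B := by
    rw [abs_two]; simpa using pow_le_pow_right₀ (a := (2 : ℤ)) (by norm_num) (by omega : 1 ≤ B)
  have c1 : (Timed.forEach fun i =>
      (⟨truncInt N (Y i), N + Timed.bits (truncInt N (Y i))⟩ : Timed ℤ)).cost ≤ B ^ 7 :=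
    Timed.cost_forEach_le_pow hB hn fun i => hone (hY i)
  have c2 : (Timed.forEach fun i => Timed.forEach fun j =>
      (⟨truncInt N (X i j), N + Timed.bits (truncInt N (X i j))⟩ : Timed ℤ)).cost ≤ B ^ 9 :=
    Timed.cost_forEach_le_pow hB hn fun i => Timed.cost_forEach_le_pow hB hp fun j => hone (hX i j)
  have c3 := hone hW
  have c4 : (Timed.forEach fun i => Timed.mul Q (truncInt N (Y i))).cost ≤ B ^ 6 :=
    Timed.cost_forEach_le_pow hB hn fun i => hbits hQ (hY i)
  have c11 : (Timed.forEach fun j =>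
      (⟨(β j : ℚ) / Q, Timed.bits (β j) * Timed.bits Q⟩ : Timed ℚ)).cost ≤ B ^ 6 :=
    Timed.cost_forEach_le_pow hB hp fun j => hbits (hβ j) hQ
  have L : ∀ {a e f : ℕ}, a ≤ B ^ e → e ≤ f → a ≤ B ^ f := fun h1 h2 =>
    Timed.pow_le_pow_of_le' hB h1 h2
  have k10 := Timed.add_le_pow_succ hB hc (L c11 (by norm_num))
  -- the nine cheap terms together are at most as large as a single power of the bound
  have k9 : ∀ a1 a2 a3 a4 a5 a6 a7 a8 a9 a10 C : ℕ, 9 ≤ C → a1 ≤ C → a2 ≤ C → a3 ≤ C →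
      a4 ≤ C → a5 ≤ C → a6 ≤ C → a7 ≤ C → a8 ≤ C → a9 ≤ C →
      a1 + (a2 + (a3 + (a4 + (a5 + (a6 + (a7 + (a8 + (a9 + a10)))))))) ≤ 9 * C + a10 := by
    intros; omega
  have h9 : 9 ≤ B ^ 9 := by
    calc 9 ≤ 4 ^ 9 := by norm_num
      _ ≤ B ^ 9 := Nat.pow_le_pow_left hB 9
  refine (k9 _ _ _ _ _ _ _ _ _ _ (B ^ 9) h9 (L c1 (by norm_num)) c2 (L c3 (by norm_num))
    (L c4 (by norm_num)) (L (hbits hQ hR) (by norm_num)) (L (hbits hR hp') (by norm_num))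
    (L (hbits hW hRp) (by norm_num)) (L (hbits hQ hS) (by norm_num))
    (L (hbits two hQS) (by norm_num))).trans ?_
  have h10 : 9 * B ^ 9 ≤ B ^ 11 := by
    calc 9 * B ^ 9 ≤ (B * B) * B ^ 9 := by gcongr; nlinarith
      _ = _ := by ring
  exact L (Timed.add_le_pow_succ hB (L h10 (by norm_num)) k10) (by norm_num)

set_option maxHeartbeats 2000000 in
/-- The algorithm succeeds on every typical sample.  Here `b = Q β + Z` is the planted vector, `A`
bounds the size of the noise in the integer system and that of `b` (up to the factors `P = n p` and
a constant), `H` bounds the approximation factor of the LLL algorithm, and `s` bounds the bit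
lengths of the parameters.  The last five hypotheses say that the sample is typical: the
entries of `b` are coprime, the noise and the matrix are not large, the measurements of `b` are not
small, and no pair `(x, y)` other than the multiples of `b` nearly solves the system. -/
theorem LBRRecovers_of_typical {n p N Q R s : ℕ} {σ What A P C H : ℝ} {β : Fin p → ℝ}
    {X : Fin n → Fin p → ℝ} {W : Fin n → ℝ} {Z βq : Fin p → ℤ} {b : Fin p → ℕ}
    (hn : 0 < n) (hp : 0 < p) (hQ : 0 < Q) (hR : 0 < R) (hσ : 0 ≤ σ) (hWhat : 0 < What)
    (hσW : √(n * p) * σ ≤ What)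
    (hβ : ∀ j, |β j| ≤ R) (hβq : ∀ j, (βq j : ℝ) = Q * β j)
    (hA : A = Q * (2 ^ N * √(n * p) * σ + R * p)) (hP : P = n * p) (hC : 1 ≤ C)
    (hH : H = √(2 ^ (p + n + n))) (hE : 40 * (H * C * P ^ 3 * A) ≤ 2 ^ N)
    (hs : 3 ≤ s) (hns : n ≤ s) (hps : p ≤ s) (hNs : N ≤ s) (hQs : Q ≤ 2 ^ s) (hRs : R ≤ 2 ^ s)
    (hWs : What ≤ 2 ^ s)
    (hb : ∀ j, (b j : ℤ) = βq j + Z j) (hZ1 : ∀ j, (Q * R : ℤ) + 1 ≤ Z j)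
    (hZ2 : ∀ j, Z j ≤ 2 * (Q * R : ℤ) + p) (hgcd : Finset.univ.gcd b = 1)
    (hWn : ∑ i, W i ^ 2 ≤ n * (√(n * p) * σ) ^ 2)
    (hX : ∑ i, ∑ j, |X i j| ≤ P ^ 3)
    (hlow : ∀ i, 1 / (C * P ^ 2) ≤ |∑ j, X i j * b j|)
    (hunion : ∀ (x : Fin p → ℤ) (y : Fin n → ℤ), (∀ j, |(x j : ℝ)| ≤ 8 * (H * P * A)) →
      (∀ i, |(y i : ℝ)| ≤ 32 * (H * C * P ^ 6 * A)) → (∀ i, ∃ j, x j ≠ y i * b j) →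
      ∃ i, 480 * (H * C * P ^ 7 * A ^ 2) / 2 ^ N < |∑ j, X i j * ((x j - y i * b j : ℤ) : ℝ)|) :
    LBRRecovers (observations X β W) X N Q R What Z β (((12 * s) ^ 703 : ℕ) : ℝ) := by
  have hQ1 : (1 : ℝ) ≤ Q := by exact_mod_cast hQ
  have hR1 : (1 : ℝ) ≤ R := by exact_mod_cast hR
  have hp1 : (1 : ℝ) ≤ p := by exact_mod_cast hp
  have hn1 : (1 : ℝ) ≤ n := by exact_mod_cast hn
  have hP1 : 1 ≤ P := by rw [hP]; exact one_le_mul_of_one_le_of_one_le hn1 hp1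
  have hpP : (p : ℝ) ≤ P := by rw [hP]; exact le_mul_of_one_le_left (by positivity) hn1
  have hnP : (n : ℝ) ≤ P := by rw [hP]; exact le_mul_of_one_le_right (by positivity) hp1
  have hH1 : 1 ≤ H := by
    rw [hH, Real.one_le_sqrt]; exact one_le_pow₀ (by norm_num)
  have hH2 : H ^ 2 = 2 ^ (p + n + n) := by rw [hH, Real.sq_sqrt (by positivity)]
  obtain ⟨a₁, ha₁⟩ : ∃ a₁ : ℝ, a₁ = Q * R * p := ⟨_, rfl⟩
  obtain ⟨a₂, ha₂⟩ : ∃ a₂ : ℝ, a₂ = Q * 2 ^ N * (√(n * p) * σ) := ⟨_, rfl⟩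
  have hAa : A = a₁ + a₂ := by rw [hA, ha₁, ha₂]; ring
  have ha₁1 : 1 ≤ a₁ := by
    rw [ha₁]
    exact one_le_mul_of_one_le_of_one_le (one_le_mul_of_one_le_of_one_le hQ1 hR1) hp1
  have ha₂0 : 0 ≤ a₂ := by rw [ha₂]; positivity
  have hA1 : 1 ≤ A := by linarith
  have ha₁A : a₁ ≤ A := by linarith
  obtain ⟨XE, hXE⟩ : ∃ XE : Fin n → Fin p → ℤ, XE = fun i j => truncInt N (X i j) := ⟨_, rfl⟩
  obtain ⟨YE, hYE⟩ : ∃ YE : Fin n → ℤ, YE = fun i => Q * truncInt N (observations X β W i) :=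
    ⟨_, rfl⟩
  -- the entries of the planted vector
  have hβqb : ∀ j, |βq j| ≤ Q * R := fun j => by
    have : |(βq j : ℝ)| ≤ Q * R := by
      rw [hβq, abs_mul, Nat.abs_cast]; exact mul_le_mul_of_nonneg_left (hβ j) (by positivity)
    exact_mod_cast this
  have hb0 : ∀ j, 0 < b j := fun j => by
    have h1 := hb j
    have h2 := (abs_le.1 (hβqb j)).1
    have h3 := hZ1 j
    have : (0 : ℤ) < b j := by linarith
    exact_mod_cast this
  have hQR1 : (1 : ℝ) ≤ Q * R := one_le_mul_of_one_le_of_one_le hQ1 hR1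
  have hb4 : ∀ j, (b j : ℝ) ≤ 4 * a₁ := fun j => by
    have h1 := hb j
    have h2 := (abs_le.1 (hβqb j)).2
    have h3 := hZ2 j
    have h4 : (b j : ℤ) ≤ 3 * (Q * R) + p := by linarith
    have h5 : (b j : ℝ) ≤ 3 * (Q * R) + p := by exact_mod_cast h4
    have h6 : (Q * R : ℝ) ≤ a₁ := by rw [ha₁]; exact le_mul_of_one_le_right (by positivity) hp1
    have h7 : (p : ℝ) ≤ a₁ := by rw [ha₁]; exact le_mul_of_one_le_left (by positivity) hQR1
    linarith
  have hbsum : ∑ j, (b j : ℝ) ≤ 4 * (P * A) := by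
    calc ∑ j, (b j : ℝ) ≤ ∑ _j : Fin p, 4 * a₁ := Finset.sum_le_sum fun j _ => hb4 j
      _ = p * (4 * a₁) := by simp
      _ ≤ P * (4 * A) := by gcongr
      _ = _ := by ring
  have hb2 : ∑ j, (b j : ℝ) ^ 2 ≤ p * (16 * a₁ ^ 2) := by
    calc ∑ j, (b j : ℝ) ^ 2 ≤ ∑ _j : Fin p, 16 * a₁ ^ 2 := Finset.sum_le_sum fun j _ => by
          have := pow_le_pow_left₀ (Nat.cast_nonneg _) (hb4 j) 2
          rw [mul_pow] at this; linarith
      _ = _ := by simp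
  obtain ⟨w, hw⟩ : ∃ w : Fin n → ℝ, w = fun i =>
      (Timed.shiftedObs YE XE Z i : ℝ) - ∑ j, (XE i j : ℝ) * b j := ⟨_, rfl⟩
  -- the remaining part of the planted vector; its length is governed by the true size of the noise,
  -- not by the upper bound `What`
  have hw2 : ∑ i, w i ^ 2 ≤ 98 * (n * A ^ 2) := by
    have h1 : ∀ i, w i ^ 2 ≤ 98 * a₁ ^ 2 + 2 * (Q * 2 ^ N) ^ 2 * W i ^ 2 := fun i => by
      have h2 := abs_shiftedObs_sub_le (N := N) (W := W) hQ hR hp hβ hβq hb (X := X) i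
      rw [← ha₁] at h2
      have h2' : |w i| ≤ 7 * a₁ + Q * 2 ^ N * |W i| := by
        rw [hw, hXE, hYE]; exact h2
      have h3 := pow_le_pow_left₀ (abs_nonneg _) h2' 2
      rw [sq_abs] at h3
      have h4 : (Q * 2 ^ N * |W i|) ^ 2 = (Q * 2 ^ N) ^ 2 * W i ^ 2 := by rw [mul_pow, sq_abs]
      nlinarith [sq_nonneg (7 * a₁ - Q * 2 ^ N * |W i|)]
    calc ∑ i, w i ^ 2 ≤ ∑ i, (98 * a₁ ^ 2 + 2 * (Q * 2 ^ N) ^ 2 * W i ^ 2) :=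
          Finset.sum_le_sum fun i _ => h1 i
      _ = n * (98 * a₁ ^ 2) + 2 * (Q * 2 ^ N) ^ 2 * ∑ i, W i ^ 2 := by
          rw [Finset.sum_add_distrib, Finset.mul_sum]; simp
      _ ≤ n * (98 * a₁ ^ 2) + 2 * (Q * 2 ^ N) ^ 2 * (n * (√(n * p) * σ) ^ 2) := by gcongr
      _ = n * (98 * a₁ ^ 2 + 2 * a₂ ^ 2) := by rw [ha₂]; ring
      _ ≤ n * (98 * A ^ 2) := by
          gcongr
          rw [hAa]
          have h1 : 0 ≤ a₁ * a₂ := mul_nonneg (by linarith) ha₂0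
          have h2 := sq_nonneg a₂
          linarith [show 98 * (a₁ + a₂) ^ 2 = 98 * a₁ ^ 2 + 196 * (a₁ * a₂) + 98 * a₂ ^ 2 by ring]
      _ = _ := by ring
  have hwi : ∀ i, |w i| ≤ 10 * (P * A) := fun i => by
    apply abs_le_of_sq_le_sq _ (by positivity)
    have h1 := Finset.single_le_sum (f := fun i => w i ^ 2) (fun _ _ => sq_nonneg _)
      (Finset.mem_univ i)
    have h2 : (n : ℝ) ≤ P ^ 2 := hnP.trans (le_self_pow₀ hP1 two_ne_zero)
    calc w i ^ 2 ≤ 98 * (n * A ^ 2) := h1.trans hw2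
      _ ≤ 98 * (P ^ 2 * A ^ 2) := by gcongr
      _ ≤ (10 * (P * A)) ^ 2 := by
        have : 0 ≤ P ^ 2 * A ^ 2 := by positivity
        linarith [show (10 * (P * A)) ^ 2 = 100 * (P ^ 2 * A ^ 2) by ring]
  obtain ⟨q₀, hq₀⟩ : ∃ q₀ : ℤ, q₀ = ∑ j, (b j : ℤ) ^ 2 +
      ∑ i, (Timed.shiftedObs YE XE Z i - ∑ j, XE i j * b j) ^ 2 := ⟨_, rfl⟩
  have hq₀r : (q₀ : ℝ) = ∑ j, (b j : ℝ) ^ 2 + ∑ i, w i ^ 2 := by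
    rw [hq₀, hw]; push_cast; rfl
  obtain ⟨WN, hWN⟩ : ∃ WN : ℤ, WN = ⌈(2 : ℝ) ^ N * What⌉ := ⟨_, rfl⟩
  have hWN1 : (2 : ℝ) ^ N * What ≤ WN := by rw [hWN]; exact Int.le_ceil _
  have hWN2 : (WN : ℝ) ≤ 2 ^ N * What + 1 := by rw [hWN]; exact (Int.ceil_lt_add_one _).le
  have hWN0 : 0 ≤ WN := by
    have : (0 : ℝ) ≤ WN := le_trans (by positivity) hWN1
    exact_mod_cast this
  obtain ⟨WE, hWE⟩ : ∃ WE : ℤ, WE = 2 * (Q * (WN + R * p)) := ⟨_, rfl⟩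
  have hWEA : 2 * A ≤ WE := by
    rw [hWE, hA]; push_cast
    have h1 : 2 ^ N * √(n * p) * σ ≤ 2 ^ N * What := by
      rw [mul_assoc]; exact mul_le_mul_of_nonneg_left hσW (by positivity)
    have h2 : 2 ^ N * √(n * p) * σ + R * p ≤ WN + R * p := by linarith
    gcongr
  have hq₀le : q₀ ≤ 64 * (p ^ 2 * ((Q * R : ℤ) ^ 2 * p + WE ^ 2 * n)) := by
    have h1 : (q₀ : ℝ) ≤ 64 * (p ^ 2 * (((Q : ℝ) * R) ^ 2 * p + (WE : ℝ) ^ 2 * n)) := by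
      rw [hq₀r]
      have h2 : 4 * A ^ 2 ≤ (WE : ℝ) ^ 2 := by
        have := pow_le_pow_left₀ (by positivity) hWEA 2
        rw [mul_pow] at this; linarith
      have h3 : (p : ℝ) * (16 * a₁ ^ 2) = 16 * (p ^ 2 * (((Q : ℝ) * R) ^ 2 * p)) := by
        rw [ha₁]; ring
      have h4 : (n : ℝ) * A ^ 2 ≤ p ^ 2 * ((WE : ℝ) ^ 2 * n) / 4 := by
        have h5 : (1 : ℝ) ≤ p ^ 2 := one_le_pow₀ hp1
        have h6 : (n : ℝ) * A ^ 2 ≤ (WE : ℝ) ^ 2 * n / 4 := by nlinarith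
        have h7 : 0 ≤ (WE : ℝ) ^ 2 * n := by positivity
        nlinarith
      have h5 : 0 ≤ (p : ℝ) ^ 2 * ((WE : ℝ) ^ 2 * n) := by positivity
      have h6 : 0 ≤ (p : ℝ) ^ 2 * (((Q : ℝ) * R) ^ 2 * p) := by positivity
      linarith
    exact_mod_cast h1
  have hm₀ : ((2 : ℝ) ^ (p + n + n - 1) * q₀) ≤ (8 * (H * P * A)) ^ 2 := by
    have h1 : (q₀ : ℝ) ≤ 114 * (P * A ^ 2) := by
      rw [hq₀r]
      have h2 : (p : ℝ) * (16 * a₁ ^ 2) ≤ P * (16 * A ^ 2) := by gcongr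
      have h3 : (n : ℝ) * A ^ 2 ≤ P * A ^ 2 := by gcongr
      linarith
    have h2 : (2 : ℝ) ^ (p + n + n - 1) * 2 = H ^ 2 := by
      rw [hH2, ← pow_succ]; congr 1; omega
    have h3 : P ≤ P ^ 2 := by nlinarith
    calc (2 : ℝ) ^ (p + n + n - 1) * q₀ ≤ 2 ^ (p + n + n - 1) * (114 * (P * A ^ 2)) := by gcongr
      _ = (2 ^ (p + n + n - 1) * 2) * (57 * (P * A ^ 2)) := by ring
      _ ≤ H ^ 2 * (64 * (P ^ 2 * A ^ 2)) := by
        rw [h2]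
        gcongr
        norm_num
      _ = _ := by ring
  have hXrow : ∀ i, ∑ j, |X i j| ≤ P ^ 3 := fun i =>
    (Finset.single_le_sum (f := fun i => ∑ j, |X i j|)
      (fun _ _ => Finset.sum_nonneg fun _ _ => abs_nonneg _) (Finset.mem_univ i)).trans hX
  have hXij : ∀ i j, |X i j| ≤ P ^ 3 := fun i j =>
    (Finset.single_le_sum (f := fun j => |X i j|) (fun _ _ => abs_nonneg _)
      (Finset.mem_univ j)).trans (hXrow i)
  have hkey : ∀ (x : Fin p → ℤ) (y v : Fin n → ℤ),
      ∑ j, x j ^ 2 + ∑ i, v i ^ 2 ≤ 2 ^ (p + n + n - 1) * q₀ →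
      (∀ i, ∑ j, XE i j * x j - Timed.shiftedObs YE XE Z i * y i + v i = 0) →
      (x ≠ 0 ∨ y ≠ 0 ∨ v ≠ 0) → ∃ q : ℤ, q ≠ 0 ∧ ∀ j, x j = q * b j := by
    intro x y v hxv heq hne
    have hxv' : ∑ j, (x j : ℝ) ^ 2 + ∑ i, (v i : ℝ) ^ 2 ≤ (8 * (H * P * A)) ^ 2 :=
      le_trans (by exact_mod_cast hxv) hm₀
    have hsx : 0 ≤ ∑ j, (x j : ℝ) ^ 2 := Finset.sum_nonneg fun _ _ => sq_nonneg _
    have hsv : 0 ≤ ∑ i, (v i : ℝ) ^ 2 := Finset.sum_nonneg fun _ _ => sq_nonneg _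
    refine exists_eq_mul_of_short (X := X) (XE := XE) (E := 2 ^ N) hpP hA1 hP1 hC hH1 hE
      (fun i j => by rw [hXE]; exact abs_truncInt_sub_le N _)
      (fun i j => by rw [hXE]; exact abs_truncInt_le N _) hbsum
      (fun i => by have := hwi i; rw [hw] at this; exact this) hXrow hlow hunion x y v
      (fun j => ?_) (fun i => ?_) heq hne
    · apply abs_le_of_sq_le_sq _ (by positivity)
      have := Finset.single_le_sum (f := fun j => (x j : ℝ) ^ 2) (fun _ _ => sq_nonneg _)
        (Finset.mem_univ j)
      linarith
    · apply abs_le_of_sq_le_sq _ (by positivity)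
      have := Finset.single_le_sum (f := fun i => (v i : ℝ) ^ 2) (fun _ _ => sq_nonneg _)
        (Finset.mem_univ i)
      linarith
  -- bit lengths
  have hmono : ∀ {a b : ℕ}, a ≤ b → (2 : ℝ) ^ a ≤ 2 ^ b := fun h =>
    pow_le_pow_right₀ (by norm_num) h
  have hnr : (n : ℝ) ≤ 2 ^ s := by
    exact_mod_cast hns.trans (Nat.lt_two_pow_self (n := s)).le
  have hpr : (p : ℝ) ≤ 2 ^ s := by
    exact_mod_cast hps.trans (Nat.lt_two_pow_self (n := s)).le
  have hQr : (Q : ℝ) ≤ 2 ^ s := by exact_mod_cast hQs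
  have hRr : (R : ℝ) ≤ 2 ^ s := by exact_mod_cast hRs
  have hNr : (2 : ℝ) ^ N ≤ 2 ^ s := hmono hNs
  have hPr : P ^ 3 ≤ 2 ^ (6 * s) := by
    rw [hP]
    calc ((n : ℝ) * p) ^ 3 ≤ (2 ^ s * 2 ^ s) ^ 3 := by gcongr
      _ = _ := by ring
  have htr : ∀ (x : ℝ) (e : ℕ), |x| ≤ 2 ^ (e * s) → |truncInt N x| ≤ 2 ^ ((e + 1) * s) := by
    intro x e hx
    apply Timed.abs_le_two_pow_of_cast
    calc |(truncInt N x : ℝ)| ≤ 2 ^ N * |x| := abs_truncInt_le N x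
      _ ≤ 2 ^ s * 2 ^ (e * s) := by gcongr
      _ = _ := by ring
  have hXb : ∀ i j, |truncInt N (X i j)| ≤ 2 ^ (7 * s) := fun i j =>
    htr _ 6 ((hXij i j).trans hPr)
  have hWi : ∀ i, |W i| ≤ 2 ^ (2 * s) := fun i => by
    have h1 := Finset.single_le_sum (f := fun i => W i ^ 2) (fun _ _ => sq_nonneg _)
      (Finset.mem_univ i)
    have h2 : |W i| ≤ n * What := by
      apply abs_le_of_sq_le_sq _ (by positivity)
      calc W i ^ 2 ≤ n * (√(n * p) * σ) ^ 2 := h1.trans hWn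
        _ ≤ n * What ^ 2 := by gcongr
        _ ≤ (n * n) * What ^ 2 := by gcongr; nlinarith
        _ = _ := by ring
    calc |W i| ≤ n * What := h2
      _ ≤ 2 ^ s * 2 ^ s := by gcongr
      _ = _ := by ring
  have hYb : ∀ i, |truncInt N (observations X β W i)| ≤ 2 ^ (9 * s) := fun i => by
    apply htr _ 8
    rw [observations]
    have h1 : |∑ j, X i j * β j| ≤ 2 ^ (7 * s) := by
      calc _ ≤ ∑ j, |X i j * β j| := Finset.abs_sum_le_sum_abs _ _
        _ ≤ ∑ j, |X i j| * R := Finset.sum_le_sum fun j _ => by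
          rw [abs_mul]; exact mul_le_mul_of_nonneg_left (hβ j) (abs_nonneg _)
        _ = (∑ j, |X i j|) * R := (Finset.sum_mul _ _ _).symm
        _ ≤ 2 ^ (6 * s) * 2 ^ s := by gcongr; exact (hXrow i).trans hPr
        _ = _ := by ring
    calc _ ≤ |∑ j, X i j * β j| + |W i| := abs_add_le _ _
      _ ≤ 2 ^ (7 * s) + 2 ^ (7 * s) :=
        add_le_add h1 ((hWi i).trans (hmono (by omega)))
      _ = 2 ^ (7 * s + 1) := by ring
      _ ≤ _ := hmono (by omega)
  have hQb : |(Q : ℤ)| ≤ 2 ^ s := Timed.abs_le_two_pow_of_cast (by simpa using hQr)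
  have hRb : |(R : ℤ)| ≤ 2 ^ s := Timed.abs_le_two_pow_of_cast (by simpa using hRr)
  have hpb : |(p : ℤ)| ≤ 2 ^ s := Timed.abs_le_two_pow_of_cast (by simpa using hpr)
  have hWNb : |WN| ≤ 2 ^ (3 * s) := by
    apply Timed.abs_le_two_pow_of_cast
    rw [abs_of_nonneg (by exact_mod_cast hWN0)]
    calc (WN : ℝ) ≤ 2 ^ N * What + 1 := hWN2
      _ ≤ 2 ^ s * 2 ^ s + 1 := by gcongr
      _ ≤ 2 ^ (2 * s) + 2 ^ (2 * s) := by
        have : (1 : ℝ) ≤ 2 ^ (2 * s) := one_le_pow₀ (by norm_num)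
        rw [← pow_add, ← two_mul]; linarith
      _ = 2 ^ (2 * s + 1) := by ring
      _ ≤ _ := hmono (by omega)
  have hRpb : |(R * p : ℤ)| ≤ 2 ^ (3 * s) := Timed.abs_mul_le_pow hRb hpb (by omega)
  have hSb : |WN + R * p| ≤ 2 ^ (4 * s) := Timed.abs_add_le_pow hWNb hRpb (by omega)
  have hQSb : |Q * (WN + R * p)| ≤ 2 ^ (5 * s) := Timed.abs_mul_le_pow hQb hSb (by omega)
  have hWEb : |WE| ≤ 2 ^ (6 * s) := by
    rw [hWE]
    exact Timed.abs_mul_le_pow (s := 1) (by norm_num) hQSb (by omega)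
  have hQRb : |(Q * R : ℤ)| ≤ 2 ^ (2 * s) := Timed.abs_mul_le_pow hQb hRb (by omega)
  have hZb : ∀ j, |Z j| ≤ 2 ^ (4 * s) := fun j => by
    have h0 : (0 : ℤ) ≤ Q * R := by positivity
    have h1 : |2 * (Q * R : ℤ)| ≤ 2 ^ (3 * s) :=
      Timed.abs_mul_le_pow (s := 1) (by norm_num) hQRb (by omega)
    have h2 : |2 * (Q * R : ℤ) + p| ≤ 2 ^ (4 * s) :=
      Timed.abs_add_le_pow h1 (Timed.abs_le_pow_mono hpb (by omega)) (by omega)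
    rw [abs_of_nonneg (by linarith [hZ1 j])]
    exact (hZ2 j).trans ((le_abs_self _).trans h2)
  have hup : ∀ {x : ℤ} {e : ℕ}, |x| ≤ 2 ^ (e * s) → e ≤ 12 → |x| ≤ 2 ^ (12 * s) := fun h he =>
    Timed.abs_le_pow_mono h (Nat.mul_le_mul_right _ he)
  have hup1 : ∀ {x : ℤ}, |x| ≤ 2 ^ s → |x| ≤ 2 ^ (12 * s) := fun h =>
    Timed.abs_le_pow_mono h (by omega)
  obtain ⟨fuel, hf1, hf2⟩ := Timed.ELO_spec (B := 12 * s) hp (Y := YE) (X := XE)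
    (R := (Q * R : ℤ)) (W := WE) (Z := Z) (β := βq) b hb hb0 hgcd
    (by exact_mod_cast hQR1)
    (by
      have : (1 : ℝ) ≤ WE := by linarith
      exact_mod_cast this)
    (by omega) (by omega) (by omega)
    (fun i => by
      rw [hYE]
      exact Timed.abs_mul_le_pow hQb (hYb i) (by omega))
    (fun i j => by rw [hXE]; exact hup (hXb i j) (by norm_num))
    (fun j => hup (hZb j) (by norm_num)) (hup hQRb (by norm_num)) (hup hWEb (by norm_num))
    hq₀ hq₀le hkey
  rw [hYE, hXE, hWE, hWN] at hf1 hf2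
  refine ⟨fuel, fun j => (βq j : ℚ) / Q, (LBR_of_ELO hf1).1, fun j => ?_, ?_⟩
  · push_cast
    rw [hβq]
    field_simp
  · rw [hWN] at *
    exact_mod_cast LBR_cost_le (by omega) (by omega) (by omega) (by omega)
      (fun i => hup (hYb i) (by norm_num)) (fun i j => hup (hXb i j) (by norm_num))
      (hup hWNb (by norm_num)) (hup1 hQb) (hup1 hRb) (hup1 hpb) (hup hRpb (by norm_num))
      (hup hSb (by norm_num)) (hup hQSb (by norm_num))
      (fun j => Timed.abs_le_pow_mono ((hβqb j).trans ((le_abs_self _).trans hQRb)) (by omega))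
      hf1 hf2

/-! ### The precision and the number of candidates -/

/-- The lower bound on the precision, in multiplicative form. -/
theorem pow_le_four_pow_of_lt {n p N : ℕ} {Q S T : ℝ} (hQ : 0 < Q) (hS : 0 < S) (hT : 0 < T)
    (h : (N : ℝ) > 1 / 2 * (2 * n + p) *
      (2 * n + p + 10 * Real.logb 2 Q + 10 * Real.logb 2 S + 20 * Real.logb 2 T)) :
    (2 ^ (p + n + n) * (Q * S) ^ 10 * T ^ 20) ^ (p + n + n) ≤ (4 : ℝ) ^ N := by
  have h2 : (1 : ℝ) < 2 := by norm_num
  have e2 : Real.logb 2 2 = 1 := Real.logb_self_eq_one h2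
  have e4 : Real.logb 2 4 = 2 := by
    rw [show (4 : ℝ) = 2 ^ 2 by norm_num, Real.logb_pow, e2]; norm_num
  rw [← Real.logb_le_logb h2 (by positivity) (by positivity)]
  rw [Real.logb_pow, Real.logb_pow, Real.logb_mul (by positivity) (by positivity),
    Real.logb_mul (by positivity) (by positivity), Real.logb_pow, Real.logb_pow, Real.logb_pow,
    Real.logb_mul hQ.ne' hS.ne', e2, e4]
  push_cast
  linarith

section

variable {n p N : ℕ} {A P C H T : ℝ}

theorem le_two_pow_of_pow_le (hp : 0 < p) (hA : 1 ≤ A) (hP : 1 ≤ P) (hC : 1 ≤ C)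
    (hH : H = √(2 ^ (p + n + n))) (hT : T = 3 * (C * P))
    (hN : (2 ^ (p + n + n) * A ^ 10 * T ^ 20) ^ (p + n + n) ≤ (4 : ℝ) ^ N) :
    40 * (H * C * P ^ 3 * A) ≤ 2 ^ N := by
  have hH2 : H ^ 2 = 2 ^ (p + n + n) := by rw [hH, Real.sq_sqrt (by positivity)]
  have hT1 : 1 ≤ T := by
    rw [hT]; linarith [one_le_mul_of_one_le_of_one_le hC hP]
  refine le_of_sq_le_sq ?_ (by positivity)
  have h1 : 1 ≤ (2 : ℝ) ^ (p + n + n) * A ^ 10 * T ^ 20 :=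
    one_le_mul_of_one_le_of_one_le (one_le_mul_of_one_le_of_one_le
      (one_le_pow₀ (by norm_num)) (one_le_pow₀ hA)) (one_le_pow₀ hT1)
  calc (40 * (H * C * P ^ 3 * A)) ^ 2 = 1600 * (H ^ 2 * A ^ 2 * (C ^ 2 * P ^ 6)) := by ring
    _ ≤ 3 ^ 20 * (2 ^ (p + n + n) * A ^ 10 * (C ^ 20 * P ^ 20)) := by
      rw [hH2]; gcongr <;> first | assumption | norm_num
    _ = 2 ^ (p + n + n) * A ^ 10 * T ^ 20 := by rw [hT]; ring
    _ ≤ (2 ^ (p + n + n) * A ^ 10 * T ^ 20) ^ (p + n + n) :=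
      le_self_pow₀ h1 (by omega)
    _ ≤ 4 ^ N := hN
    _ = (2 ^ N) ^ 2 := by rw [← pow_mul, mul_comm, pow_mul]; norm_num

/-- The number of candidates times the probability that a given candidate is bad. -/
theorem card_mul_prob_le (hn : 0 < n) (hA : 1 ≤ A) (hP : 1 ≤ P) (hC : 1 ≤ C)
    (hH : H = √(2 ^ (p + n + n))) (hT : T = 3 * (C * P))
    (hN : (2 ^ (p + n + n) * A ^ 10 * T ^ 20) ^ (p + n + n) ≤ (4 : ℝ) ^ N) :
    (24 * (H * P * A)) ^ p * (96 * (H * C * P ^ 6 * A)) ^ n *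
      (960 * (H * C ^ 2 * P ^ 7 * A ^ 2) / 2 ^ N) ^ n ≤ 1 / P := by
  have hH0 : 0 ≤ H := by rw [hH]; positivity
  have hH2 : H ^ 2 = 2 ^ (p + n + n) := by rw [hH, Real.sq_sqrt (by positivity)]
  have hCP : 1 ≤ C * P := one_le_mul_of_one_le_of_one_le hC hP
  have hT1 : 1 ≤ T := by rw [hT]; linarith
  have hPT : P ≤ T := by
    rw [hT]
    linarith [le_mul_of_one_le_left (by positivity : 0 ≤ P) hC]
  obtain ⟨k, hk⟩ : ∃ k, k = p + n + n := ⟨_, rfl⟩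
  rw [← hk] at hH2 hN
  have h1 : (24 * (H * P * A)) ^ 2 ≤ 2 ^ k * A ^ 2 * T ^ 6 := by
    calc (24 * (H * P * A)) ^ 2 = 576 * (2 ^ k * A ^ 2 * (1 * P ^ 2)) := by rw [← hH2]; ring
      _ ≤ 3 ^ 6 * (2 ^ k * A ^ 2 * (C ^ 6 * P ^ 6)) := by
        gcongr <;> first | assumption | exact one_le_pow₀ hC | norm_num
      _ = _ := by rw [hT]; ring
  have h2 : (92160 * (H ^ 2 * C ^ 3 * P ^ 13 * A ^ 3)) ^ 2 ≤ 2 ^ (2 * k) * A ^ 6 * T ^ 26 := by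
    calc (92160 * (H ^ 2 * C ^ 3 * P ^ 13 * A ^ 3)) ^ 2 =
          92160 ^ 2 * (2 ^ (2 * k) * A ^ 6 * (C ^ 6 * P ^ 26)) := by rw [hH2]; ring
      _ ≤ 3 ^ 26 * (2 ^ (2 * k) * A ^ 6 * (C ^ 26 * P ^ 26)) := by
        gcongr <;> first | assumption | norm_num
      _ = _ := by rw [hT]; ring
  have h3 : (24 * (H * P * A)) ^ p * (92160 * (H ^ 2 * C ^ 3 * P ^ 13 * A ^ 3)) ^ n * P ≤
      (2 ^ N) ^ n := by
    have hsq : ∀ a b c : ℝ, (a ^ p * b ^ n * c) ^ 2 = (a ^ 2) ^ p * (b ^ 2) ^ n * c ^ 2 := by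
      intro a b c; ring
    refine le_of_sq_le_sq ?_ (by positivity)
    calc _ = ((24 * (H * P * A)) ^ 2) ^ p *
          ((92160 * (H ^ 2 * C ^ 3 * P ^ 13 * A ^ 3)) ^ 2) ^ n * P ^ 2 := by
          rw [hsq]
      _ ≤ (2 ^ k * A ^ 2 * T ^ 6) ^ p * (2 ^ (2 * k) * A ^ 6 * T ^ 26) ^ n * T ^ 2 := by gcongr
      _ = 2 ^ (k * (p + n + n)) * A ^ (2 * p + 6 * n) * T ^ (2 + 6 * p + 26 * n) := by ring
      _ ≤ 2 ^ (k * k * n) * A ^ (10 * k * n) * T ^ (20 * k * n) := by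
        have hkn : k ≤ k * n := Nat.le_mul_of_pos_right _ hn
        have e1 : k * (p + n + n) ≤ k * k * n := by
          rw [← hk]; exact Nat.le_mul_of_pos_right _ hn
        have e2 : 2 * p + 6 * n ≤ 10 * k * n := by rw [mul_assoc]; omega
        have e3 : 2 + 6 * p + 26 * n ≤ 20 * k * n := by rw [mul_assoc]; omega
        have two : (1 : ℝ) ≤ 2 := by norm_num
        exact mul_le_mul (mul_le_mul (pow_le_pow_right₀ two e1) (pow_le_pow_right₀ hA e2)
          (by positivity) (by positivity)) (pow_le_pow_right₀ hT1 e3) (by positivity)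
          (by positivity)
      _ = ((2 ^ k * A ^ 10 * T ^ 20) ^ k) ^ n := by ring
      _ ≤ (4 ^ N) ^ n := by gcongr
      _ = _ := by
        rw [show (4 : ℝ) = 2 ^ 2 by norm_num, ← pow_mul, ← pow_mul, ← pow_mul, ← pow_mul]
        congr 1; ring
  rw [le_div_iff₀ (by positivity), mul_assoc ((24 * (H * P * A)) ^ p), ← mul_pow, mul_div_assoc',
    div_pow, mul_div_assoc', div_mul_eq_mul_div, div_le_one (by positivity)]
  calc _ = (24 * (H * P * A)) ^ p * (92160 * (H ^ 2 * C ^ 3 * P ^ 13 * A ^ 3)) ^ n * P := by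
        congr 3; ring
    _ ≤ _ := h3

end

/-! ### Probability estimates for the measurement matrix and the noise -/

/-- Union bound on a product space whose last factor is countable: conditionally on the last
coordinate, the first one is in an event of small probability. -/
theorem prod_prod_apply_le {α β γ : Type*} [MeasurableSpace α] [MeasurableSpace β]
    [MeasurableSpace γ] [Countable γ] [MeasurableSingletonClass γ] {μ : Measure α} {ν : Measure β}
    {ρ : Measure γ} [IsProbabilityMeasure μ] [IsProbabilityMeasure ν] [IsProbabilityMeasure ρ]
    {F : Set (α × β × γ)} {SX : Set α} {SW : Set β} {SZ : Set γ} {B : γ → Set α} {ε : ENNReal}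
    (hB : ∀ z, ρ {z} ≠ 0 → μ (B z) ≤ ε)
    (hF : ∀ x w z, ρ {z} ≠ 0 → (x, w, z) ∈ F → x ∈ SX ∨ w ∈ SW ∨ z ∈ SZ ∨ x ∈ B z) :
    μ.prod (ν.prod ρ) F ≤ μ SX + ν SW + ρ SZ + ε := by
  classical
  set B' : γ → Set α := fun z => if ρ {z} = 0 then Set.univ else B z with hB'
  have hsub : F ⊆ SX ×ˢ Set.univ ∪ Set.univ ×ˢ (SW ×ˢ Set.univ) ∪
      Set.univ ×ˢ (Set.univ ×ˢ SZ) ∪ ⋃ z, B' z ×ˢ (Set.univ ×ˢ {z}) := by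
    rintro ⟨x, w, z⟩ h
    by_cases hz : ρ {z} = 0
    · exact Or.inr (Set.mem_iUnion.2 ⟨z, by simp [hB', hz]⟩)
    · rcases hF x w z hz h with h | h | h | h
      · exact Or.inl (Or.inl (Or.inl ⟨h, trivial⟩))
      · exact Or.inl (Or.inl (Or.inr ⟨trivial, h, trivial⟩))
      · exact Or.inl (Or.inr ⟨trivial, trivial, h⟩)
      · exact Or.inr (Set.mem_iUnion.2 ⟨z, by simpa [hB', hz] using h⟩)
  have hU : μ.prod (ν.prod ρ) (⋃ z, B' z ×ˢ (Set.univ ×ˢ {z})) ≤ ε := by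
    calc _ ≤ ∑' z, μ.prod (ν.prod ρ) (B' z ×ˢ (Set.univ ×ˢ {z})) := measure_iUnion_le _
      _ ≤ ∑' z, ε * ρ {z} := by
        refine ENNReal.tsum_le_tsum fun z => ?_
        rw [Measure.prod_prod, Measure.prod_prod, measure_univ, one_mul]
        by_cases hz : ρ {z} = 0
        · simp [hz]
        · simp only [hB', hz, if_false]
          gcongr
          exact hB z hz
      _ = ∫⁻ _, ε ∂ρ := (lintegral_countable' _).symm
      _ = ε := by simp
  refine (measure_mono hsub).trans ((measure_union_le _ _).trans (add_le_add ?_ hU))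
  refine (measure_union_le _ _).trans (add_le_add ((measure_union_le _ _).trans ?_) ?_)
  · simp [Measure.prod_prod]
  · simp [Measure.prod_prod]

section

variable {n p : ℕ} {μX : Measure ℝ} [IsProbabilityMeasure μX] {c : ℝ}

/-- A linear form with a coefficient of modulus at least one in independent variables with density
at most `c` again has, conditionally on the other variables, density at most `c`. -/
theorem pi_abs_sum_mul_le (hμ : ∀ s, μX s ≤ ENNReal.ofReal c * volume s) (hc : 0 ≤ c)
    {v : Fin p → ℤ} (hv : v ≠ 0) (t : ℝ) :
    Measure.pi (fun _ : Fin p => μX) {x | |∑ j, x j * (v j : ℝ)| ≤ t} ≤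
      ENNReal.ofReal (2 * c * t) := by
  obtain ⟨i, hi⟩ := Function.ne_iff.1 hv
  obtain ⟨q, rfl⟩ : ∃ q, p = q + 1 := ⟨p - 1, by have := i.pos; omega⟩
  have hvi : (1 : ℝ) ≤ |(v i : ℝ)| := by exact_mod_cast Int.one_le_abs hi
  have hvi0 : (v i : ℝ) ≠ 0 := by exact_mod_cast hi
  set S : Set (ℝ × (Fin q → ℝ)) :=
    {z | |z.1 * v i + ∑ j, z.2 j * (v (i.succAbove j) : ℝ)| ≤ t} with hS
  have hSm : MeasurableSet S := by
    apply measurableSet_le _ measurable_const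
    fun_prop
  have hpre : {x : Fin (q + 1) → ℝ | |∑ j, x j * (v j : ℝ)| ≤ t} =
      MeasurableEquiv.piFinSuccAbove (fun _ => ℝ) i ⁻¹' S := by
    ext x
    simp only [Set.mem_ofPred_eq, Set.mem_preimage, hS]
    rw [Fin.sum_univ_succAbove _ i]
    rfl
  rw [hpre, (measurePreserving_piFinSuccAbove (fun _ => μX) i).measure_preimage
    hSm.nullMeasurableSet, Measure.prod_apply_symm hSm]
  calc _ ≤ ∫⁻ _, ENNReal.ofReal (2 * c * t) ∂(Measure.pi fun _ : Fin q => μX) := by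
        refine lintegral_mono fun y => ?_
        set s := ∑ j, y j * (v (i.succAbove j) : ℝ) with hs
        have hsub : (fun x => (x, y)) ⁻¹' S ⊆ Set.Icc (-s / v i - t) (-s / v i + t) := by
          intro a ha
          have h1 : |a * v i + s| ≤ t := ha
          have h2 : |a - -s / v i| ≤ t := by
            refine le_trans ?_ h1
            have e : a * v i + s = (a - -s / v i) * v i := by field_simp; ring
            rw [e, abs_mul]
            exact le_mul_of_one_le_right (abs_nonneg _) hvi
          rw [abs_le] at h2
          constructor <;> linarith
        calc _ ≤ μX (Set.Icc (-s / v i - t) (-s / v i + t)) := measure_mono hsub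
          _ ≤ _ := hμ _
          _ = ENNReal.ofReal (2 * c * t) := by
            rw [Real.volume_Icc, ← ENNReal.ofReal_mul hc]; congr 1; ring
    _ = _ := by simp

theorem pi_exists_abs_sum_mul_le (hμ : ∀ s, μX s ≤ ENNReal.ofReal c * volume s) (hc : 0 ≤ c)
    {v : Fin p → ℤ} (hv : v ≠ 0) {t : ℝ} :
    Measure.pi (fun _ : Fin n => Measure.pi fun _ : Fin p => μX)
      {X | ∃ i, |∑ j, X i j * (v j : ℝ)| ≤ t} ≤ ENNReal.ofReal (n * (2 * c * t)) := by
  have hm : MeasurableSet {x : Fin p → ℝ | |∑ j, x j * (v j : ℝ)| ≤ t} := by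
    apply measurableSet_le _ measurable_const
    fun_prop
  have e : {X : Fin n → Fin p → ℝ | ∃ i, |∑ j, X i j * (v j : ℝ)| ≤ t} =
      ⋃ i, Function.eval i ⁻¹' {x : Fin p → ℝ | |∑ j, x j * (v j : ℝ)| ≤ t} := by
    ext X; simp
  rw [e]
  refine (measure_iUnion_fintype_le _ _).trans ?_
  calc _ ≤ ∑ _i : Fin n, ENNReal.ofReal (2 * c * t) := by
        refine Finset.sum_le_sum fun i _ => ?_
        rw [(measurePreserving_eval (fun _ : Fin n => Measure.pi fun _ : Fin p => μX)
          i).measure_preimage hm.nullMeasurableSet]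
        exact pi_abs_sum_mul_le hμ hc hv t
    _ = _ := by
      rw [ENNReal.ofReal_mul (Nat.cast_nonneg n)]; simp

theorem pi_forall_abs_sum_mul_le (hμ : ∀ s, μX s ≤ ENNReal.ofReal c * volume s) (hc : 0 ≤ c)
    {v : Fin n → Fin p → ℤ} (hv : ∀ i, v i ≠ 0) {t : ℝ} (ht : 0 ≤ t) :
    Measure.pi (fun _ : Fin n => Measure.pi fun _ : Fin p => μX)
      {X | ∀ i, |∑ j, X i j * (v i j : ℝ)| ≤ t} ≤ ENNReal.ofReal ((2 * c * t) ^ n) := by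
  have e : {X : Fin n → Fin p → ℝ | ∀ i, |∑ j, X i j * (v i j : ℝ)| ≤ t} =
      Set.univ.pi fun i => {x : Fin p → ℝ | |∑ j, x j * (v i j : ℝ)| ≤ t} := by
    ext X; simp
  rw [e, Measure.pi_pi, ENNReal.ofReal_pow (by positivity)]
  calc _ ≤ ∏ _i : Fin n, ENNReal.ofReal (2 * c * t) :=
        Finset.prod_le_prod' fun i _ => pi_abs_sum_mul_le hμ hc (hv i) t
    _ = _ := by simp

theorem card_piFinset_Icc_le (k : ℕ) {m : ℝ} (hm : 1 ≤ m) :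
    ((Fintype.piFinset fun _ : Fin k => Finset.Icc (-⌊m⌋) ⌊m⌋).card : ℝ) ≤ (3 * m) ^ k := by
  rw [Fintype.card_piFinset_const, Int.card_Icc]
  push_cast
  refine pow_le_pow_left₀ (Nat.cast_nonneg _) ?_ k
  have h0 : 0 ≤ ⌊m⌋ := Int.floor_nonneg.2 (by linarith)
  have h1 : (((⌊m⌋ + 1 - -⌊m⌋).toNat : ℤ) : ℝ) = ⌊m⌋ + 1 + ⌊m⌋ := by
    rw [Int.toNat_of_nonneg (by linarith)]; push_cast; ring
  rw [Int.cast_natCast] at h1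
  rw [h1]
  linarith [Int.floor_le m]

theorem mem_piFinset_Icc {k : ℕ} {m : ℝ} {x : Fin k → ℤ} (hx : ∀ j, |(x j : ℝ)| ≤ m) :
    x ∈ Fintype.piFinset fun _ : Fin k => Finset.Icc (-⌊m⌋) ⌊m⌋ := by
  rw [Fintype.mem_piFinset]
  intro j
  rw [Finset.mem_Icc, ← abs_le]
  exact Int.le_floor.2 (by exact_mod_cast hx j)

/-- Union bound over all integer vectors `x` and `y` in a box. -/
theorem pi_exists_candidate_le (hμ : ∀ s, μX s ≤ ENNReal.ofReal c * volume s) (hc : 0 ≤ c)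
    {b : Fin p → ℤ} {m L t : ℝ} (hm : 1 ≤ m) (hL : 1 ≤ L) (ht : 0 ≤ t) :
    Measure.pi (fun _ : Fin n => Measure.pi fun _ : Fin p => μX)
      {X | ∃ (x : Fin p → ℤ) (y : Fin n → ℤ), (∀ j, |(x j : ℝ)| ≤ m) ∧ (∀ i, |(y i : ℝ)| ≤ L) ∧
        (∀ i, ∃ j, x j ≠ y i * b j) ∧ ∀ i, |∑ j, X i j * ((x j - y i * b j : ℤ) : ℝ)| ≤ t} ≤
      ENNReal.ofReal ((3 * m) ^ p * (3 * L) ^ n * (2 * c * t) ^ n) := by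
  set I := (Fintype.piFinset fun _ : Fin p => Finset.Icc (-⌊m⌋) ⌊m⌋) ×ˢ
    (Fintype.piFinset fun _ : Fin n => Finset.Icc (-⌊L⌋) ⌊L⌋) with hI
  set S : (Fin p → ℤ) × (Fin n → ℤ) → Set (Fin n → Fin p → ℝ) := fun z =>
    {X | (∀ i, ∃ j, z.1 j ≠ z.2 i * b j) ∧
      ∀ i, |∑ j, X i j * ((z.1 j - z.2 i * b j : ℤ) : ℝ)| ≤ t} with hS
  have hsub : {X : Fin n → Fin p → ℝ | ∃ (x : Fin p → ℤ) (y : Fin n → ℤ),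
      (∀ j, |(x j : ℝ)| ≤ m) ∧ (∀ i, |(y i : ℝ)| ≤ L) ∧ (∀ i, ∃ j, x j ≠ y i * b j) ∧
        ∀ i, |∑ j, X i j * ((x j - y i * b j : ℤ) : ℝ)| ≤ t} ⊆ ⋃ z ∈ I, S z := by
    rintro X ⟨x, y, hx, hy, h⟩
    refine Set.mem_biUnion (x := (x, y)) ?_ h
    exact Finset.mem_product.2 ⟨mem_piFinset_Icc hx, mem_piFinset_Icc hy⟩
  refine (measure_mono hsub).trans ((measure_biUnion_finset_le _ _).trans ?_)
  calc _ ≤ ∑ _z ∈ I, ENNReal.ofReal ((2 * c * t) ^ n) := by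
        refine Finset.sum_le_sum fun z _ => ?_
        by_cases h : ∀ i, ∃ j, z.1 j ≠ z.2 i * b j
        · refine (measure_mono fun X hX => ?_).trans (pi_forall_abs_sum_mul_le hμ hc
            (v := fun i j => z.1 j - z.2 i * b j) (fun i h0 => ?_) ht)
          · exact hX.2
          · obtain ⟨j, hj⟩ := h i
            exact hj (sub_eq_zero.1 (congrFun h0 j))
        · have : S z = ∅ := by
            ext X; simp only [hS, Set.mem_ofPred_eq, h, false_and, Set.mem_empty_iff_false]
          rw [this, measure_empty]
          exact zero_le
    _ = ENNReal.ofReal (I.card * (2 * c * t) ^ n) := by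
      rw [ENNReal.ofReal_mul (Nat.cast_nonneg _)]; simp
    _ ≤ _ := by
      refine ENNReal.ofReal_le_ofReal (mul_le_mul_of_nonneg_right ?_ (by positivity))
      rw [hI, Finset.card_product]
      push_cast
      exact mul_le_mul (card_piFinset_Icc_le p hm) (card_piFinset_Icc_le n hL)
        (Nat.cast_nonneg _) (by positivity)

/-- Markov's inequality for the sum of the moduli of all entries. -/
theorem pi_lt_sum_abs_le {M a : ℝ} (ha : 0 < a) (hint : Integrable (fun x => x) μX)
    (hM : ∫ x, |x| ∂μX ≤ M) :
    Measure.pi (fun _ : Fin n => Measure.pi fun _ : Fin p => μX) {X | a < ∑ i, ∑ j, |X i j|} ≤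
      ENNReal.ofReal (n * p * M / a) := by
  have h1 : ∫⁻ x, ENNReal.ofReal |x| ∂μX ≤ ENNReal.ofReal M := by
    rw [← ofReal_integral_eq_lintegral_ofReal hint.abs (ae_of_all _ fun _ => abs_nonneg _)]
    exact ENNReal.ofReal_le_ofReal hM
  have h2 : ∫⁻ X, ∑ i, ∑ j, ENNReal.ofReal |X i j|
      ∂(Measure.pi fun _ : Fin n => Measure.pi fun _ : Fin p => μX) ≤
      ENNReal.ofReal (n * p * M) := by
    rw [lintegral_finsetSum _ fun i _ => by fun_prop]
    have h3 : ∀ i : Fin n, ∫⁻ X, ∑ j, ENNReal.ofReal |X i j|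
        ∂(Measure.pi fun _ : Fin n => Measure.pi fun _ : Fin p => μX) ≤ p * ENNReal.ofReal M := by
      intro i
      rw [(measurePreserving_eval (fun _ : Fin n => Measure.pi fun _ : Fin p => μX)
        i).lintegral_comp (f := fun x : Fin p → ℝ => ∑ j, ENNReal.ofReal |x j|) (by fun_prop),
        lintegral_finsetSum _ fun j _ => by fun_prop]
      calc _ ≤ ∑ _j : Fin p, ENNReal.ofReal M := Finset.sum_le_sum fun j _ => by
            rw [(measurePreserving_eval (fun _ : Fin p => μX) j).lintegral_comp
              (f := fun x : ℝ => ENNReal.ofReal |x|) (by fun_prop)]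
            exact h1
        _ = _ := by simp
    calc _ ≤ ∑ _i : Fin n, (p * ENNReal.ofReal M) := Finset.sum_le_sum fun i _ => h3 i
      _ = _ := by
        rw [mul_assoc, ENNReal.ofReal_mul (Nat.cast_nonneg _),
          ENNReal.ofReal_mul (Nat.cast_nonneg _)]
        simp
  rw [ENNReal.ofReal_div_of_pos ha, ENNReal.le_div_iff_mul_le (Or.inl (ENNReal.ofReal_pos.2 ha).ne')
    (Or.inl ENNReal.ofReal_ne_top), mul_comm]
  refine le_trans ?_ ((mul_meas_ge_le_lintegral (by fun_prop) (ENNReal.ofReal a)).trans h2)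
  gcongr with X
  intro hX
  calc ENNReal.ofReal a ≤ ENNReal.ofReal (∑ i, ∑ j, |X i j|) := ENNReal.ofReal_le_ofReal hX.le
    _ = _ := by
      rw [ENNReal.ofReal_sum_of_nonneg fun i _ => Finset.sum_nonneg fun _ _ => abs_nonneg _]
      refine Finset.sum_congr rfl fun i _ => ?_
      rw [ENNReal.ofReal_sum_of_nonneg fun _ _ => abs_nonneg _]

/-- Chebyshev's inequality for the noise vector; for `σ = 0` the noise vanishes almost surely. -/
theorem pi_lt_sum_sq_le {μW : Measure ℝ} [IsProbabilityMeasure μW] {σ a : ℝ} (ha : 0 < a)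
    (hL2 : MemLp (fun x => x) 2 μW) (h0 : ∫ x, x ∂μW = 0)
    (hvar : ProbabilityTheory.variance (fun x => x) μW ≤ σ ^ 2) :
    Measure.pi (fun _ : Fin n => μW) {W | n * (a * σ ^ 2) < ∑ i, W i ^ 2} ≤
      ENNReal.ofReal (1 / a) := by
  have h1 : ∫⁻ x, ENNReal.ofReal (x ^ 2) ∂μW ≤ ENNReal.ofReal (σ ^ 2) := by
    rw [← ofReal_integral_eq_lintegral_ofReal hL2.integrable_sq (ae_of_all _ fun _ => sq_nonneg _)]
    rw [ProbabilityTheory.variance_of_integral_eq_zero hL2.aemeasurable h0] at hvar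
    exact ENNReal.ofReal_le_ofReal hvar
  have h2 : ∫⁻ W, ∑ i, ENNReal.ofReal (W i ^ 2) ∂(Measure.pi fun _ : Fin n => μW) ≤
      ENNReal.ofReal (n * σ ^ 2) := by
    rw [lintegral_finsetSum _ fun i _ => by fun_prop]
    calc _ ≤ ∑ _i : Fin n, ENNReal.ofReal (σ ^ 2) := Finset.sum_le_sum fun i _ => by
          rw [(measurePreserving_eval (fun _ : Fin n => μW) i).lintegral_comp
            (f := fun x : ℝ => ENNReal.ofReal (x ^ 2)) (by fun_prop)]
          exact h1
      _ = _ := by rw [ENNReal.ofReal_mul (Nat.cast_nonneg _)]; simp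
  have hsum : ∀ W : Fin n → ℝ, ENNReal.ofReal (∑ i, W i ^ 2) = ∑ i, ENNReal.ofReal (W i ^ 2) :=
    fun W => ENNReal.ofReal_sum_of_nonneg fun _ _ => sq_nonneg _
  rcases (show 0 ≤ n * σ ^ 2 by positivity).eq_or_lt with hz | hpos
  · rw [← hz, ENNReal.ofReal_zero, nonpos_iff_eq_zero, lintegral_eq_zero_iff (by fun_prop)] at h2
    refine le_of_eq_of_le ?_ zero_le
    refine measure_mono_null (fun W hW => ?_) h2
    rw [Set.mem_ofPred_eq, mul_left_comm, ← hz, mul_zero] at hW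
    simp only [Set.mem_compl_iff, Set.mem_ofPred_eq, ← hsum, Pi.zero_apply,
      ENNReal.ofReal_eq_zero, not_le]
    exact hW
  · have hna : 0 < n * (a * σ ^ 2) := by rw [mul_left_comm]; positivity
    have e : 1 / a = n * σ ^ 2 / (n * (a * σ ^ 2)) := by
      rw [mul_left_comm, div_mul_cancel_right₀ hpos.ne', one_div]
    rw [e, ENNReal.ofReal_div_of_pos hna,
      ENNReal.le_div_iff_mul_le (Or.inl (ENNReal.ofReal_pos.2 hna).ne')
        (Or.inl ENNReal.ofReal_ne_top), mul_comm]
    refine le_trans ?_ ((mul_meas_ge_le_lintegral (by fun_prop)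
      (ENNReal.ofReal (n * (a * σ ^ 2)))).trans h2)
    gcongr with W
    intro hW
    rw [← hsum]
    exact ENNReal.ofReal_le_ofReal hW.le

end

/-! ### The greatest common divisor of the randomly shifted vector -/

/-- Among `L` consecutive integers there are at most `⌈L / q⌉` in a given residue class. -/
theorem card_filter_dvd_add_mul_le (a u : ℤ) {q L : ℕ} (hq : 0 < q) :
    (((Finset.Icc (u + 1) (u + L)).filter fun z => (q : ℤ) ∣ a + z).card : ℤ) * q ≤ L + q - 1 := by
  have hq' : (0 : ℤ) < q := by exact_mod_cast hq
  have e : (Finset.Icc (u + 1) (u + L)).filter (fun z => (q : ℤ) ∣ a + z) =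
      (Finset.Ioc u (u + L)).filter fun z => z ≡ -a [ZMOD q] := by
    ext z
    simp only [Finset.mem_filter, Finset.mem_Icc, Finset.mem_Ioc, Int.add_one_le_iff]
    refine and_congr_right fun _ => ?_
    rw [Int.modEq_comm, Int.modEq_iff_dvd, sub_neg_eq_add, add_comm]
  rw [e, Int.Ioc_filter_modEq_card _ _ hq']
  have h1 : ∀ x : ℤ, ⌊((x : ℤ) - ((-a : ℤ) : ℚ)) / ((q : ℤ) : ℚ)⌋ = (x + a) / q := by
    intro x
    rw [← Int.cast_sub, Int.cast_natCast, Rat.floor_intCast_div_natCast, sub_neg_eq_add]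
  rw [h1, h1]
  have h2 := Int.mul_ediv_self_le (x := u + L + a) hq'.ne'
  have h3 := Int.lt_mul_ediv_self_add (x := u + a) hq'
  rcases max_cases ((u + L + a) / (q : ℤ) - (u + a) / q) 0 with h | h
  · rw [h.1]; linarith
  · rw [h.1]; omega

theorem uniformOn_Icc_dvd_le (a u : ℤ) {q L : ℕ} (hq : 2 ≤ q) (hL : 2 ≤ L) :
    ProbabilityTheory.uniformOn (Set.Icc (u + 1) (u + L)) {z | (q : ℤ) ∣ a + z} ≤
      ENNReal.ofReal (3 / 4) ∧
    (q ≤ 3 * L → ProbabilityTheory.uniformOn (Set.Icc (u + 1) (u + L)) {z | (q : ℤ) ∣ a + z} ≤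
      ENNReal.ofReal (4 / q)) := by
  have hcard := card_filter_dvd_add_mul_le a u (q := q) (L := L) (by omega)
  set k := ((Finset.Icc (u + 1) (u + L)).filter fun z => (q : ℤ) ∣ a + z).card with hk
  have hL0 : (0 : ℝ) < L := by exact_mod_cast (by omega : 0 < L)
  have hq0 : (0 : ℝ) < q := by exact_mod_cast (by omega : 0 < q)
  have e : ProbabilityTheory.uniformOn (Set.Icc (u + 1) (u + L)) {z | (q : ℤ) ∣ a + z} =
      ENNReal.ofReal (k / L) := by
    rw [← ProbabilityTheory.uniformOn_inter_self (Set.finite_Icc _ _)]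
    have e1 : Set.Icc (u + 1) (u + L) ∩ {z | (q : ℤ) ∣ a + z} =
        ((Finset.Icc (u + 1) (u + L)).filter fun z => (q : ℤ) ∣ a + z : Finset ℤ) := by
      ext z; simp
    rw [e1, ← Finset.coe_Icc, ProbabilityTheory.uniformOn_apply_finset,
      Finset.inter_eq_right.2 (Finset.filter_subset _ _), ENNReal.ofReal_div_of_pos hL0]
    simp [hk]
  have h1 : (k : ℝ) * q ≤ L + q - 1 := by exact_mod_cast hcard
  have hq2 : (2 : ℝ) ≤ q := by exact_mod_cast hq
  have hL2 : (2 : ℝ) ≤ L := by exact_mod_cast hL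
  rw [e]
  refine ⟨ENNReal.ofReal_le_ofReal ?_, fun h => ENNReal.ofReal_le_ofReal ?_⟩
  · rw [div_le_div_iff₀ hL0 (by norm_num)]
    refine le_of_mul_le_mul_right ?_ hq0
    nlinarith [mul_nonneg (sub_nonneg.2 hq2) (sub_nonneg.2 hL2)]
  · have h' : (q : ℝ) ≤ 3 * L := by exact_mod_cast h
    rw [div_le_div_iff₀ hL0 hq0]
    linarith

/-- The entries of the shifted vector are unlikely to have a common divisor `q ≥ 2`: all of them
are divisible by `q` with probability at most `(min (3 / 4) (4 / q)) ^ p`, which is summable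
over `q`. -/
theorem pi_uniformOn_gcd_ne_one_le {p r l : ℕ} (hp : 2 ≤ p) (hr : 1 ≤ r) (hl : 1 ≤ l)
    {β : Fin p → ℤ} (hβ : ∀ j, |β j| ≤ r) :
    Measure.pi (fun _ : Fin p =>
        ProbabilityTheory.uniformOn (Set.Icc ((r : ℤ) + 1) (2 * r + l)))
      {z | (∀ j, z j ∈ Set.Icc ((r : ℤ) + 1) (2 * r + l)) ∧
        Finset.univ.gcd (fun j => (β j + z j).toNat) ≠ 1} ≤
      ENNReal.ofReal (29 * (3 / 4) ^ p) := by
  obtain ⟨L, hL⟩ : ∃ L, L = r + l := ⟨_, rfl⟩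
  have e : (2 * r + l : ℤ) = r + (L : ℤ) := by rw [hL]; push_cast; ring
  rw [e]
  have : IsProbabilityMeasure
      (ProbabilityTheory.uniformOn (Set.Icc ((r : ℤ) + 1) (r + (L : ℤ)))) :=
    ProbabilityTheory.isProbabilityMeasure_uniformOn (Set.finite_Icc _ _)
      (Set.nonempty_Icc.2 (by omega))
  have hsub : {z : Fin p → ℤ | (∀ j, z j ∈ Set.Icc ((r : ℤ) + 1) (r + (L : ℤ))) ∧
      Finset.univ.gcd (fun j => (β j + z j).toNat) ≠ 1} ⊆
      ⋃ q ∈ Finset.Ioc 1 (3 * L), Set.univ.pi fun j => {z : ℤ | (q : ℤ) ∣ β j + z} := by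
    rintro z ⟨hz, hg⟩
    have hpos : ∀ j, 0 < β j + z j := fun j => by
      have := (abs_le.1 (hβ j)).1
      have := (hz j).1
      omega
    set g := Finset.univ.gcd fun j => (β j + z j).toNat with hgdef
    have hdvd : ∀ j, (g : ℤ) ∣ β j + z j := fun j => by
      have h1 : g ∣ (β j + z j).toNat := Finset.gcd_dvd (Finset.mem_univ j)
      rw [← Int.toNat_of_nonneg (hpos j).le]
      exact_mod_cast h1
    let j₀ : Fin p := ⟨0, by omega⟩
    have hle : (g : ℤ) ≤ β j₀ + z j₀ := Int.le_of_dvd (hpos j₀) (hdvd j₀)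
    have hg0 : g ≠ 0 := by
      intro h0
      have h1 := hdvd j₀
      rw [h0, Nat.cast_zero, zero_dvd_iff] at h1
      exact (hpos j₀).ne' h1
    have h2 := (abs_le.1 (hβ j₀)).2
    have h3 := (hz j₀).2
    exact Set.mem_biUnion (x := g) (Finset.mem_Ioc.2 ⟨by omega, by omega⟩) fun j _ => hdvd j
  refine (measure_mono hsub).trans ((measure_biUnion_finset_le _ _).trans ?_)
  obtain ⟨k, rfl⟩ : ∃ k, p = k + 2 := ⟨p - 2, by omega⟩
  calc _ ≤ ∑ q ∈ Finset.Ioc 1 (3 * L), ENNReal.ofReal ((3 / 4) ^ k * (4 / q) ^ 2) := by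
        refine Finset.sum_le_sum fun q hq => ?_
        obtain ⟨hq1, hq2⟩ := Finset.mem_Ioc.1 hq
        have hb := fun j => uniformOn_Icc_dvd_le (β j) (r : ℤ) (q := q) (L := L) hq1 (by omega)
        rw [Measure.pi_pi, Fin.prod_univ_add, ENNReal.ofReal_mul (by positivity),
          ENNReal.ofReal_pow (by norm_num), ENNReal.ofReal_pow (by positivity)]
        refine mul_le_mul' ?_ ?_
        · exact (Finset.prod_le_prod' fun j _ => (hb _).1).trans (by simp)
        · exact (Finset.prod_le_prod' fun j _ => (hb _).2 hq2).trans (by simp)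
    _ = ENNReal.ofReal (∑ q ∈ Finset.Ioc 1 (3 * L), (3 / 4) ^ k * (4 / (q : ℝ)) ^ 2) :=
        (ENNReal.ofReal_sum_of_nonneg fun _ _ => by positivity).symm
    _ ≤ _ := by
        refine ENNReal.ofReal_le_ofReal ?_
        have h1 := sum_Ioc_inv_sq_le_sub (α := ℝ) (k := 1) (n := 3 * L) one_ne_zero (by omega)
        have h2 : ∑ q ∈ Finset.Ioc 1 (3 * L), (((q : ℕ) : ℝ) ^ 2)⁻¹ ≤ 1 := by
          refine h1.trans ?_
          rw [Nat.cast_one, inv_one]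
          exact sub_le_self _ (by positivity)
        calc _ = (3 / 4) ^ k * 16 * ∑ q ∈ Finset.Ioc 1 (3 * L), (((q : ℕ) : ℝ) ^ 2)⁻¹ := by
              rw [Finset.mul_sum]
              refine Finset.sum_congr rfl fun q _ => ?_
              rw [div_pow]; ring
          _ ≤ (3 / 4) ^ k * 16 * 1 := by gcongr
          _ ≤ _ := by
            rw [pow_add]
            have : (0 : ℝ) ≤ (3 / 4) ^ k := by positivity
            linarith

/-! ### The algorithm succeeds with high probability -/

theorem isProbabilityMeasure_uniformOn_shift {r : ℕ} (hr : 0 < r) (l : ℕ) :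
    IsProbabilityMeasure (ProbabilityTheory.uniformOn (Set.Icc ((r : ℤ) + 1) (2 * r + l))) :=
  ProbabilityTheory.isProbabilityMeasure_uniformOn (Set.finite_Icc _ _)
    (Set.nonempty_Icc.2 (by omega))

theorem withDensity_le_mul_volume {f : ℝ → ENNReal} {c : ℝ}
    (hf : ∀ᵐ x, f x ≤ ENNReal.ofReal c) (s : Set ℝ) :
    volume.withDensity f s ≤ ENNReal.ofReal c * volume s := by
  have h := withDensity_mono (μ := volume) hf
  rw [withDensity_const] at h
  exact h s

/-- The input length is a natural number up to rounding, and rounding it is harmless. -/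
theorem exists_bitLength {n p N Q R : ℕ} {W : ℝ} (hn : 0 < n) (hp : 0 < p) (hN : 0 < N)
    (hQ : 0 < Q) (hR : 0 < R) (hW : 0 < W) :
    ∃ s : ℕ, 3 ≤ s ∧ n ≤ s ∧ p ≤ s ∧ N ≤ s ∧ Q ≤ 2 ^ s ∧ R ≤ 2 ^ s ∧ W ≤ 2 ^ s ∧
      (((12 * s) ^ 703 : ℕ) : ℝ) ≤ (2812 : ℕ) * (n + p + N + Real.logb 2 R +
        max 0 (Real.logb 2 W) + Real.logb 2 Q) ^ 2812 := by
  have two : (1 : ℝ) < 2 := by norm_num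
  have hn1 : (1 : ℝ) ≤ n := by exact_mod_cast hn
  have hp1 : (1 : ℝ) ≤ p := by exact_mod_cast hp
  have hN1 : (1 : ℝ) ≤ N := by exact_mod_cast hN
  have hQ1 : (1 : ℝ) ≤ Q := by exact_mod_cast hQ
  have hR1 : (1 : ℝ) ≤ R := by exact_mod_cast hR
  have hQl : 0 ≤ Real.logb 2 Q := Real.logb_nonneg two hQ1
  have hRl : 0 ≤ Real.logb 2 R := Real.logb_nonneg two hR1
  have hWl := le_max_left 0 (Real.logb 2 W)
  obtain ⟨x, hx⟩ : ∃ x : ℝ, x = n + p + N + Real.logb 2 R + max 0 (Real.logb 2 W) +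
    Real.logb 2 Q := ⟨_, rfl⟩
  rw [← hx]
  have hx3 : 3 ≤ x := by linarith
  have hxs : x ≤ ⌈x⌉₊ := Nat.le_ceil x
  have hsx : (⌈x⌉₊ : ℝ) ≤ 2 * x := by
    linarith [Nat.ceil_lt_add_one (by linarith : 0 ≤ x)]
  have hpow : ∀ {y : ℝ}, 0 < y → Real.logb 2 y ≤ x → y ≤ 2 ^ ⌈x⌉₊ := by
    intro y hy h
    rw [Real.logb_le_iff_le_rpow two hy] at h
    rw [← Real.rpow_natCast]
    exact h.trans (Real.rpow_le_rpow_of_exponent_le two.le hxs)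
  refine ⟨⌈x⌉₊, ?_, ?_, ?_, ?_, ?_, ?_, ?_, ?_⟩
  · exact_mod_cast hx3.trans hxs
  · exact_mod_cast (by linarith : (n : ℝ) ≤ ⌈x⌉₊)
  · exact_mod_cast (by linarith : (p : ℝ) ≤ ⌈x⌉₊)
  · exact_mod_cast (by linarith : (N : ℝ) ≤ ⌈x⌉₊)
  · exact_mod_cast hpow (by linarith : (0 : ℝ) < Q) (by linarith)
  · exact_mod_cast hpow (by linarith : (0 : ℝ) < R) (by linarith)
  · exact hpow hW (by linarith [le_max_right 0 (Real.logb 2 W)])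
  · have h1 : (12 * ⌈x⌉₊ : ℝ) ≤ x ^ 4 := by
      have h2 : (3 : ℝ) ^ 3 ≤ x ^ 3 := pow_le_pow_left₀ (by norm_num) hx3 3
      calc (12 * ⌈x⌉₊ : ℝ) ≤ 3 ^ 3 * x := by linarith
        _ ≤ x ^ 3 * x := by gcongr
        _ = x ^ 4 := by ring
    rw [Nat.cast_pow, Nat.cast_mul, Nat.cast_ofNat]
    calc (12 * (⌈x⌉₊ : ℝ)) ^ 703 ≤ (x ^ 4) ^ 703 := pow_le_pow_left₀ (by positivity) h1 _
      _ = x ^ 2812 := (pow_mul x 4 703).symm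
      _ ≤ (2812 : ℕ) * x ^ 2812 := le_mul_of_one_le_left (by positivity) (by norm_num)

theorem LBRRecovers.mono {n p N Q R : ℕ} {Y : Fin n → ℝ} {X : Fin n → Fin p → ℝ} {W : ℝ}
    {Z : Fin p → ℤ} {β : Fin p → ℝ} {T T' : ℝ} (h : LBRRecovers Y X N Q R W Z β T)
    (hT : T ≤ T') : LBRRecovers Y X N Q R W Z β T' := by
  obtain ⟨fuel, out, h1, h2, h3⟩ := h
  exact ⟨fuel, out, h1, h2, h3.trans hT⟩

/-- The failure probability is the sum of five contributions: a large measurement matrix, large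
noise, a common divisor of the shifted vector, a small measurement of the shifted vector, and
the existence of a spurious short lattice vector. -/
theorem jointLaw_failure_le {n p N Q Qhat Rhat s : ℕ} {R σ What c M : ℝ} {μX μW : Measure ℝ}
    [IsProbabilityMeasure μX] [IsProbabilityMeasure μW] {β : Fin p → ℝ}
    (hn : 0 < n) (hp : 2 ≤ p) (hQ : 0 < Q) (hQhat : 0 < Qhat) (hRhat : 0 < Rhat)
    (hσ : 0 ≤ σ) (hWhat : 0 < What) (hc : 0 < c)
    (hμ : ∀ s, μX s ≤ ENNReal.ofReal c * volume s) (hint : Integrable (fun x => x) μX)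
    (hM : ∫ x, |x| ∂μX ≤ M) (hL2 : MemLp (fun x => x) 2 μW) (h0 : ∫ x, x ∂μW = 0)
    (hvar : ProbabilityTheory.variance (fun x => x) μW ≤ σ ^ 2)
    (hβ : ∀ j, |β j| ≤ R) (hrat : IsRationalWith Q β) (hdvd : Q ∣ Qhat) (hR : R ≤ Rhat)
    (hσW : √(n * p) * σ ≤ What)
    (hprec : (N : ℝ) > 1 / 2 * (2 * n + p) *
        (2 * n + p + 10 * Real.logb 2 Qhat
          + 10 * Real.logb 2 (2 ^ N * √(n * p) * σ + Rhat * p)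
          + 20 * Real.logb 2 (3 * (1 + c) * n * p)))
    (hMP : M ≤ n * p) (hs : 3 ≤ s) (hns : n ≤ s) (hps : p ≤ s) (hNs : N ≤ s)
    (hQs : Qhat ≤ 2 ^ s) (hRs : Rhat ≤ 2 ^ s) (hWs : What ≤ 2 ^ s) :
    jointLaw n p Qhat Rhat μX μW
      {ω | ¬ LBRRecovers (observations ω.1 β ω.2.1) ω.1 N Qhat Rhat What ω.2.2 β
        (((12 * s) ^ 703 : ℕ) : ℝ)} ≤
      ENNReal.ofReal (5 / (n * p) + 29 * (3 / 4) ^ p) := by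
  have hp0 : 0 < p := by omega
  have hQ1 : (1 : ℝ) ≤ Qhat := by exact_mod_cast hQhat
  have hR1 : (1 : ℝ) ≤ Rhat := by exact_mod_cast hRhat
  have hp1 : (1 : ℝ) ≤ p := by exact_mod_cast hp0
  have hn1 : (1 : ℝ) ≤ n := by exact_mod_cast hn
  obtain ⟨P, hP⟩ : ∃ P : ℝ, P = n * p := ⟨_, rfl⟩
  obtain ⟨C, hC⟩ : ∃ C : ℝ, C = 1 + c := ⟨_, rfl⟩
  obtain ⟨H, hH⟩ : ∃ H : ℝ, H = √(2 ^ (p + n + n)) := ⟨_, rfl⟩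
  obtain ⟨S, hS⟩ : ∃ S : ℝ, S = 2 ^ N * √(n * p) * σ + Rhat * p := ⟨_, rfl⟩
  obtain ⟨A, hA⟩ : ∃ A : ℝ, A = Qhat * S := ⟨_, rfl⟩
  have hP1 : 1 ≤ P := by rw [hP]; exact one_le_mul_of_one_le_of_one_le hn1 hp1
  have hC1 : 1 ≤ C := by linarith
  have hH1 : 1 ≤ H := by
    rw [hH, Real.one_le_sqrt]; exact one_le_pow₀ (by norm_num)
  have hS1 : 1 ≤ S := by
    have h1 := one_le_mul_of_one_le_of_one_le hR1 hp1
    have h2 : 0 ≤ 2 ^ N * √(n * p) * σ := by positivity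
    linarith
  have hA1 : 1 ≤ A := by rw [hA]; exact one_le_mul_of_one_le_of_one_le hQ1 hS1
  have hgrowth : (2 ^ (p + n + n) * A ^ 10 * (3 * (C * P)) ^ 20) ^ (p + n + n) ≤ (4 : ℝ) ^ N := by
    rw [hA]
    refine pow_le_four_pow_of_lt (by linarith) (by linarith) (by positivity) ?_
    rw [hS, hC, hP, show 3 * ((1 + c) * (n * p : ℝ)) = 3 * (1 + c) * n * p by ring]
    exact hprec
  -- the integer vector `Qhat * β`
  obtain ⟨βq, hβq⟩ : ∃ βq : Fin p → ℤ, ∀ j, (βq j : ℝ) = Qhat * β j := by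
    choose k hk using hrat
    obtain ⟨e, rfl⟩ := hdvd
    refine ⟨fun j => e * k j, fun j => ?_⟩
    have : (Q : ℝ) ≠ 0 := by exact_mod_cast hQ.ne'
    rw [hk]; push_cast; field_simp
  have hβR : ∀ j, |β j| ≤ Rhat := fun j => (hβ j).trans hR
  have hβqR : ∀ j, |βq j| ≤ (Qhat * Rhat : ℕ) := fun j => by
    have : |(βq j : ℝ)| ≤ Qhat * Rhat := by
      rw [hβq, abs_mul, Nat.abs_cast]
      exact mul_le_mul_of_nonneg_left (hβR j) (by positivity)
    exact_mod_cast this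
  have hr : 0 < Qhat * Rhat := Nat.mul_pos hQhat hRhat
  have hlog : 1 ≤ Nat.log 2 p := Nat.le_log_of_pow_le (by norm_num) (by simpa using hp)
  have := isProbabilityMeasure_uniformOn_shift hr (Nat.log 2 p)
  -- the size of the measurements of `x - y i • b` for a spurious vector `(x, y)`
  set t := 480 * (H * C * P ^ 7 * A ^ 2) / 2 ^ N with ht
  -- the values which `Z` takes with positive probability
  have hz : ∀ z : Fin p → ℤ, (Measure.pi fun _ : Fin p => ProbabilityTheory.uniformOn
      (Set.Icc ((Qhat * Rhat : ℕ) + 1 : ℤ) (2 * (Qhat * Rhat : ℕ) + Nat.log 2 p))) {z} ≠ 0 →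
      ∀ j, z j ∈ Set.Icc ((Qhat * Rhat : ℕ) + 1 : ℤ) (2 * (Qhat * Rhat : ℕ) + Nat.log 2 p) := by
    intro z h j
    rw [Measure.pi_singleton, Finset.prod_ne_zero_iff] at h
    by_contra hj
    refine h j (Finset.mem_univ j) ?_
    rw [ProbabilityTheory.uniformOn_eq_zero_iff (Set.finite_Icc _ _)]
    exact Set.inter_singleton_eq_empty.2 hj
  have hbpos : ∀ z : Fin p → ℤ, (∀ j, z j ∈ Set.Icc ((Qhat * Rhat : ℕ) + 1 : ℤ)
      (2 * (Qhat * Rhat : ℕ) + Nat.log 2 p)) → ∀ j, 0 < βq j + z j := by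
    intro z h j
    have h1 := (abs_le.1 (hβqR j)).1
    have h2 := (h j).1
    omega
  rw [jointLaw]
  have hX : (Measure.pi fun _ : Fin n => Measure.pi fun _ : Fin p => μX)
      {X | P ^ 3 < ∑ i, ∑ j, |X i j|} ≤ ENNReal.ofReal (1 / P) := by
    refine (pi_lt_sum_abs_le (by positivity) hint hM).trans (ENNReal.ofReal_le_ofReal ?_)
    rw [← hP] at hMP ⊢
    rw [div_le_div_iff₀ (by positivity) (by positivity)]
    have h1 : P * M * P ≤ P * P * P := by gcongr
    linarith [show 1 * P ^ 3 = P * P * P by ring]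
  have hW : (Measure.pi fun _ : Fin n => μW) {W | n * (P * σ ^ 2) < ∑ i, W i ^ 2} ≤
      ENNReal.ofReal (1 / P) := pi_lt_sum_sq_le (by positivity) hL2 h0 hvar
  have hZ := pi_uniformOn_gcd_ne_one_le hp hr hlog hβqR
  -- for fixed `Z`: small measurements of `b`, and spurious vectors
  have hB : ∀ z : Fin p → ℤ, (Measure.pi fun _ : Fin p => ProbabilityTheory.uniformOn
      (Set.Icc ((Qhat * Rhat : ℕ) + 1 : ℤ) (2 * (Qhat * Rhat : ℕ) + Nat.log 2 p))) {z} ≠ 0 →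
      (Measure.pi fun _ : Fin n => Measure.pi fun _ : Fin p => μX)
        ({X | ∃ i, |∑ j, X i j * ((βq j + z j : ℤ) : ℝ)| ≤ 1 / (C * P ^ 2)} ∪
        {X | ∃ (x : Fin p → ℤ) (y : Fin n → ℤ), (∀ j, |(x j : ℝ)| ≤ 8 * (H * P * A)) ∧
          (∀ i, |(y i : ℝ)| ≤ 32 * (H * C * P ^ 6 * A)) ∧
          (∀ i, ∃ j, x j ≠ y i * (βq j + z j)) ∧
          ∀ i, |∑ j, X i j * ((x j - y i * (βq j + z j) : ℤ) : ℝ)| ≤ t}) ≤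
        ENNReal.ofReal (3 / P) := by
    intro z h
    have hb := hbpos z (hz z h)
    have h1 : (n * (2 * c * (1 / (C * P ^ 2))) : ℝ) ≤ 2 / P := by
      have h2 : n * c ≤ P * C := by
        rw [hP]
        exact mul_le_mul (le_mul_of_one_le_right (by positivity) hp1) (by linarith) hc.le
          (by positivity)
      rw [le_div_iff₀ (by positivity)]
      calc (n * (2 * c * (1 / (C * P ^ 2))) : ℝ) * P = 2 * ((n * c) / (P * C)) := by
            field_simp
        _ ≤ 2 * 1 := by gcongr; exact div_le_one_of_le₀ h2 (by positivity)
        _ = 2 := by norm_num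
    have h2 : (3 * (8 * (H * P * A))) ^ p * (3 * (32 * (H * C * P ^ 6 * A))) ^ n *
        (2 * c * t) ^ n ≤ 1 / P := by
      refine le_trans ?_ (card_mul_prob_le hn hA1 hP1 hC1 hH rfl hgrowth)
      rw [show 3 * (8 * (H * P * A)) = 24 * (H * P * A) by ring,
        show 3 * (32 * (H * C * P ^ 6 * A)) = 96 * (H * C * P ^ 6 * A) by ring]
      refine mul_le_mul_of_nonneg_left (pow_le_pow_left₀ (by positivity) ?_ n) (by positivity)
      calc 2 * c * t ≤ 2 * C * t := by gcongr; linarith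
        _ = _ := by rw [ht]; ring
    have hHPA := one_le_mul_of_one_le_of_one_le (one_le_mul_of_one_le_of_one_le hH1 hP1) hA1
    have hHCPA := one_le_mul_of_one_le_of_one_le (one_le_mul_of_one_le_of_one_le
      (one_le_mul_of_one_le_of_one_le hH1 hC1) (one_le_pow₀ (n := 6) hP1)) hA1
    refine (measure_union_le _ _).trans ?_
    rw [show 3 / P = 2 / P + 1 / P by ring, ENNReal.ofReal_add (by positivity) (by positivity)]
    refine add_le_add ?_ ?_
    · refine (pi_exists_abs_sum_mul_le hμ hc.le (v := fun j => βq j + z j) ?_).trans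
        (ENNReal.ofReal_le_ofReal h1)
      exact fun h3 => (hb ⟨0, hp0⟩).ne' (congrFun h3 _)
    · exact (pi_exists_candidate_le hμ hc.le (by linarith) (by linarith) (by positivity)).trans
        (ENNReal.ofReal_le_ofReal h2)
  refine (prod_prod_apply_le hB (SX := {X | P ^ 3 < ∑ i, ∑ j, |X i j|})
    (SW := {W | n * (P * σ ^ 2) < ∑ i, W i ^ 2}) (SZ := {z | (∀ j, z j ∈ Set.Icc
      ((Qhat * Rhat : ℕ) + 1 : ℤ) (2 * (Qhat * Rhat : ℕ) + Nat.log 2 p)) ∧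
        Finset.univ.gcd (fun j => (βq j + z j).toNat) ≠ 1}) fun X W z h hfail => ?_).trans ?_
  · by_contra hgood
    simp only [not_or] at hgood
    obtain ⟨g1, g2, g3, g4⟩ := hgood
    rw [Set.mem_union, not_or] at g4
    obtain ⟨g4, g5⟩ := g4
    refine hfail (LBRRecovers_of_typical (s := s) (βq := βq)
      (b := fun j => (βq j + z j).toNat) hn hp0 hQhat hRhat hσ hWhat hσW hβR hβq
      (hA.trans (by rw [hS])) hP hC1 hH (le_two_pow_of_pow_le hp0 hA1 hP1 hC1 hH rfl hgrowth)
      hs hns hps hNs hQs hRs hWs ?_ ?_ ?_ ?_ ?_ ?_ ?_ ?_)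
    · exact fun j => Int.toNat_of_nonneg (hbpos z (hz z h) j).le
    · intro j
      have := (hz z h j).1
      push_cast at this
      exact this
    · intro j
      have h1 := (hz z h j).2
      have h2 : (Nat.log 2 p : ℤ) ≤ p := by exact_mod_cast Nat.log_le_self 2 p
      push_cast at h1
      linarith
    · by_contra hg
      exact g3 ⟨hz z h, hg⟩
    · have h1 : (√(n * p) * σ) ^ 2 = P * σ ^ 2 := by
        rw [mul_pow, Real.sq_sqrt (by positivity), hP]
      rw [h1]
      exact not_lt.1 g2
    · exact not_lt.1 g1
    · intro i
      by_contra hi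
      refine g4 ⟨i, ?_⟩
      have e : ∀ j, ((βq j + z j : ℤ) : ℝ) = ((βq j + z j).toNat : ℝ) := fun j => by
        rw [← Int.cast_natCast, Int.toNat_of_nonneg (hbpos z (hz z h) j).le]
      simp only [e]
      exact (not_le.1 hi).le
    · intro x y hx hy hne
      have e : ∀ j, (((βq j + z j).toNat : ℕ) : ℤ) = βq j + z j := fun j =>
        Int.toNat_of_nonneg (hbpos z (hz z h) j).le
      by_contra hall
      push Not at hall
      simp only [e] at hne hall
      exact g5 ⟨x, y, hx, hy, hne, hall⟩
  · refine (add_le_add (add_le_add (add_le_add hX hW) hZ) le_rfl).trans ?_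
    rw [← ENNReal.ofReal_add (by positivity) (by positivity),
      ← ENNReal.ofReal_add (by positivity) (by positivity),
      ← ENNReal.ofReal_add (by positivity) (by positivity), ← hP]
    refine ENNReal.ofReal_le_ofReal (le_of_eq ?_)
    ring

/-! ### Comparison of the error terms -/

/-- The rate `1 / 10` is small enough for `exp (1 / 10) * (3 / 4) ≤ (10 / 9) * (3 / 4) = 5 / 6 < 1`,
which leaves room for the factor `p`. -/
theorem exp_tenth_mul_le (p : ℕ) : p * (Real.exp (1 / 10 * p) * (3 / 4) ^ p) ≤ 5 := by
  have h1 : Real.exp (1 / 10) ≤ 10 / 9 := by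
    have := Real.exp_bound_div_one_sub_of_interval (x := 1 / 10) (by norm_num) (by norm_num)
    linarith
  have h2 : Real.exp (1 / 10 * p) * (3 / 4) ^ p ≤ (5 / 6) ^ p := by
    rw [mul_comm (1 / 10 : ℝ), Real.exp_nat_mul, ← mul_pow]
    exact pow_le_pow_left₀ (by positivity) (by linarith) p
  have h3 : (p : ℝ) ≤ 5 * (6 / 5) ^ p := by
    have := one_add_mul_le_pow (a := (1 / 5 : ℝ)) (by norm_num) p
    rw [show (6 / 5 : ℝ) = 1 + 1 / 5 by norm_num]
    linarith
  calc p * (Real.exp (1 / 10 * p) * (3 / 4) ^ p) ≤ 5 * (6 / 5) ^ p * (5 / 6) ^ p := by gcongr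
    _ = 5 := by rw [mul_assoc, ← mul_pow]; norm_num

theorem three_quarters_pow_le (p : ℕ) : (3 / 4 : ℝ) ^ p ≤ Real.exp (-(1 / 10 * p)) := by
  rw [mul_comm, ← mul_neg, Real.exp_nat_mul]
  exact pow_le_pow_left₀ (by norm_num) (by linarith [Real.add_one_le_exp (-(1 / 10) : ℝ)]) p

theorem mainTheorem3 :
    ∃ (κ : ℝ) (D : ℕ), 0 < κ ∧
    ∀ c M : ℝ, 0 < c → ∃ K : ℝ,
    ∀ (n p N Q Qhat Rhat : ℕ) (R σ What : ℝ)
      (μX μW : Measure ℝ) [IsProbabilityMeasure μX] [IsProbabilityMeasure μW]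
      (f : ℝ → ENNReal) (β : Fin p → ℝ),
      0 < n → 0 < p → 0 < N → 0 < Q → 0 < Qhat → 0 < Rhat → 0 < R → 0 ≤ σ → 0 < What →
      -- the law of the entries of `X` has a density bounded by `c` and a finite first moment
      Measurable f → μX = volume.withDensity f → (∀ᵐ x, f x ≤ ENNReal.ofReal c) →
      Integrable (fun x => x) μX → ∫ x, |x| ∂μX ≤ M →
      -- the law of the entries of `W` has mean zero and variance at most `σ ^ 2`
      MemLp (fun x => x) 2 μW → ∫ x, x ∂μW = 0 →
      ProbabilityTheory.variance (fun x => x) μW ≤ σ ^ 2 →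
      -- the ground truth
      (∀ j, |β j| ≤ R) → IsRationalWith Q β →
      -- the parameters of the algorithm
      Q ∣ Qhat → R ≤ Rhat → √(n * p) * σ ≤ What →
      (N : ℝ) > 1 / 2 * (2 * n + p) *
        (2 * n + p + 10 * Real.logb 2 Qhat
          + 10 * Real.logb 2 (2 ^ N * √(n * p) * σ + Rhat * p)
          + 20 * Real.logb 2 (3 * (1 + c) * n * p)) →
      let T : ℝ := D * (n + p + N + Real.logb 2 Rhat + max 0 (Real.logb 2 What)
        + Real.logb 2 Qhat) ^ D
      let failure : Set ((Fin n → Fin p → ℝ) × (Fin n → ℝ) × (Fin p → ℤ)) :=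
        {ω | ¬ LBRRecovers (observations ω.1 β ω.2.1) ω.1 N Qhat Rhat What ω.2.2 β T}
      ((n : ℝ) ≤ Real.exp (κ * p) →
        jointLaw n p Qhat Rhat μX μW failure ≤ ENNReal.ofReal (K / (n * p))) ∧
      jointLaw n p Qhat Rhat μX μW failure
        ≤ ENNReal.ofReal (K * (1 / (n * p) + Real.exp (-(κ * p)))) := by
  -- the exponent is `4 * 703`, where `(12 s) ^ 703` bounds the time and `12 s` is at most the fourth
  -- power of the input length
  refine ⟨1 / 10, 2812, by norm_num, fun c M hc => ⟨150 + |M|, ?_⟩⟩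
  intro n p N Q Qhat Rhat R σ What μX μW _ _ f β hn hp hN hQ hQhat hRhat _ hσ hWhat _ hf hfc hint
    hM hL2 h0 hvar hβ hrat hdvd hR hσW hprec T failure
  have hn1 : (1 : ℝ) ≤ n := by exact_mod_cast hn
  have hp1 : (1 : ℝ) ≤ p := by exact_mod_cast hp
  have hP : (1 : ℝ) ≤ n * p := one_le_mul_of_one_le_of_one_le hn1 hp1
  have := isProbabilityMeasure_uniformOn_shift (Nat.mul_pos hQhat hRhat) (Nat.log 2 p)
  have hle_one : jointLaw n p Qhat Rhat μX μW failure ≤ 1 := by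
    rw [jointLaw]; exact prob_le_one
  have hbound : 2 ≤ p → M ≤ n * p → jointLaw n p Qhat Rhat μX μW failure ≤
      ENNReal.ofReal (5 / (n * p) + 29 * (3 / 4) ^ p) := fun hp2 hMP => by
    obtain ⟨s, hs, hns, hps, hNs, hQs, hRs, hWs, hsT⟩ :=
      exists_bitLength hn hp hN hQhat hRhat hWhat
    have hsub : failure ⊆ {ω | ¬ LBRRecovers (observations ω.1 β ω.2.1) ω.1 N Qhat Rhat What
        ω.2.2 β (((12 * s) ^ 703 : ℕ) : ℝ)} := fun ω h h' => h (h'.mono hsT)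
    exact (measure_mono hsub).trans
      (jointLaw_failure_le hn hp2 hQ hQhat hRhat hσ hWhat hc
        (fun s => by rw [hf]; exact withDensity_le_mul_volume hfc s) hint hM hL2 h0 hvar hβ hrat
        hdvd hR hσW hprec hMP hs hns hps hNs hQs hRs hWs)
  clear_value failure
  clear hprec T
  have htriv : ∀ {x : ℝ}, 1 ≤ x → jointLaw n p Qhat Rhat μX μW failure ≤ ENNReal.ofReal x :=
    fun h => hle_one.trans (ENNReal.one_le_ofReal.2 h)
  have hexp := three_quarters_pow_le p
  by_cases hMP : n * p < M
  · -- both bounds exceed one, since `K ≥ M`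
    have h1 : 1 ≤ (150 + |M|) * (1 / (n * p : ℝ)) := by
      rw [mul_one_div, one_le_div (by linarith)]
      linarith [le_abs_self M]
    refine ⟨fun _ => htriv (by rwa [mul_one_div] at h1), htriv (h1.trans ?_)⟩
    gcongr
    linarith [Real.exp_pos (-(1 / 10 * (p : ℝ)))]
  rw [not_lt] at hMP
  have hM0 := abs_nonneg M
  rcases (Nat.succ_le_iff.2 hp).eq_or_lt with rfl | hp2
  · -- for `p = 1` both bounds exceed one; in the first claim because `n ≤ exp (1 / 10)`
    simp only [Nat.succ_eq_add_one, zero_add, Nat.cast_one, mul_one, pow_one] at *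
    refine ⟨fun h => htriv ?_, htriv ?_⟩
    · have h2 := exp_tenth_mul_le 1
      simp only [Nat.cast_one, mul_one, pow_one, one_mul] at h2
      rw [one_le_div (by linarith)]
      linarith
    · have h1 : 0 < 1 / (n : ℝ) := by positivity
      nlinarith
  · refine ⟨fun h => (hbound hp2 hMP).trans (ENNReal.ofReal_le_ofReal ?_),
      (hbound hp2 hMP).trans (ENNReal.ofReal_le_ofReal ?_)⟩
    · have h1 : n * p * (3 / 4 : ℝ) ^ p ≤ 5 := by
        refine le_trans ?_ (exp_tenth_mul_le p)
        calc n * p * (3 / 4 : ℝ) ^ p = p * (n * (3 / 4) ^ p) := by ring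
          _ ≤ _ := by gcongr
      rw [div_add' _ _ _ (by linarith)]
      refine div_le_div_of_nonneg_right ?_ (by linarith)
      linarith
    · have h1 : 0 < 1 / (n * p : ℝ) := by positivity
      have h2 := Real.exp_pos (-(1 / 10 * (p : ℝ)))
      calc 5 / (n * p : ℝ) + 29 * (3 / 4) ^ p ≤
            150 * (1 / (n * p)) + 150 * Real.exp (-(1 / 10 * p)) := by
              rw [div_eq_mul_one_div]; linarith
        _ = 150 * (1 / (n * p) + Real.exp (-(1 / 10 * p))) := by ring
        _ ≤ _ := by gcongr; linarith
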